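/- Let $K$ be a field of characteristic $0$ and let $Z\subset\mathbb P^3_K$ be a set of $9$ distinct ($K$-rational) points. We say that $Z$ is *non-degenerate* if no plane contains $Z$. We say that *the general projection of $Z$ to a plane is a complete intersection of two cubic curves* if there is a nonempty Zariski open set $U\subset\mathbb P^3_K$ such that for every $K$-rational point $P\in U$ we have $P\notin Z$ and, for every plane $H\not\ni P$, the image $\pi_P(Z)\subset H\cong\mathbb P^2_K$ of $Z$ under the projection from $P$ to $H$ has the following property: there are two cubic forms $F,G$ on $H$ without common factor that generate the homogeneous ideal of $\pi_P(Z)$. We say that $Z$ is a *$(3,3)$-grid* if there are pairwise skew lines $L_1,L_2,L_3$ and pairwise skew lines $L_1',L_2',L_3'$ in $\mathbb P^3_K$ such that each $L_i$ meets each $L_j'$ in exactly one point and $Z=\{L_i\cap L_j' : 1\le i,j\le 3\}$. Theorem. If $Z$ is non-degenerate and the general projection of $Z$ to a plane is a complete intersection of two cubic curves, then $Z$ is a $(3,3)$-grid. Conversely, if $Z$ is a $(3,3)$-grid, then $Z$ is non-degenerate and its general projection to a plane is a complete intersection of two cubic curves. -/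

import Mathlib

open scoped LinearAlgebra.Projectivization

/-- The property `Q` holds for a general point of projective `n`-space over `K`: it holds at every
point of some nonempty Zariski open set. Since the sets `{F ≠ 0}`, for `F` a form, are a basis of
the Zariski topology, it is enough to use one nonzero form `F`. -/
def HoldsAtGeneralPoint {K : Type*} [Field K] {n : ℕ}
    (Q : ℙ K (Fin (n + 1) → K) → Prop) : Prop :=
  ∃ (d : ℕ) (F : MvPolynomial (Fin (n + 1)) K), F.IsHomogeneous d ∧ F ≠ 0 ∧
    ∀ P : ℙ K (Fin (n + 1) → K), MvPolynomial.eval P.rep F ≠ 0 → Q P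

/-- A set of points of projective space is non-degenerate if no hyperplane contains it. -/
def NonDegenerate {K : Type*} [Field K] {n : ℕ} (Z : Set (ℙ K (Fin (n + 1) → K))) : Prop :=
  ∀ H : Submodule K (Fin (n + 1) → K), Module.finrank K H = n →
    ∃ p ∈ Z, ¬ p.submodule ≤ H

/-- The homogeneous ideal of a set `W` of points of projective space (over an infinite field):
the polynomials that vanish on the affine cone over `W`. -/
noncomputable def homogeneousIdealOf {K : Type*} [Field K] {n : ℕ}
    (W : Set (ℙ K (Fin (n + 1) → K))) : Ideal (MvPolynomial (Fin (n + 1)) K) :=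
  MvPolynomial.vanishingIdeal K {v : Fin (n + 1) → K | ∃ q ∈ W, v ∈ q.submodule}

/-- A set of points of the projective plane is a complete intersection of a curve of degree `a` and
a curve of degree `b` if these curves have no common component and their equations generate the
homogeneous ideal of the set. -/
def IsPlaneCompleteIntersection {K : Type*} [Field K] (a b : ℕ)
    (W : Set (ℙ K (Fin 3 → K))) : Prop :=
  ∃ F G : MvPolynomial (Fin 3) K, F.IsHomogeneous a ∧ G.IsHomogeneous b ∧ IsRelPrime F G ∧
    homogeneousIdealOf W = Ideal.span {F, G}

/-- `φ` induces the projection of projective 3-space from the point `P` to a plane. A plane not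
through `P` with a choice of homogeneous coordinates on it amounts to a linear map `K⁴ → K³` whose
kernel is the line of `K⁴` that represents `P` (such a map is onto). -/
def IsProjectionFrom {K : Type*} [Field K] (P : ℙ K (Fin 4 → K))
    (φ : (Fin 4 → K) →ₗ[K] (Fin 3 → K)) : Prop :=
  LinearMap.ker φ = P.submodule

/-- The image of a set of points under the rational map induced by `φ`; a point of `Z` whose
representatives lie in the kernel of `φ` has no image. -/
def projectedSet {K : Type*} [Field K] (φ : (Fin 4 → K) →ₗ[K] (Fin 3 → K))
    (Z : Set (ℙ K (Fin 4 → K))) : Set (ℙ K (Fin 3 → K)) :=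
  {q | ∃ p ∈ Z, q.submodule = p.submodule.map φ}

/-- The general projection of `Z` to a plane is a complete intersection of two plane curves, of
degrees `a` and `b`: for a general point `P` (in particular not in `Z`), this holds for
the projection of `Z` from `P` to any plane not through `P`. -/
def GeneralProjectionIsCompleteIntersection {K : Type*} [Field K] (a b : ℕ)
    (Z : Set (ℙ K (Fin 4 → K))) : Prop :=
  HoldsAtGeneralPoint (n := 3) fun P => P ∉ Z ∧
    ∀ φ : (Fin 4 → K) →ₗ[K] (Fin 3 → K), IsProjectionFrom P φ →
      IsPlaneCompleteIntersection a b (projectedSet φ Z)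

/-- `Z` is an `(a, b)`-grid: there are `a` pairwise skew lines `L i` and `b` pairwise skew lines
`M j` such that each `L i` meets each `M j` in exactly one point and `Z` is the set of these
points. A line of projective 3-space is a 2-dimensional subspace of `K⁴`, two lines are skew when
these subspaces meet only in `0`, and they meet in one point when the intersection has
dimension 1. -/
def IsGrid {K : Type*} [Field K] (a b : ℕ) (Z : Set (ℙ K (Fin 4 → K))) : Prop :=
  ∃ (L : Fin a → Submodule K (Fin 4 → K)) (M : Fin b → Submodule K (Fin 4 → K)),
    (∀ i, Module.finrank K (L i) = 2) ∧ (∀ j, Module.finrank K (M j) = 2) ∧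
    (∀ i i', i ≠ i' → L i ⊓ L i' = ⊥) ∧ (∀ j j', j ≠ j' → M j ⊓ M j' = ⊥) ∧
    (∀ i j, Module.finrank K ↥(L i ⊓ M j) = 1) ∧
    Z = {p | ∃ i j, p.submodule = L i ⊓ M j}

/-! Let `v` be the nine points. If the projection from `P` is cut out by two coprime cubics, the
images impose at most eight conditions on the ten-dimensional space of plane cubics. So there is a
nonzero linear relation between the values at `v` of all cubic cones with vertex `P`. The existence
of a relation is a closed condition on `P`, the vanishing of minors, hence it holds for every
vertex. Special vertices then carry the argument: a coefficient of the relation is zero as soon as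
three planes through `P` contain all other points with nonzero coefficient but not its own
(`IsCubicRelation.eq_zero`), and `P` is placed so that all coefficients would die unless the points
were in special position.

This gives three facts. No plane contains exactly four points (`card_zeroSet_ne_four`). If two
planes contain exactly three points each, all six different, and the other three points are not
collinear, then the plane of these is in the pencil of the two planes (`exists_eq_smul_add_smul`).
Eight coplanar points lie on a conic, which contradicts coprimality since the conic times any line
through the ninth image point is a cubic of the ideal (`card_zeroSet_ne_eight`). Moreover no four
points are collinear: cubics through four collinear points contain the line, but the ideal, which is
generated by cubics, does not vanish on it.

The rest of this direction is finite geometry, with the axioms of `CubicPlaneSystem`. The recurrent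
move is this: a plane through three points with at most one further point has exactly three, because
four is forbidden (`pl_triple`); given two disjoint such triples, if a plane contains the three
remaining points and one of the first triple, the remaining points are collinear (`col_of_mem`).
This excludes planes with six or seven points, so a plane with more than three points has five, and
then it produces a collinear triple. The planes through a collinear triple split the other six
points into three pairs (a `Frame`), each pair is collinear with one point of the triple, and
different pairs with different points. A second frame, on a line through such a pair, completes a `3
× 3` array with collinear rows and columns. Two rows are skew since no plane has six points.

Conversely, a grid is projected from a point off the nine planes spanned by a row and a column. The
line of a projected row then contains no points of other rows, and likewise for columns. The product
of the three row lines and the product of the three column lines generate the ideal of the nine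
points, as is seen by splitting off one line at a time. -/

section

/-! ### Linear algebra: general vectors, planes and pencils of planes -/

section LinearAlgebra

variable {K V : Type*} [Field K] [AddCommGroup V] [Module K V]

/-- A vector space over an infinite field is not a finite union of proper subspaces: a subspace
`U` has a vector outside every member of a finite family that does not contain `U`. -/
theorem Submodule.exists_mem_forall_notMem [Infinite K] {α : Type*} [Finite α]
    (U : Submodule K V) (T : α → Submodule K V) :
    ∃ x ∈ U, ∀ i, ¬ U ≤ T i → x ∉ T i := by
  classical
  have := Fintype.ofFinite α
  let s : Finset (Submodule K U) :=
    (Finset.univ.filter fun i => ¬ U ≤ T i).image fun i => (T i).comap U.subtype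
  have hs : (⊤ : Submodule K U) ∉ s := by
    intro h
    obtain ⟨i, hi, h⟩ := Finset.mem_image.1 h
    exact (Finset.mem_filter.1 hi).2 (Submodule.comap_subtype_eq_top.1 h)
  have := Subspace.biUnion_ne_univ_of_top_notMem (k := K) hs
  obtain ⟨x, hx⟩ := (Set.ne_univ_iff_exists_notMem _).1 this
  refine ⟨x, x.2, fun i hi hxi => hx ?_⟩
  simp only [Set.mem_iUnion]
  exact ⟨(T i).comap U.subtype, Finset.mem_image.2 ⟨i, by simp [hi], rfl⟩, hxi⟩

theorem exists_dual_ne_zero_of_notMem_span {s : Set V} {x : V} (hx : x ∉ Submodule.span K s) :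
    ∃ l : Module.Dual K V, (∀ a ∈ s, l a = 0) ∧ l x ≠ 0 := by
  obtain ⟨l, hl, h⟩ := Submodule.exists_le_ker_of_notMem hx
  exact ⟨l, fun a ha => h (Submodule.subset_span ha), hl⟩

/-- By exchange: if `x` were in the span of `P` and `s` but not in that of `s`, then `P` would be in
the span of `x` and `s`. With `P` the vertex, this supplies most planes of the cones below. -/
theorem exists_dual_of_notMem_span {s : Set V} {x P : V} (hx : x ∉ Submodule.span K s)
    (hP : P ∉ Submodule.span K (insert x s)) :
    ∃ l : Module.Dual K V, l P = 0 ∧ (∀ a ∈ s, l a = 0) ∧ l x ≠ 0 := by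
  obtain ⟨l, hl, h⟩ := exists_dual_ne_zero_of_notMem_span (s := insert P s) (x := x)
    fun h => hP (mem_span_insert_exchange h hx)
  exact ⟨l, hl P (by simp), fun a ha => hl a (by simp [ha]), h⟩

theorem finrank_ker_dual [FiniteDimensional K V] {f : Module.Dual K V} (hf : f ≠ 0) :
    Module.finrank K (LinearMap.ker f) + 1 = Module.finrank K V :=
  Module.Dual.finrank_ker_add_one_of_ne_zero hf

theorem finrank_span_singleton_le (a : V) : Module.finrank K (Submodule.span K {a}) ≤ 1 := by
  have := finrank_span_finset_le_card (R := K) ({a} : Finset V)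
  rwa [Set.finrank, Finset.coe_singleton, Finset.card_singleton] at this

theorem finrank_span_pair_le (a b : V) : Module.finrank K (Submodule.span K {a, b}) ≤ 2 := by
  classical
  have := finrank_span_finset_le_card (R := K) ({a, b} : Finset V)
  rw [Set.finrank, Finset.coe_pair] at this
  exact this.trans Finset.card_le_two

theorem finrank_span_triple_le (a b c : V) :
    Module.finrank K (Submodule.span K {a, b, c}) ≤ 3 := by
  classical
  have := finrank_span_finset_le_card (R := K) ({a, b, c} : Finset V)
  rw [Set.finrank, Finset.coe_insert, Finset.coe_pair] at this
  exact this.trans Finset.card_le_three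

theorem exists_dual_ne_zero_of_finrank_lt [FiniteDimensional K V] {U : Submodule K V}
    (h : Module.finrank K U < Module.finrank K V) :
    ∃ f : Module.Dual K V, f ≠ 0 ∧ ∀ x ∈ U, f x = 0 := by
  obtain ⟨f, hf, h⟩ := Submodule.exists_le_ker_of_lt_top U
    (lt_top_iff_ne_top.2 fun e => by subst e; simp at h)
  exact ⟨f, hf, h⟩

theorem le_finrank_ker_inf_ker [FiniteDimensional K V] (f g : Module.Dual K V) :
    Module.finrank K V ≤ Module.finrank K ↥(LinearMap.ker f ⊓ LinearMap.ker g) + 2 := by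
  have h1 := Submodule.finrank_sup_add_finrank_inf_eq (LinearMap.ker f) (LinearMap.ker g)
  have h2 := Submodule.finrank_le (LinearMap.ker f ⊔ LinearMap.ker g)
  have h3 : ∀ f : Module.Dual K V, Module.finrank K V ≤ Module.finrank K (LinearMap.ker f) + 1 := by
    intro f
    have := LinearMap.finrank_range_add_finrank_ker f
    have h := Submodule.finrank_le (LinearMap.range f)
    simp at h
    omega
  have := h3 f
  have := h3 g
  omega

theorem exists_eq_smul_add_smul_of_ker_le {f g h : Module.Dual K V}
    (H : LinearMap.ker f ⊓ LinearMap.ker g ≤ LinearMap.ker h) :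
    ∃ s t : K, h = s • f + t • g := by
  have := mem_span_of_iInf_ker_le_ker (L := ![f, g]) (K := h) (by
    refine le_trans (fun x hx => ?_) H
    simp only [Submodule.mem_iInf, Fin.forall_fin_two] at hx
    exact hx)
  simp only [Matrix.range_cons, Matrix.range_empty, Set.union_empty,
    Set.singleton_union, Submodule.mem_span_pair] at this
  obtain ⟨s, t, e⟩ := this
  exact ⟨s, t, e.symm⟩

/-- Two different planes through two points meet in the line through these points. -/
theorem mem_span_pair_of_dual_eq_zero [FiniteDimensional K V] (hV : Module.finrank K V = 4)
    {f g : Module.Dual K V} (hfg : ∃ z, f z = 0 ∧ g z ≠ 0) (hf : f ≠ 0) {a b x : V} (ha : a ≠ 0)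
    (hab : b ∉ Submodule.span K {a}) (hfa : f a = 0) (hfb : f b = 0) (hfx : f x = 0)
    (hga : g a = 0) (hgb : g b = 0) (hgx : g x = 0) : x ∈ Submodule.span K {a, b} := by
  have hle : Submodule.span K {a, b} ≤ LinearMap.ker f ⊓ LinearMap.ker g := by
    rw [Submodule.span_le]
    rintro y (rfl | rfl)
    · exact ⟨hfa, hga⟩
    · exact ⟨hfb, hgb⟩
  obtain ⟨z, hz1, hz2⟩ := hfg
  have hlt : LinearMap.ker f ⊓ LinearMap.ker g < LinearMap.ker f :=
    lt_of_le_of_ne inf_le_left fun e => hz2 ((e.ge (show z ∈ LinearMap.ker f from hz1)).2)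
  have h1 := Submodule.finrank_lt_finrank_of_lt hlt
  have h2 := finrank_ker_dual hf
  have h3 : Module.finrank K (Submodule.span K {a, b}) = 2 := by
    have hli : LinearIndependent K ![a, b] := by
      rw [LinearIndependent.pair_iff' ha]
      intro c hc
      exact hab (hc ▸ Submodule.smul_mem _ _ (Submodule.mem_span_singleton_self a))
    have := finrank_span_eq_card hli
    rwa [Matrix.range_cons_cons_empty, Fintype.card_fin] at this
  have := Submodule.eq_of_le_of_finrank_le hle (by omega)
  rw [this]
  exact ⟨hfx, hgx⟩

end LinearAlgebra

/-! ### Relations on cubic cones and their use at special vertices -/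

section CubicRelations

variable {K V ι : Type*} [Field K] [AddCommGroup V] [Module K V] [Fintype ι]

/-- `c` is a linear relation between the values of the cubic cones with vertex `P` at the points
`v i`. -/
def IsCubicRelation (v : ι → V) (P : V) (c : ι → K) : Prop :=
  ∀ l₁ l₂ l₃ : Module.Dual K V, l₁ P = 0 → l₂ P = 0 → l₃ P = 0 →
    ∑ i, c i * (l₁ (v i) * l₂ (v i) * l₃ (v i)) = 0

/-- Three planes through `P` form a cubic cone with vertex `P`; when it is evaluated in the
relation, only the summand of `i` survives. Relations are refuted by killing their coefficients one
after another. -/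
theorem IsCubicRelation.eq_zero {v : ι → V} {P : V} {c : ι → K} (hc : IsCubicRelation v P c)
    {i : ι} {l₁ l₂ l₃ : Module.Dual K V} (h₁ : l₁ P = 0) (h₂ : l₂ P = 0) (h₃ : l₃ P = 0)
    (hi₁ : l₁ (v i) ≠ 0) (hi₂ : l₂ (v i) ≠ 0) (hi₃ : l₃ (v i) ≠ 0)
    (hj : ∀ j ≠ i, c j = 0 ∨ l₁ (v j) = 0 ∨ l₂ (v j) = 0 ∨ l₃ (v j) = 0) : c i = 0 := by
  have := hc l₁ l₂ l₃ h₁ h₂ h₃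
  rw [Finset.sum_eq_single i] at this
  · simpa [hi₁, hi₂, hi₃] using this
  · intro j _ hji
    rcases hj j hji with h | h | h | h <;> simp [h]
  · simp

/-- The configuration `v` fails to impose independent conditions on the cubic cones with any given
vertex, no two of its points agree and no four are collinear. -/
structure FailsOnCubicCones (v : ι → V) : Prop where
  exists_relation : ∀ P : V, P ≠ 0 → ∃ c : ι → K, c ≠ 0 ∧ IsCubicRelation v P c
  notMem_span_singleton : ∀ i j, i ≠ j → v j ∉ Submodule.span K {v i}
  not_four_collinear : ∀ i j k l, i ≠ j → k ≠ i → k ≠ j → l ≠ i → l ≠ j → k ≠ l →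
    v k ∈ Submodule.span K {v i, v j} → v l ∉ Submodule.span K {v i, v j}

open Classical in
/-- The indices of the points of a configuration that lie on a plane. -/
noncomputable def zeroSet (v : ι → V) (f : Module.Dual K V) : Finset ι :=
  Finset.univ.filter fun i => f (v i) = 0

theorem mem_zeroSet {v : ι → V} {f : Module.Dual K V} {i : ι} :
    i ∈ zeroSet v f ↔ f (v i) = 0 := by
  simp [zeroSet]

namespace FailsOnCubicCones

variable {v : ι → V}

theorem ne_zero [Nontrivial ι] (hv : FailsOnCubicCones (K := K) v) (i : ι) : v i ≠ 0 := by
  obtain ⟨j, hj⟩ := exists_ne i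
  intro h
  exact hv.notMem_span_singleton j i hj (h ▸ Submodule.zero_mem _)

theorem col_rotate (hv : FailsOnCubicCones (K := K) v) {i j k : ι}
    (h : v k ∈ Submodule.span K {v i, v j}) (hjk : j ≠ k) : v i ∈ Submodule.span K {v j, v k} := by
  rw [Set.pair_comm]
  exact mem_span_insert_exchange h (hv.notMem_span_singleton _ _ hjk)

omit [Fintype ι] in
theorem col_swap {i j k : ι} (h : v k ∈ Submodule.span K {v i, v j}) :
    v k ∈ Submodule.span K {v j, v i} := by
  rwa [Set.pair_comm]

/-- Let the vertex be general on a plane with exactly four points. For each outside point, this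
plane and two planes through two pairs of the other four outside points form a cone that misses only
this point, so its coefficient is zero. The four points left are then separated by planes through
the vertex and one point each. -/
theorem card_zeroSet_ne_four [Infinite K] [FiniteDimensional K V] (hV : Module.finrank K V = 4)
    (hι : Fintype.card ι = 9) (hv : FailsOnCubicCones (K := K) v) {f : Module.Dual K V}
    (hf : f ≠ 0) : (zeroSet v f).card ≠ 4 := by
  classical
  intro h4
  have := finrank_ker_dual hf
  have : Nontrivial ι := Fintype.one_lt_card_iff_nontrivial.1 (by omega)
  -- A general `P` on the plane avoids all lines through two points and all planes through three
  -- points, except when the latter coincide with `ker f`.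
  obtain ⟨P, hPf, hP⟩ := (LinearMap.ker f).exists_mem_forall_notMem
    (fun t : ι × ι × ι => Submodule.span K {v t.1, v t.2.1, v t.2.2})
  have hP2 : ∀ i j, P ∉ Submodule.span K {v i, v j} := by
    intro i j
    have h1 := hP (i, j, j) fun hle => by
      have h1 := Submodule.finrank_mono hle
      have h2 := finrank_span_pair_le (K := K) (v i) (v j)
      rw [Set.pair_eq_singleton] at h1
      dsimp only at h1
      omega
    simpa using h1
  have hP3 : ∀ i j k, f (v i) ≠ 0 → P ∉ Submodule.span K {v i, v j, v k} := by
    intro i j k hi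
    refine hP (i, j, k) fun hle => hi ?_
    have := Submodule.eq_of_le_of_finrank_le hle
      ((finrank_span_triple_le (K := K) (v i) (v j) (v k)).trans (by omega))
    have h : v i ∈ LinearMap.ker f := by
      rw [this]; exact Submodule.subset_span (by simp)
    exact h
  have hP0 : P ≠ 0 := by
    rintro rfl
    obtain ⟨i, -⟩ := exists_pair_ne ι
    exact hP2 i i (Submodule.zero_mem _)
  obtain ⟨c, hc0, hc⟩ := hv.exists_relation P hP0
  have key : ∀ i j, i ≠ j → ∃ l : Module.Dual K V, l P = 0 ∧ l (v j) = 0 ∧ l (v i) ≠ 0 := by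
    intro i j hij
    obtain ⟨l, h1, h2, h3⟩ := exists_dual_of_notMem_span (s := {v j}) (x := v i) (P := P)
      (hv.notMem_span_singleton _ _ hij.symm) (hP2 _ _)
    exact ⟨l, h1, h2 _ rfl, h3⟩
  have hout : ∀ i, f (v i) ≠ 0 → c i = 0 := by
    intro e he
    have hcard : ((zeroSet v f)ᶜ.erase e).card = 4 := by
      rw [Finset.card_erase_of_mem (by simp [mem_zeroSet, he]), Finset.card_compl]
      omega
    obtain ⟨p, q, r, s, hpq, hpr, hps, hqr, hqs, hrs, hE⟩ := Finset.card_eq_four.1 hcard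
    have hcov : ∀ j, j ≠ e → f (v j) = 0 ∨ j = p ∨ j = q ∨ j = r ∨ j = s := by
      intro j hj
      by_cases h : f (v j) = 0
      · exact .inl h
      · have : j ∈ (zeroSet v f)ᶜ.erase e := by simp [mem_zeroSet, h, hj]
        rw [hE] at this
        simpa using Or.inr this
    have hne : ∀ x ∈ ({p, q, r, s} : Finset ι), e ≠ x := by
      rw [← hE]; intro x hx h; simp [h] at hx
    have hep := hne p (by simp)
    have heq := hne q (by simp)
    have her := hne r (by simp)
    have hes := hne s (by simp)
    have fin : ∀ x y z w, v e ∉ Submodule.span K {v x, v y} → v e ∉ Submodule.span K {v z, v w} →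
        (∀ j, j ≠ e → f (v j) = 0 ∨ j = x ∨ j = y ∨ j = z ∨ j = w) → c e = 0 := by
      intro x y z w hxy hzw hcov
      obtain ⟨l, h1, h2, h3⟩ := exists_dual_of_notMem_span hxy (hP3 _ _ _ he)
      obtain ⟨m, k1, k2, k3⟩ := exists_dual_of_notMem_span hzw (hP3 _ _ _ he)
      refine hc.eq_zero (l₁ := f) (l₂ := l) (l₃ := m) hPf h1 k1 he h3 k3 fun j hj => ?_
      rcases hcov j hj with h | rfl | rfl | rfl | rfl
      · exact .inr (.inl h)
      · exact .inr (.inr (.inl (h2 _ (by simp))))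
      · exact .inr (.inr (.inl (h2 _ (by simp))))
      · exact .inr (.inr (.inr (k2 _ (by simp))))
      · exact .inr (.inr (.inr (k2 _ (by simp))))
    have rot : ∀ x y, e ≠ x → e ≠ y → x ≠ y → v e ∈ Submodule.span K {v x, v y} →
        v y ∈ Submodule.span K {v e, v x} := fun x y h1 h2 h3 h =>
      hv.col_rotate (hv.col_rotate h h2.symm) h1
    have not2 : ∀ x y z, e ≠ x → e ≠ y → e ≠ z → x ≠ y → x ≠ z → y ≠ z →
        v e ∈ Submodule.span K {v x, v y} → v e ∉ Submodule.span K {v x, v z} :=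
      fun x y z h1 h2 h3 h4 h5 h6 h h' =>
        hv.not_four_collinear e x y z h1 h2.symm h4.symm h3.symm h5.symm h6
          (rot x y h1 h2 h4 h) (rot x z h1 h3 h5 h')
    -- A pairing of the four other outside points fails only if `v e` is on one of its two lines.
    -- Since no four points are collinear, `v e` is then off both lines of another pairing.
    by_cases h1 : v e ∈ Submodule.span K {v p, v q}
    · exact fin p r q s (not2 p q r hep heq her hpq hpr hqr h1)
        (not2 q p s heq hep hes hpq.symm hqs hps (col_swap h1)) (by grind)
    by_cases h2 : v e ∈ Submodule.span K {v r, v s}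
    · exact fin r p s q (not2 r s p her hes hep hrs hpr.symm hps.symm h2)
        (not2 s r q hes her heq hrs.symm hqs.symm hqr.symm (col_swap h2)) (by grind)
    exact fin p q r s h1 h2 hcov
  apply hc0
  funext a
  by_cases ha : f (v a) = 0
  swap
  · exact hout a ha
  have hcard : ((zeroSet v f).erase a).card = 3 := by
    rw [Finset.card_erase_of_mem (by simp [mem_zeroSet, ha])]
    omega
  obtain ⟨p, q, r, hpq, hpr, hqr, hE⟩ := Finset.card_eq_three.1 hcard
  have hne : ∀ x ∈ ({p, q, r} : Finset ι), a ≠ x := by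
    rw [← hE]; intro x hx h; simp [h] at hx
  obtain ⟨l₁, h1, h1', h1''⟩ := key a p (hne p (by simp))
  obtain ⟨l₂, h2, h2', h2''⟩ := key a q (hne q (by simp))
  obtain ⟨l₃, h3, h3', h3''⟩ := key a r (hne r (by simp))
  refine hc.eq_zero h1 h2 h3 h1'' h2'' h3'' fun j hj => ?_
  by_cases hjf : f (v j) = 0
  swap
  · exact .inl (hout j hjf)
  have : j ∈ (zeroSet v f).erase a := by simp [mem_zeroSet, hj, hjf]
  rw [hE] at this
  simp only [Finset.mem_insert, Finset.mem_singleton] at this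
  rcases this with rfl | rfl | rfl <;> simp [*]

/-- If two planes contain exactly three points each, and these six points are different, then the
plane of the other three points belongs to the pencil spanned by these two planes. -/
theorem exists_eq_smul_add_smul [Infinite K] [FiniteDimensional K V]
    (hV : Module.finrank K V = 4) (hv : FailsOnCubicCones (K := K) v)
    {a b c d e k x y z : ι} {f g h : Module.Dual K V}
    (hcov : ∀ i, i = a ∨ i = b ∨ i = c ∨ i = d ∨ i = e ∨ i = k ∨ i = x ∨ i = y ∨ i = z)
    (hab : a ≠ b) (hac : a ≠ c) (hbc : b ≠ c) (hde : d ≠ e) (hdk : d ≠ k) (hek : e ≠ k)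
    (hxy : x ≠ y) (hxz : x ≠ z) (hyz : y ≠ z)
    (hf : ∀ i, f (v i) = 0 ↔ i = a ∨ i = b ∨ i = c)
    (hg : ∀ i, g (v i) = 0 ↔ i = d ∨ i = e ∨ i = k)
    (hfg : ∀ i, f (v i) = 0 → g (v i) ≠ 0)
    (hx : f (v x) ≠ 0 ∧ g (v x) ≠ 0) (hy : f (v y) ≠ 0 ∧ g (v y) ≠ 0)
    (hz : f (v z) ≠ 0 ∧ g (v z) ≠ 0)
    (hhx : h (v x) = 0) (hhy : h (v y) = 0) (hhz : h (v z) = 0)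
    (hxyz : v z ∉ Submodule.span K {v x, v y}) :
    ∃ s t : K, h = s • f + t • g := by
  by_contra hcon
  have hker : ¬ LinearMap.ker f ⊓ LinearMap.ker g ≤ LinearMap.ker h := fun hle =>
    hcon (exists_eq_smul_add_smul_of_ker_le hle)
  have hdim := le_finrank_ker_inf_ker f g
  -- `P` is general on the axis of the pencil. It is off `h`, which is not in the pencil, and off
  -- every line through two points of which one is not on the axis.
  obtain ⟨P, ⟨hPf, hPg⟩, hP⟩ := (LinearMap.ker f ⊓ LinearMap.ker g).exists_mem_forall_notMem
    (fun t : Option (ι × ι) => t.elim (LinearMap.ker h) fun t => Submodule.span K {v t.1, v t.2})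
  have hPh : P ∉ LinearMap.ker h := hP none hker
  have hP2 : ∀ i j, (f (v i) ≠ 0 ∨ g (v i) ≠ 0) → P ∉ Submodule.span K {v i, v j} := by
    intro i j hi
    refine hP (some (i, j)) fun hle => ?_
    have := Submodule.eq_of_le_of_finrank_le hle
      ((finrank_span_pair_le (K := K) (v i) (v j)).trans (by omega))
    have h : v i ∈ LinearMap.ker f ⊓ LinearMap.ker g := by
      rw [this]; exact Submodule.subset_span (by simp)
    exact hi.elim (· h.1) (· h.2)
  have hP0 : P ≠ 0 := by
    rintro rfl
    exact hPh (Submodule.zero_mem _)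
  obtain ⟨c', hc0, hc⟩ := hv.exists_relation P hP0
  -- The cone formed by `f`, `g` and a plane `l` through `P`, `v x`, `v y` misses only `v z`,
  -- because `P` is not on the plane `h` of the three points.
  have hlast : ∀ x y z, x ≠ y → f (v z) ≠ 0 ∧ g (v z) ≠ 0 → h (v x) = 0 → h (v y) = 0 →
      h (v z) = 0 → v z ∉ Submodule.span K {v x, v y} →
      (∀ i, f (v i) = 0 ∨ g (v i) = 0 ∨ i = x ∨ i = y ∨ i = z) → c' z = 0 := by
    intro x y z hxy hz hhx hhy hhz hxyz hcov
    obtain ⟨l, h1, h2, h3⟩ := exists_dual_of_notMem_span (P := P) hxyz fun hm => hPh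
      (Submodule.span_le.2 (by rintro _ (rfl | rfl | rfl) <;> assumption) hm)
    refine hc.eq_zero (l₁ := f) (l₂ := g) (l₃ := l) hPf hPg h1 hz.1 hz.2 h3 fun j hj => ?_
    rcases hcov j with h | h | rfl | rfl | rfl
    · simp [h]
    · simp [h]
    · simp [h2]
    · simp [h2]
    · exact absurd rfl hj
  have hcov' : ∀ i, f (v i) = 0 ∨ g (v i) = 0 ∨ i = x ∨ i = y ∨ i = z := by
    intro i
    rw [hf, hg]
    rcases hcov i with h | h | h | h | h | h | h | h | h <;> simp [h]
  have hcz := hlast x y z hxy hz hhx hhy hhz hxyz hcov'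
  have hcx := hlast y z x hyz hx hhy hhz hhx
    (fun h => hxyz (hv.col_rotate (hv.col_rotate h hxz.symm) hxy))
    (fun i => by rcases hcov' i with h | h | h | h | h <;> simp [h])
  have hcy := hlast z x y hxz.symm hy hhz hhx hhy
    (fun h => hxyz (hv.col_rotate h hxy))
    (fun i => by rcases hcov' i with h | h | h | h | h <;> simp [h])
  -- Six points are left. The plane `g` contains three of them, and two planes through `P` and one
  -- point each remove two of the others.
  have hthree : ∀ (f g : Module.Dual K V) (a b c : ι), g P = 0 → b ≠ a → c ≠ a →
      P ∉ Submodule.span K {v a, v b} → P ∉ Submodule.span K {v a, v c} →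
      g (v a) ≠ 0 → (∀ i, g (v i) = 0 ∨ i = a ∨ i = b ∨ i = c ∨ c' i = 0) → c' a = 0 := by
    intro f g a b c hPg hba hca hPb hPc hga hcov
    obtain ⟨l, h1, h2, h3⟩ := exists_dual_of_notMem_span (s := {v b}) (P := P)
      (hv.notMem_span_singleton b a hba) hPb
    obtain ⟨m, k1, k2, k3⟩ := exists_dual_of_notMem_span (s := {v c}) (P := P)
      (hv.notMem_span_singleton c a hca) hPc
    refine hc.eq_zero hPg h1 k1 hga h3 k3 fun j hj => ?_
    rcases hcov j with h | rfl | rfl | rfl | h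
    · simp [h]
    · exact absurd rfl hj
    · simp [h2]
    · simp [k2]
    · simp [h]
  have hga := fun i hi => hfg i ((hf i).2 hi)
  have hfd : ∀ i, i = d ∨ i = e ∨ i = k → f (v i) ≠ 0 := fun i hi h => hfg i h ((hg i).2 hi)
  have hout : ∀ i, g (v i) = 0 ∨ i = a ∨ i = b ∨ i = c ∨ c' i = 0 := by
    intro i
    rw [hg]
    rcases hcov i with h | h | h | h | h | h | rfl | rfl | rfl <;> simp [*]
  have hout' : ∀ i, f (v i) = 0 ∨ i = d ∨ i = e ∨ i = k ∨ c' i = 0 := by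
    intro i
    rw [hf]
    rcases hcov i with h | h | h | h | h | h | rfl | rfl | rfl <;> simp [*]
  have hPa : ∀ i j, i = a ∨ i = b ∨ i = c → P ∉ Submodule.span K {v i, v j} :=
    fun i j hi => hP2 i j (.inr (hga i hi))
  have hPd : ∀ i j, i = d ∨ i = e ∨ i = k → P ∉ Submodule.span K {v i, v j} :=
    fun i j hi => hP2 i j (.inl (hfd i hi))
  apply hc0
  funext i
  rcases hcov i with rfl | rfl | rfl | rfl | rfl | rfl | rfl | rfl | rfl
  · exact hthree f g _ b c hPg hab.symm hac.symm (hPa _ _ (by simp)) (hPa _ _ (by simp))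
      (hga _ (by simp)) hout
  · exact hthree f g _ a c hPg hab hbc.symm (hPa _ _ (by simp)) (hPa _ _ (by simp))
      (hga _ (by simp)) (fun i => by rcases hout i with h | h | h | h | h <;> simp [h])
  · exact hthree f g _ a b hPg hac hbc (hPa _ _ (by simp)) (hPa _ _ (by simp))
      (hga _ (by simp)) (fun i => by rcases hout i with h | h | h | h | h <;> simp [h])
  · exact hthree g f _ e k hPf hde.symm hdk.symm (hPd _ _ (by simp)) (hPd _ _ (by simp))
      (hfd _ (by simp)) hout'
  · exact hthree g f _ d k hPf hde hek.symm (hPd _ _ (by simp)) (hPd _ _ (by simp))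
      (hfd _ (by simp)) (fun i => by rcases hout' i with h | h | h | h | h <;> simp [h])
  · exact hthree g f _ d e hPf hdk hek (hPd _ _ (by simp)) (hPd _ _ (by simp))
      (hfd _ (by simp)) (fun i => by rcases hout' i with h | h | h | h | h <;> simp [h])
  · exact hcx
  · exact hcy
  · exact hcz

end FailsOnCubicCones

end CubicRelations

end

/-! ### Eight coplanar points lie on a conic -/

section

namespace FailsOnCubicCones

variable {K V ι : Type*} [Field K] [AddCommGroup V] [Module K V] [Fintype ι] {v : ι → V}

/-- If all points but `v o` lie on a plane, and no three of them are collinear, then a conic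
through five of them contains the other ones. The conic is given by a pencil of line pairs. -/
theorem mul_eq_mul_of_forall_notMem_span [Infinite K] [FiniteDimensional K V]
    (hv : FailsOnCubicCones (K := K) v) {f : Module.Dual K V} {o a b k c₁ c₂ c₃ c₄ c₅ : ι}
    (hnd : [o, a, b, k, c₁, c₂, c₃, c₄, c₅].Nodup)
    (hcov : ∀ i, i ∈ [o, a, b, k, c₁, c₂, c₃, c₄, c₅])
    (hf : ∀ i, i ≠ o → f (v i) = 0) (hfo : f (v o) ≠ 0)
    (hncol : ∀ i j l, i ≠ o → j ≠ o → l ≠ o → i ≠ j → i ≠ l → j ≠ l →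
      v l ∉ Submodule.span K {v i, v j})
    {p q r s : Module.Dual K V} (hp₁ : p (v c₁) = 0) (hp₂ : p (v c₂) = 0) (hq₃ : q (v c₃) = 0)
    (hq₄ : q (v c₄) = 0) (hr₁ : r (v c₁) = 0) (hr₃ : r (v c₃) = 0) (hs₂ : s (v c₂) = 0)
    (hs₄ : s (v c₄) = 0) :
    p (v c₅) * q (v c₅) * (r (v k) * s (v k)) = r (v c₅) * s (v c₅) * (p (v k) * q (v k)) := by
  simp only [List.mem_cons, List.not_mem_nil, or_false] at hcov
  simp only [List.nodup_cons, List.mem_cons, List.not_mem_nil, or_false, not_or,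
    List.nodup_nil, not_false_eq_true, and_true] at hnd
  obtain ⟨⟨hoa, hob, hok, ho1, ho2, ho3, ho4, ho5⟩, ⟨hab, hak, ha1, ha2, ha3, ha4, ha5⟩,
    ⟨hbk, hb1, hb2, hb3, hb4, hb5⟩, ⟨hk1, hk2, hk3, hk4, hk5⟩, ⟨h12, h13, h14, h15⟩,
    ⟨h23, h24, h25⟩, ⟨h34, h35⟩, h45⟩ := hnd
  -- A plane through `v o` and two points of `ker f` meets `ker f` only in the line of these two
  -- points.
  have hA : ∀ i j x, i ≠ o → j ≠ o → x ∈ Submodule.span K {v o, v i, v j} → f x = 0 →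
      x ∈ Submodule.span K {v i, v j} := by
    intro i j x hi hj hx hfx
    obtain ⟨t, y, hy, rfl⟩ := Submodule.mem_span_insert.1 hx
    have hfy : f y = 0 := by
      have : Submodule.span K {v i, v j} ≤ LinearMap.ker f := by
        rw [Submodule.span_le]
        rintro _ (rfl | rfl)
        · exact hf _ hi
        · exact hf _ hj
      exact this hy
    have : t = 0 := by simpa [hfy, hfo] using hfx
    simpa [this] using hy
  -- With the vertex general on the plane of `v o`, `v a`, `v b`, this plane is one component of the
  -- cones and takes care of three points. A quadric cone remains for the other six.
  obtain ⟨P, hPG, hP⟩ := (Submodule.span K {v o, v a, v b}).exists_mem_forall_notMem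
    (fun t : Option (ι × ι × ι) => t.elim (LinearMap.ker f)
      fun t => Submodule.span K {v t.1, v t.2.1, v t.2.2})
  have hPf : f P ≠ 0 := hP none fun hle => hfo (hle (Submodule.subset_span (by simp)))
  have hP0 : P ≠ 0 := by
    rintro rfl
    simp at hPf
  have hPA : ∀ i j l, i ≠ o → j ≠ o → l ≠ o → P ∉ Submodule.span K {v i, v j, v l} := by
    intro i j l hi hj hl hm
    have : Submodule.span K {v i, v j, v l} ≤ LinearMap.ker f := by
      rw [Submodule.span_le]
      rintro _ (rfl | rfl | rfl) <;> exact hf _ ‹_›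
    exact hPf (this hm)
  have hPo : ∀ i, i ≠ o → P ∉ Submodule.span K {v o, v i} := by
    intro i hi
    have := hP (some (o, i, i)) fun hle => by
      have h1 : v a ∈ Submodule.span K {v i} := by
        simpa using hA i i (v a) hi hi (hle (Submodule.subset_span (by simp))) (hf _ (Ne.symm hoa))
      have h2 : v b ∈ Submodule.span K {v i} := by
        simpa using hA i i (v b) hi hi (hle (Submodule.subset_span (by simp))) (hf _ (Ne.symm hob))
      by_cases hai : i = a
      · exact hv.notMem_span_singleton i b (hai ▸ hab) h2
      · exact hv.notMem_span_singleton i a hai h1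
    simpa using this
  obtain ⟨c, hc0, hc⟩ := hv.exists_relation P hP0
  have hG : ∀ i, i ≠ o → i ≠ a → i ≠ b → ∃ g : Module.Dual K V, g P = 0 ∧ g (v o) = 0 ∧
      g (v a) = 0 ∧ g (v b) = 0 ∧ g (v i) ≠ 0 := by
    intro i hio hia hib
    have : v i ∉ Submodule.span K {v o, v a, v b} := fun hm =>
      hncol a b i (Ne.symm hoa) (Ne.symm hob) hio hab (Ne.symm hia) (Ne.symm hib)
        (hA a b _ (Ne.symm hoa) (Ne.symm hob) hm (hf _ hio))
    obtain ⟨g, hgi, hg⟩ := Submodule.exists_le_ker_of_notMem this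
    exact ⟨g, hg hPG, hg (Submodule.subset_span (by simp)), hg (Submodule.subset_span (by simp)),
      hg (Submodule.subset_span (by simp)), hgi⟩
  have hl : ∀ x i j, x ≠ o → i ≠ o → j ≠ o → x ≠ i → x ≠ j → i ≠ j →
      ∃ l : Module.Dual K V, l P = 0 ∧ l (v i) = 0 ∧ l (v j) = 0 ∧ l (v x) ≠ 0 := by
    intro x i j hx hi hj hxi hxj hij
    obtain ⟨l, h1, h2, h3⟩ := exists_dual_of_notMem_span (s := {v i, v j}) (x := v x) (P := P)
      (hncol i j x hi hj hx hij hxi.symm hxj.symm) (hPA _ _ _ hx hi hj)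
    exact ⟨l, h1, h2 _ (by simp), h2 _ (by simp), h3⟩
  -- If `c k` were zero, each of `c₁`, …, `c₅` would be isolated by the plane of `o`, `a`, `b` and
  -- two planes through pairs of the other four. Then only `o`, `a`, `b` would be left, and `P` is
  -- on no line through two of these.
  have hck : c k ≠ 0 := by
    intro hck
    have fin : ∀ x i j l m, [o, x, i, j, l, m].Nodup → x ≠ a → x ≠ b →
        (∀ y, y = o ∨ y = a ∨ y = b ∨ y = k ∨ y = x ∨ y = i ∨ y = j ∨ y = l ∨ y = m) →
        c x = 0 := by
      intro x i j l m hnd hxa hxb hcov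
      simp only [List.nodup_cons, List.mem_cons, List.not_mem_nil, or_false, not_or,
        List.nodup_nil, not_false_eq_true, and_true] at hnd
      obtain ⟨⟨n1, n2, n3, n4, n5⟩, ⟨n6, n7, n8, n9⟩, ⟨n10, n11, n12⟩, ⟨n13, n14⟩, n15⟩ := hnd
      obtain ⟨g, g1, g2, g3, g4, g5⟩ := hG x (Ne.symm n1) hxa hxb
      obtain ⟨l₁, m1, m2, m3, m4⟩ :=
        hl x i j (Ne.symm n1) (Ne.symm n2) (Ne.symm n3) n6 n7 n10
      obtain ⟨l₂, k1, k2, k3, k4⟩ :=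
        hl x l m (Ne.symm n1) (Ne.symm n4) (Ne.symm n5) n8 n9 n15
      refine hc.eq_zero g1 m1 k1 g5 m4 k4 fun y hy => ?_
      rcases hcov y with rfl | rfl | rfl | rfl | rfl | rfl | rfl | rfl | rfl <;>
        first | exact absurd rfl hy | simp [*]
    have e1 := fin c₁ c₂ c₃ c₄ c₅ (by grind) (by grind) (by grind) hcov
    have e2 := fin c₂ c₁ c₃ c₄ c₅ (by grind) (by grind) (by grind)
      (fun y => by rcases hcov y with h | h | h | h | h | h | h | h | h <;> simp [h])
    have e3 := fin c₃ c₁ c₂ c₄ c₅ (by grind) (by grind) (by grind)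
      (fun y => by rcases hcov y with h | h | h | h | h | h | h | h | h <;> simp [h])
    have e4 := fin c₄ c₁ c₂ c₃ c₅ (by grind) (by grind) (by grind)
      (fun y => by rcases hcov y with h | h | h | h | h | h | h | h | h <;> simp [h])
    have e5 := fin c₅ c₁ c₂ c₃ c₄ (by grind) (by grind) (by grind)
      (fun y => by rcases hcov y with h | h | h | h | h | h | h | h | h <;> simp [h])
    have fin3 : ∀ x y z, x ≠ y → x ≠ z → P ∉ Submodule.span K {v x, v y} →
        P ∉ Submodule.span K {v x, v z} → (∀ i, c i = 0 ∨ i = x ∨ i = y ∨ i = z) → c x = 0 := by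
      intro x y z hxy hxz hy hz hcov
      obtain ⟨l, h1, h2, h3⟩ := exists_dual_of_notMem_span (s := {v y}) (P := P)
        (hv.notMem_span_singleton y x hxy.symm) hy
      obtain ⟨m, k1, k2, k3⟩ := exists_dual_of_notMem_span (s := {v z}) (P := P)
        (hv.notMem_span_singleton z x hxz.symm) hz
      refine hc.eq_zero h1 h1 k1 h3 h3 k3 fun i hi => ?_
      rcases hcov i with h | rfl | rfl | rfl
      · exact .inl h
      · exact absurd rfl hi
      · simp [h2]
      · simp [k2]
    have hcov3 : ∀ i, c i = 0 ∨ i = o ∨ i = a ∨ i = b := by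
      intro i
      rcases hcov i with rfl | rfl | rfl | rfl | rfl | rfl | rfl | rfl | rfl <;> simp [*]
    have eo := fin3 o a b hoa hob (hPo _ (Ne.symm hoa)) (hPo _ (Ne.symm hob)) hcov3
    have hPab : P ∉ Submodule.span K {v a, v b} := by
      have := hPA a a b (Ne.symm hoa) (Ne.symm hoa) (Ne.symm hob)
      simpa using this
    have ea := fin3 a o b (Ne.symm hoa) hab (by rw [Set.pair_comm]; exact hPo _ (Ne.symm hoa)) hPab
      (fun i => by rcases hcov3 i with h | h | h | h <;> simp [h])
    have eb := fin3 b o a (Ne.symm hob) (Ne.symm hab) (by rw [Set.pair_comm]; exact hPo _ (Ne.symm hob))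
      (by rw [Set.pair_comm]; exact hPab)
      (fun i => by rcases hcov3 i with h | h | h | h <;> simp [h])
    apply hc0
    funext i
    rcases hcov i with rfl | rfl | rfl | rfl | rfl | rfl | rfl | rfl | rfl <;> assumption
  -- A multiple of `f` is subtracted to make the form vanish at `P`; its values on the plane `ker f`
  -- do not change. This is the cone over the line that `p` cuts out there.
  let cone : Module.Dual K V → Module.Dual K V := fun p => p - (p P / f P) • f
  have cone_P : ∀ p, cone p P = 0 := fun p => by simp [cone, hPf]
  have cone_eq : ∀ p i, i ≠ o → cone p (v i) = p (v i) := fun p i hi => by simp [cone, hf i hi]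
  obtain ⟨g, g1, g2, g3, g4, g5⟩ := hG k (Ne.symm hok) (Ne.symm hak) (Ne.symm hbk)
  have s1 := hc g (cone p) (cone q) g1 (cone_P p) (cone_P q)
  have s2 := hc g (cone r) (cone s) g1 (cone_P r) (cone_P s)
  -- The member of the pencil of conics through `c₁`, …, `c₄` that also passes through `c₅`. Times
  -- `g`, it is a cubic cone that contains all points except possibly `k`, so `c k ≠ 0` forces it to
  -- contain `k`.
  have s3 : ∑ i, c i * (g (v i) * (p (v c₅) * q (v c₅) * (cone r (v i) * cone s (v i)) -
      r (v c₅) * s (v c₅) * (cone p (v i) * cone q (v i)))) = 0 := by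
    calc _ = p (v c₅) * q (v c₅) * ∑ i, c i * (g (v i) * cone r (v i) * cone s (v i)) -
          r (v c₅) * s (v c₅) * ∑ i, c i * (g (v i) * cone p (v i) * cone q (v i)) := by
          rw [Finset.mul_sum, Finset.mul_sum, ← Finset.sum_sub_distrib]
          exact Finset.sum_congr rfl fun i _ => by ring
      _ = 0 := by rw [s1, s2]; ring
  rw [Finset.sum_eq_single k] at s3
  · rw [cone_eq _ _ (Ne.symm hok), cone_eq _ _ (Ne.symm hok), cone_eq _ _ (Ne.symm hok),
      cone_eq _ _ (Ne.symm hok)] at s3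
    simpa [hck, g5, sub_eq_zero] using s3
  · intro i _ hik
    rcases hcov i with rfl | rfl | rfl | rfl | rfl | rfl | rfl | rfl | rfl
    · simp [g2]
    · simp [g3]
    · simp [g4]
    · exact absurd rfl hik
    all_goals rw [cone_eq _ _ (Ne.symm ‹_›), cone_eq _ _ (Ne.symm ‹_›), cone_eq _ _ (Ne.symm ‹_›),
      cone_eq _ _ (Ne.symm ‹_›)]
    · simp [hp₁, hr₁]
    · simp [hp₂, hs₂]
    · simp [hq₃, hr₃]
    · simp [hq₄, hs₄]
    · ring
  · simp

end FailsOnCubicCones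

end

/-! ### Linear and cubic forms, maximal minors -/

section

open MvPolynomial

section Polynomials

variable {K : Type*} [Field K]

theorem dual_apply_eq_sum {m : Type*} [Fintype m] [DecidableEq m] (l : Module.Dual K (m → K))
    (x : m → K) : l x = ∑ i, l (Pi.single i 1) * x i := by
  conv_lhs => rw [← Finset.univ_sum_single x]
  rw [map_sum]
  refine Finset.sum_congr rfl fun i _ => ?_
  have : (Pi.single i (x i) : m → K) = x i • Pi.single i 1 := by simp [← Pi.single_smul]
  rw [this, map_smul, smul_eq_mul, mul_comm]

/-- A linear form as a homogeneous polynomial of degree one. -/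
noncomputable def linearPoly {n : ℕ} (l : Module.Dual K (Fin n → K)) : MvPolynomial (Fin n) K :=
  ∑ i, C (l (Pi.single i 1)) * X i

theorem isHomogeneous_linearPoly {n : ℕ} (l : Module.Dual K (Fin n → K)) :
    (linearPoly l).IsHomogeneous 1 :=
  IsHomogeneous.sum _ _ _ fun _ _ => isHomogeneous_C_mul_X _ _

@[simp]
theorem eval_linearPoly {n : ℕ} (l : Module.Dual K (Fin n → K)) (x : Fin n → K) :
    eval x (linearPoly l) = l x := by
  simp [linearPoly, dual_apply_eq_sum l x]

theorem MvPolynomial.IsHomogeneous.eval_smul {σ : Type*} {p : MvPolynomial σ K} {d : ℕ}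
    (hp : p.IsHomogeneous d) (t : K) (x : σ → K) : eval (t • x) p = t ^ d * eval x p := by
  rw [eval_eq, eval_eq, Finset.mul_sum]
  refine Finset.sum_congr rfl fun m hm => ?_
  have := hp.degree_eq_sum_deg_support hm
  simp only [Pi.smul_apply, smul_eq_mul, mul_pow, Finset.prod_mul_distrib, Finset.prod_pow_eq_pow_sum]
  rw [← this]
  ring

theorem MvPolynomial.exists_eval_ne_zero {σ : Type*} [Infinite K] {p : MvPolynomial σ K}
    (hp : p ≠ 0) : ∃ x, eval x p ≠ 0 := by
  by_contra! h
  exact hp (MvPolynomial.funext fun x => by simp [h x])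

/-- Over an infinite field some vector is a zero neither of `D` nor of `F` nor of a coordinate. The
coordinate makes the vector nonzero, and homogeneity of `F` allows the passage to the chosen
representative of its point. -/
theorem HoldsAtGeneralPoint.exists_of_ne_zero [Infinite K] {n : ℕ}
    {Q : ℙ K (Fin (n + 1) → K) → Prop} (h : HoldsAtGeneralPoint Q)
    {D : MvPolynomial (Fin (n + 1)) K} (hD : D ≠ 0) :
    ∃ (x : Fin (n + 1) → K) (hx : x ≠ 0), eval x D ≠ 0 ∧ Q (Projectivization.mk K x hx) := by
  obtain ⟨d, F, hF, hF0, hQ⟩ := h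
  obtain ⟨x, hx⟩ := MvPolynomial.exists_eval_ne_zero
    (mul_ne_zero (mul_ne_zero hD hF0) (X_ne_zero (R := K) (0 : Fin (n + 1))))
  simp only [map_mul, eval_X, mul_ne_zero_iff] at hx
  have hx0 : x ≠ 0 := by
    rintro rfl
    exact hx.2 rfl
  refine ⟨x, hx0, hx.1.1, hQ _ ?_⟩
  obtain ⟨a, ha⟩ := Projectivization.exists_smul_eq_mk_rep K x hx0
  rw [← ha, Units.smul_def, hF.eval_smul]
  exact mul_ne_zero (pow_ne_zero _ a.ne_zero) hx.1.2

/-- The space of ternary cubic forms has dimension ten. -/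
theorem finrank_homogeneousSubmodule_three :
    Module.finrank K (homogeneousSubmodule (Fin 3) K 3) = 10 ∧
      FiniteDimensional K (homogeneousSubmodule (Fin 3) K 3) := by
  classical
  have e : {d : Fin 3 →₀ ℕ | d.degree = 3} ≃ (Finset.Nat.antidiagonalTuple 3 3) :=
    (Finsupp.equivFunOnFinite.subtypeEquiv fun d => by
      simp [Finset.Nat.mem_antidiagonalTuple, Finsupp.degree_eq_sum])
  have : Fintype {d : Fin 3 →₀ ℕ | d.degree = 3} := Fintype.ofEquiv _ e.symm
  have hcard : Fintype.card {d : Fin 3 →₀ ℕ | d.degree = 3} = 10 := by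
    rw [Fintype.card_congr e, Fintype.card_coe]
    rfl
  have hE : homogeneousSubmodule (Fin 3) K 3 =
      restrictSupport K {d : Fin 3 →₀ ℕ | d.degree = 3} :=
    homogeneousSubmodule_eq_finsupp_supported _ _ _
  rw [hE]
  have B := basisRestrictSupport K {d : Fin 3 →₀ ℕ | d.degree = 3}
  exact ⟨(Module.finrank_eq_card_basis B).trans hcard, B.finiteDimensional_of_finite⟩

/-- In the component of degree `d`, only the constant terms of the multipliers contribute. -/
theorem MvPolynomial.exists_eq_C_mul_add_C_mul {σ : Type*} {d : ℕ} {F G H : MvPolynomial σ K}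
    (hF : F.IsHomogeneous d) (hG : G.IsHomogeneous d) (hH : H.IsHomogeneous d)
    (h : H ∈ Ideal.span {F, G}) : ∃ s t : K, H = C s * F + C t * G := by
  classical
  let _ := gradedAlgebra (R := K) (σ := σ)
  have key : ∀ a F : MvPolynomial σ K, F.IsHomogeneous d →
      homogeneousComponent d (a * F) = C (coeff 0 a) * F := by
    intro a F hF
    have := DirectSum.coe_decompose_mul_of_right_mem_of_le (homogeneousSubmodule σ K)
      (a := a) (b := F) (i := d) (n := d) hF le_rfl
    rw [Nat.sub_self] at this
    rw [← homogeneousComponent_zero]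
    rw [← decomposition.decompose'_apply, ← decomposition.decompose'_apply]
    exact this
  obtain ⟨a, b, e⟩ := Ideal.mem_span_pair.1 h
  refine ⟨coeff 0 a, coeff 0 b, ?_⟩
  rw [← key a F hF, ← key b G hG, ← map_add, e, homogeneousComponent_eq_self hH]

/-- A binary cubic form with four zeros vanishes: a ternary cubic form that vanishes at four points
of a line vanishes on this line. -/
theorem MvPolynomial.IsHomogeneous.eval_add_smul_eq_zero {σ : Type*} {H : MvPolynomial σ K}
    (hH : H.IsHomogeneous 3) {a d : σ → K} {τ : Fin 4 → K} (hτ : Function.Injective τ)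
    (h0 : ∀ m, eval (a + τ m • d) H = 0) (t : K) : eval (a + t • d) H = 0 := by
  let p : Polynomial K := MvPolynomial.aeval (fun i => Polynomial.C (a i) + Polynomial.X * Polynomial.C (d i)) H
  have hp : ∀ t, p.eval t = eval (a + t • d) H := by
    intro t
    simp only [p]
    rw [← Polynomial.coe_aeval_eq_eval, ← AlgHom.comp_apply, MvPolynomial.comp_aeval]
    have h : (fun i => Polynomial.aeval t (Polynomial.C (a i) + Polynomial.X * Polynomial.C (d i))) =
        a + t • d := by
      ext i
      simp only [map_add, map_mul, Polynomial.aeval_C, Polynomial.aeval_X, Pi.add_apply,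
        Pi.smul_apply, smul_eq_mul, Algebra.algebraMap_self, RingHom.id_apply]
    rw [h]
    rfl
  have hdeg : p.natDegree ≤ 3 := by
    refine (aeval_natDegree_le (m := 3) (n := 1) H hH.totalDegree_le _ fun i => ?_).trans (by simp)
    compute_degree
  have : p = 0 := Polynomial.eq_zero_of_natDegree_lt_card_of_eval_eq_zero p hτ
    (fun m => by rw [hp, h0]) (by simp; omega)
  rw [← hp, this, Polynomial.eval_zero]

end Polynomials

/-- Independence of the rows means that the columns span, so a basis can be chosen among them. This
turns the absence of relations at a vertex into a nonzero minor. -/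
theorem Matrix.exists_submatrix_det_ne_zero {K m n : Type*} [Field K] [Fintype m] [DecidableEq m]
    (A : Matrix m n K) (h : ∀ c : m → K, (∀ j, ∑ i, c i * A i j = 0) → c = 0) :
    ∃ col : m → n, (A.submatrix id col).det ≠ 0 := by
  have hspan : Submodule.span K (Set.range A.transpose) = ⊤ := by
    by_contra hne
    obtain ⟨l, hl, hle⟩ := Submodule.exists_le_ker_of_lt_top _ (lt_top_iff_ne_top.2 hne)
    have hc := h (fun i => l (Pi.single i 1)) fun j => by
      have : l (A.transpose j) = 0 := hle (Submodule.subset_span ⟨j, rfl⟩)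
      rw [dual_apply_eq_sum] at this
      exact this
    apply hl
    ext i
    simpa using congrFun hc i
  obtain ⟨κ, a, -, ha, hli⟩ := exists_linearIndependent' K A.transpose
  let b : Module.Basis κ K (m → K) := Module.Basis.mk hli (by rw [ha, hspan])
  let e : m ≃ κ := (Pi.basisFun K m).indexEquiv b
  refine ⟨a ∘ e, ?_⟩
  have h2 : LinearIndependent K (A.submatrix id (a ∘ e)).col := hli.comp e e.injective
  have := Matrix.linearIndependent_cols_iff_isUnit.1 h2
  exact ((Matrix.isUnit_iff_isUnit_det _).1 this).ne_zero

end

/-! ### From complete intersections to relations at every vertex -/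

section

open MvPolynomial

variable {K : Type*} [Field K]

/-- The affine cone over the image consists of the multiples of the `φ p.rep`. A point in the kernel
has no image and has to be excluded. -/
theorem mem_homogeneousIdealOf_projectedSet {Z : Set (ℙ K (Fin 4 → K))}
    {φ : (Fin 4 → K) →ₗ[K] (Fin 3 → K)} (hφ : ∀ p ∈ Z, φ p.rep ≠ 0) {H : MvPolynomial (Fin 3) K} :
    H ∈ homogeneousIdealOf (projectedSet φ Z) ↔
      ∀ p ∈ Z, ∀ t : K, eval (t • φ p.rep) H = 0 := by
  rw [homogeneousIdealOf, mem_vanishingIdeal_iff]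
  constructor
  · intro h p hp t
    have := h (t • φ p.rep) ⟨Projectivization.mk K _ (hφ p hp), ⟨p, hp, ?_⟩, ?_⟩
    · exact this
    · rw [Projectivization.submodule_mk, Projectivization.submodule_eq, Submodule.map_span,
        Set.image_singleton]
    · rw [Projectivization.submodule_mk]
      exact Submodule.smul_mem _ _ (Submodule.mem_span_singleton_self _)
  · rintro h w ⟨q, ⟨p, hp, hq⟩, hw⟩
    rw [hq, Projectivization.submodule_eq, Submodule.map_span, Set.image_singleton,
      Submodule.mem_span_singleton] at hw
    obtain ⟨t, rfl⟩ := hw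
    exact h p hp t

theorem exists_ker_eq_span_singleton {x : Fin 4 → K} (hx : x ≠ 0) :
    ∃ φ : (Fin 4 → K) →ₗ[K] (Fin 3 → K), LinearMap.ker φ = Submodule.span K {x} := by
  have h1 := Submodule.finrank_quotient_add_finrank (Submodule.span K {x})
  rw [finrank_span_singleton hx, Module.finrank_fin_fun] at h1
  have e : ((Fin 4 → K) ⧸ Submodule.span K {x}) ≃ₗ[K] (Fin 3 → K) :=
    LinearEquiv.ofFinrankEq _ _ (by rw [Module.finrank_fin_fun]; omega)
  exact ⟨e.toLinearMap ∘ₗ (Submodule.span K {x}).mkQ, by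
    rw [LinearEquiv.ker_comp, Submodule.ker_mkQ]⟩

/-- A form that vanishes at the centre annihilates the kernel of the projection, hence factors
through it. Three planes through the centre thus become three lines, that is, a plane cubic. -/
theorem exists_comp_eq_of_ker_eq_span_singleton {V W : Type*} [AddCommGroup V] [Module K V]
    [AddCommGroup W] [Module K W] {x : V} {φ : V →ₗ[K] W}
    (hφ : LinearMap.ker φ = Submodule.span K {x}) (l : Module.Dual K V) (hl : l x = 0) :
    ∃ m : Module.Dual K W, ∀ y, m (φ y) = l y := by
  have : l ∈ LinearMap.range φ.dualMap := by
    rw [LinearMap.range_dualMap_eq_dualAnnihilator_ker, hφ, Submodule.mem_dualAnnihilator]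
    intro y hy
    obtain ⟨t, rfl⟩ := Submodule.mem_span_singleton.1 hy
    simp [hl]
  obtain ⟨m, rfl⟩ := this
  exact ⟨m, fun y => rfl⟩

/-- Two independent cubic curves through nine points of the plane give a relation between the
values of cubic forms at these points. -/
theorem exists_relation_of_isRelPrime {ι : Type*} [Fintype ι] (hι : Fintype.card ι = 9)
    {w : ι → Fin 3 → K} {F G : MvPolynomial (Fin 3) K} (hF : F.IsHomogeneous 3)
    (hG : G.IsHomogeneous 3) (hFG : IsRelPrime F G) (hFw : ∀ i, eval (w i) F = 0)
    (hGw : ∀ i, eval (w i) G = 0) :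
    ∃ c : ι → K, c ≠ 0 ∧ ∀ H : MvPolynomial (Fin 3) K, H.IsHomogeneous 3 →
      ∑ i, c i * eval (w i) H = 0 := by
  classical
  obtain ⟨hdim, hfin⟩ := finrank_homogeneousSubmodule_three (K := K)
  let E : homogeneousSubmodule (Fin 3) K 3 →ₗ[K] (ι → K) :=
    { toFun := fun H i => eval (w i) H.1
      map_add' := fun _ _ => by ext; simp
      map_smul' := fun _ _ => by ext; simp [smul_eval] }
  have : Nonempty ι := Fintype.card_pos_iff.1 (by omega)
  obtain ⟨i₀⟩ := this
  have hunit : ∀ P : MvPolynomial (Fin 3) K, eval (w i₀) P = 0 → ¬ IsUnit P := fun P hP hu => by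
    have := hu.map (eval (w i₀))
    rw [hP] at this
    exact not_isUnit_zero this
  have hF0 : F ≠ 0 := by
    rintro rfl
    exact hunit G (hGw _) (hFG (dvd_zero _) dvd_rfl)
  have hG0 : G ≠ 0 := by
    rintro rfl
    exact hunit F (hFw _) (hFG dvd_rfl (dvd_zero _))
  have hli : LinearIndependent K ![F, G] := by
    refine LinearIndependent.pair_iff.2 fun s t h => ?_
    by_cases hs : s = 0
    · subst hs
      exact ⟨rfl, (smul_eq_zero.1 (by simpa using h)).resolve_right hG0⟩
    · refine absurd (hFG ⟨C (-(s⁻¹ * t)), ?_⟩ dvd_rfl) (hunit G (hGw _))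
      have : F = s⁻¹ • (s • F + t • G) - (s⁻¹ * t) • G := by
        rw [smul_add, smul_smul, smul_smul, inv_mul_cancel₀ hs]
        simp
      rw [mul_comm, ← smul_eq_C_mul, neg_smul]
      rw [h] at this
      simpa using this
  have hli : LinearIndependent K
      (fun i : Fin 2 => (⟨⟨![F, G] i, by fin_cases i <;> assumption⟩, by
        funext j; fin_cases i <;> simp [hFw, hGw, E]⟩ : LinearMap.ker E)) :=
    LinearIndependent.of_comp ((homogeneousSubmodule (Fin 3) K 3).subtype ∘ₗ
      (LinearMap.ker E).subtype) hli
  -- The source has dimension ten and the kernel at least two, so the image is a proper subspace of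
  -- the nine-dimensional target. The coordinates of a functional that annihilates it are the
  -- relation.
  have h2 := hli.fintype_card_le_finrank
  have h3 := LinearMap.finrank_range_add_finrank_ker E
  rw [Fintype.card_fin] at h2
  obtain ⟨l, hl, hlE⟩ := exists_dual_ne_zero_of_finrank_lt (U := LinearMap.range E)
    (by rw [Module.finrank_fintype_fun_eq_card]; omega)
  refine ⟨fun i => l (Pi.single i 1), fun h => hl ?_, fun H hH => ?_⟩
  · ext i
    simpa using congrFun h i
  · have := hlE (E ⟨H, hH⟩) ⟨_, rfl⟩
    rwa [dual_apply_eq_sum] at this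

/-- The linear form in `y` given by a `2 × 2` minor of the matrix with columns `x` and `y`. -/
noncomputable def minorDual (x : Fin 4 → K) (a : Fin 4 × Fin 4) : Module.Dual K (Fin 4 → K) :=
  x a.1 • LinearMap.proj a.2 - x a.2 • LinearMap.proj a.1

@[simp]
theorem minorDual_apply (x y : Fin 4 → K) (a : Fin 4 × Fin 4) :
    minorDual x a y = x a.1 * y a.2 - x a.2 * y a.1 := by
  simp [minorDual]

/-- If `x i ≠ 0`, the minors with first row `i`, weighted by the coefficients of `l`, add up to `x i
* l y`, because the correction term is a multiple of `l x = 0`. So the planes through `x` are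
spanned by forms whose coefficients are polynomials in `x`, as the specialization of the vertex
requires. -/
theorem exists_eq_sum_minorDual {x : Fin 4 → K} (hx : x ≠ 0) (l : Module.Dual K (Fin 4 → K))
    (hl : l x = 0) : ∃ t : Fin 4 × Fin 4 → K, l = ∑ a, t a • minorDual x a := by
  obtain ⟨i, hi⟩ := Function.ne_iff.1 hx
  refine ⟨fun a => if a.1 = i then (x i)⁻¹ * l (Pi.single a.2 1) else 0, ?_⟩
  refine LinearMap.ext fun y => ?_
  have h1 := dual_apply_eq_sum l x
  have h2 := dual_apply_eq_sum l y
  rw [hl] at h1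
  rw [LinearMap.sum_apply, Fintype.sum_prod_type, Finset.sum_eq_single i (by simp +contextual)
    (by simp)]
  simp only [if_true, LinearMap.smul_apply, minorDual_apply, smul_eq_mul]
  have : ∀ j, (x i)⁻¹ * l (Pi.single j 1) * (x i * y j - x j * y i) =
      l (Pi.single j 1) * y j - (x i)⁻¹ * y i * (l (Pi.single j 1) * x j) := by
    intro j
    have : x i ≠ 0 := hi
    field_simp
  rw [Finset.sum_congr rfl fun j _ => this j, Finset.sum_sub_distrib, ← Finset.mul_sum, ← h1, ← h2]
  simp

theorem eq_zero_of_forall_minorDual {x : Fin 4 → K} (hx : x ≠ 0)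
    (Φ : Module.Dual K (Module.Dual K (Fin 4 → K))) (hΦ : ∀ a, Φ (minorDual x a) = 0)
    {l : Module.Dual K (Fin 4 → K)} (hl : l x = 0) : Φ l = 0 := by
  obtain ⟨t, rfl⟩ := exists_eq_sum_minorDual hx l hl
  simp [hΦ]

/-- The relation is linear in each of the three forms, so the minors are replaced by arbitrary forms
through `x` in one slot at a time. -/
theorem isCubicRelation_of_forall_minorDual {ι : Type*} [Fintype ι] {v : ι → Fin 4 → K}
    {x : Fin 4 → K} (hx : x ≠ 0) {c : ι → K}
    (h : ∀ a b d, ∑ i, c i * (minorDual x a (v i) * minorDual x b (v i) * minorDual x d (v i)) = 0) :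
    IsCubicRelation v x c := by
  let ev (i : ι) : Module.Dual K (Module.Dual K (Fin 4 → K)) := Module.Dual.eval K _ (v i)
  intro l₁ l₂ l₃ h₁ h₂ h₃
  have s1 : ∀ b d, ∑ i, c i * (l₁ (v i) * minorDual x b (v i) * minorDual x d (v i)) = 0 := by
    intro b d
    have := eq_zero_of_forall_minorDual hx
      (∑ i, (c i * (minorDual x b (v i) * minorDual x d (v i))) • ev i) (fun a => by
        rw [← h a b d]
        simp only [LinearMap.sum_apply, LinearMap.smul_apply, smul_eq_mul, ev,
          Module.Dual.eval_apply]
        exact Finset.sum_congr rfl fun i _ => by ring) h₁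
    rw [← this]
    simp only [LinearMap.sum_apply, LinearMap.smul_apply, smul_eq_mul, ev, Module.Dual.eval_apply]
    exact Finset.sum_congr rfl fun i _ => by ring
  have s2 : ∀ d, ∑ i, c i * (l₁ (v i) * l₂ (v i) * minorDual x d (v i)) = 0 := by
    intro d
    have := eq_zero_of_forall_minorDual hx
      (∑ i, (c i * (l₁ (v i) * minorDual x d (v i))) • ev i) (fun a => by
        rw [← s1 a d]
        simp only [LinearMap.sum_apply, LinearMap.smul_apply, smul_eq_mul, ev,
          Module.Dual.eval_apply]
        exact Finset.sum_congr rfl fun i _ => by ring) h₂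
    rw [← this]
    simp only [LinearMap.sum_apply, LinearMap.smul_apply, smul_eq_mul, ev, Module.Dual.eval_apply]
    exact Finset.sum_congr rfl fun i _ => by ring
  have := eq_zero_of_forall_minorDual hx
    (∑ i, (c i * (l₁ (v i) * l₂ (v i))) • ev i) (fun a => by
      rw [← s2 a]
      simp only [LinearMap.sum_apply, LinearMap.smul_apply, smul_eq_mul, ev,
        Module.Dual.eval_apply]
      exact Finset.sum_congr rfl fun i _ => by ring) h₃
  rw [← this]
  simp only [LinearMap.sum_apply, LinearMap.smul_apply, smul_eq_mul, ev, Module.Dual.eval_apply]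
  exact Finset.sum_congr rfl fun i _ => by ring

/-- A relation between the values of cubic cones for general vertices specializes to any vertex. -/
theorem exists_isCubicRelation_of_holdsAtGeneralPoint [Infinite K] {ι : Type*} [Fintype ι]
    {v : ι → Fin 4 → K} {Q : ℙ K (Fin 4 → K) → Prop} (hQ : HoldsAtGeneralPoint (n := 3) Q)
    (h : ∀ (x : Fin 4 → K) (hx : x ≠ 0), Q (Projectivization.mk K x hx) →
      ∃ c : ι → K, c ≠ 0 ∧ IsCubicRelation v x c) (x : Fin 4 → K) (hx : x ≠ 0) :
    ∃ c : ι → K, c ≠ 0 ∧ IsCubicRelation v x c := by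
  classical
  let n := (Fin 4 × Fin 4) × (Fin 4 × Fin 4) × (Fin 4 × Fin 4)
  let M (x : Fin 4 → K) : Matrix ι n K := fun i a =>
    minorDual x a.1 (v i) * minorDual x a.2.1 (v i) * minorDual x a.2.2 (v i)
  let e (i : ι) (a : Fin 4 × Fin 4) : MvPolynomial (Fin 4) K :=
    C (v i a.2) * X a.1 - C (v i a.1) * X a.2
  -- The evaluation matrix with the vertex as indeterminate; its left kernel at `x` consists of the
  -- relations for the vertex `x`.
  let MP : Matrix ι n (MvPolynomial (Fin 4) K) := fun i a => e i a.1 * e i a.2.1 * e i a.2.2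
  have hMP : ∀ x, MP.map (eval x) = M x := by
    intro x
    ext i a
    rw [Matrix.map_apply]
    simp only [MP, M, e, map_mul, map_sub, eval_C, eval_X, minorDual_apply]
    ring
  by_contra! hcon
  obtain ⟨col, hcol⟩ := (M x).exists_submatrix_det_ne_zero fun c hc => by
    by_contra hc0
    exact hcon c hc0 (isCubicRelation_of_forall_minorDual hx fun a b d => hc (a, b, d))
  have hdet : ∀ y, eval y (MP.submatrix id col).det = ((M y).submatrix id col).det := by
    intro y
    rw [RingHom.map_det, RingHom.mapMatrix_apply, ← Matrix.submatrix_map, hMP]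
  -- A maximal minor that is nonzero at `x` is nonzero at some vertex where `Q` holds. There the
  -- rows are dependent, a contradiction.
  obtain ⟨y, hy0, hy, hQy⟩ := hQ.exists_of_ne_zero (D := (MP.submatrix id col).det) fun h0 => by
    rw [← hdet, h0, map_zero] at hcol
    exact hcol rfl
  obtain ⟨c, hc0, hc⟩ := h y hy0 hQy
  rw [hdet] at hy
  apply hy
  rw [← Matrix.exists_vecMul_eq_zero_iff]
  refine ⟨c, hc0, ?_⟩
  funext j
  exact hc _ _ _ (by simp [mul_comm]) (by simp [mul_comm]) (by simp [mul_comm])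

end

/-! ### No four of the points are collinear -/

section

open MvPolynomial

variable {K : Type*} [Field K]

/-- A plane model of the projection of `Z` from a point from which the image is a complete
intersection of two cubics. -/
theorem exists_plane_model {Z : Finset (ℙ K (Fin 4 → K))} {x : Fin 4 → K} {hx : x ≠ 0}
    (h : Projectivization.mk K x hx ∉ (Z : Set (ℙ K (Fin 4 → K))) ∧
      ∀ φ : (Fin 4 → K) →ₗ[K] (Fin 3 → K), IsProjectionFrom (Projectivization.mk K x hx) φ →
        IsPlaneCompleteIntersection 3 3 (projectedSet φ (Z : Set (ℙ K (Fin 4 → K))))) :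
    ∃ (φ : (Fin 4 → K) →ₗ[K] (Fin 3 → K)) (F G : MvPolynomial (Fin 3) K),
      LinearMap.ker φ = Submodule.span K {x} ∧ F.IsHomogeneous 3 ∧ G.IsHomogeneous 3 ∧
      IsRelPrime F G ∧ ∀ H, H ∈ Ideal.span {F, G} ↔
        ∀ (i : Z) (t : K), eval (t • φ i.1.rep) H = 0 := by
  obtain ⟨φ, hφ⟩ := exists_ker_eq_span_singleton hx
  obtain ⟨F, G, hF, hG, hFG, hI⟩ := h.2 φ (by rw [IsProjectionFrom, hφ, Projectivization.submodule_mk])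
  refine ⟨φ, F, G, hφ, hF, hG, hFG, fun H => ?_⟩
  rw [← hI, mem_homogeneousIdealOf_projectedSet]
  · simp
  · intro p hp h0
    have h1 : p.rep ∈ Submodule.span K {x} := hφ ▸ h0
    obtain ⟨a, ha⟩ := Submodule.mem_span_singleton.1 h1
    apply h.1
    rw [← Projectivization.mk_rep p] at hp
    rwa [(Projectivization.mk_eq_mk_iff' K _ _ p.rep_nonzero hx).2 ⟨a, ha⟩] at hp

theorem eval_rep_eq_zero {Z : Finset (ℙ K (Fin 4 → K))} {φ : (Fin 4 → K) →ₗ[K] (Fin 3 → K)}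
    {F G : MvPolynomial (Fin 3) K}
    (hI : ∀ H, H ∈ Ideal.span {F, G} ↔ ∀ (i : Z) (t : K), eval (t • φ i.1.rep) H = 0)
    {H : MvPolynomial (Fin 3) K} (hH : H ∈ Ideal.span {F, G}) (i : Z) :
    eval (φ i.1.rep) H = 0 := by
  have := (hI H).1 hH i 1
  rwa [one_smul] at this

theorem linearPoly_ne_zero {n : ℕ} {l : Module.Dual K (Fin n → K)} (hl : l ≠ 0) :
    linearPoly l ≠ 0 := by
  intro h
  apply hl
  refine LinearMap.ext fun x => ?_
  rw [← eval_linearPoly, h, map_zero, LinearMap.zero_apply]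

/-- The ideal of a finite set of points in the plane that is generated by two cubics does not
vanish on a line; so the set does not contain four points on a line. -/
theorem notMem_span_pair_of_span_eq [Infinite K] {ι : Type*} [Fintype ι] {w : ι → Fin 3 → K}
    {F G : MvPolynomial (Fin 3) K} (hF : F.IsHomogeneous 3) (hG : G.IsHomogeneous 3)
    (hI : ∀ H, H ∈ Ideal.span {F, G} ↔ ∀ (i : ι) (t : K), eval (t • w i) H = 0)
    {e : Fin 4 → ι} (he : ∀ m m', m ≠ m' → w (e m') ∉ Submodule.span K {w (e m)})
    (U : Submodule K (Fin 3 → K)) (hU : Module.finrank K U = 2) : ∃ m, w (e m) ∉ U := by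
  by_contra! hmem
  have hsing : ∀ y, ¬ U ≤ Submodule.span K {y} := fun y hle => by
    have := Submodule.finrank_mono hle
    have h1 := finrank_span_singleton_le (K := K) y
    omega
  -- `d` is the point at infinity of the projective line `U`, different from the four given points.
  -- All other points are multiples of some `a + t • d`, and the given ones have different
  -- parameters.
  obtain ⟨d, hdU, hd⟩ := U.exists_mem_forall_notMem
    (fun m : Option (Fin 4) => m.elim ⊥ fun m => Submodule.span K {w (e m)})
  have hd0 : d ≠ 0 := hd none fun hle => hsing 0 (by simpa using hle)
  have hd : ∀ m, d ∉ Submodule.span K {w (e m)} := fun m => hd (some m) (hsing _)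
  obtain ⟨a, haU, ha⟩ := U.exists_mem_forall_notMem (fun _ : Unit => Submodule.span K {d})
  have ha : a ∉ Submodule.span K {d} := ha () (hsing _)
  have hli : LinearIndependent K ![d, a] := by
    rw [LinearIndependent.pair_iff' hd0]
    exact fun c hc => ha (hc ▸ Submodule.smul_mem _ _ (Submodule.mem_span_singleton_self d))
  have hspan : U = Submodule.span K {d, a} := by
    symm
    refine Submodule.eq_of_le_of_finrank_le (Submodule.span_le.2 ?_) ?_
    · rintro y (rfl | rfl) <;> assumption
    · have := finrank_span_eq_card hli
      rw [Matrix.range_cons_cons_empty, Fintype.card_fin] at this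
      omega
  have hrep : ∀ y ∈ U, y ∉ Submodule.span K {d} → ∃ s t : K, s ≠ 0 ∧ y = s • (a + t • d) := by
    intro y hy hyd
    rw [hspan, Submodule.mem_span_pair] at hy
    obtain ⟨t, s, rfl⟩ := hy
    have hs : s ≠ 0 := by
      rintro rfl
      exact hyd (by simpa using Submodule.smul_mem _ _ (Submodule.mem_span_singleton_self d))
    refine ⟨s, s⁻¹ * t, hs, ?_⟩
    rw [smul_add, smul_smul, mul_inv_cancel_left₀ hs, add_comm]
  have hwd : ∀ m, w (e m) ∉ Submodule.span K {d} := fun m hm => by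
    obtain ⟨t, ht⟩ := Submodule.mem_span_singleton.1 hm
    by_cases ht0 : t = 0
    · obtain ⟨m', hm'⟩ := exists_ne m
      exact he m' m hm' (by rw [← ht, ht0, zero_smul]; exact Submodule.zero_mem _)
    · exact hd m (by
        rw [← ht, Submodule.mem_span_singleton]
        exact ⟨t⁻¹, by rw [smul_smul, inv_mul_cancel₀ ht0, one_smul]⟩)
  choose s τ hs hτ using fun m => hrep _ (hmem m) (hwd m)
  have hinj : Function.Injective τ := by
    intro m m' h
    by_contra hne
    refine he m m' hne ?_
    rw [hτ m, hτ m', h, Submodule.mem_span_singleton]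
    exact ⟨s m' * (s m)⁻¹, by rw [smul_smul, inv_mul_cancel_right₀ (hs m)]⟩
  have hw : ∀ H : MvPolynomial (Fin 3) K, H ∈ Ideal.span {F, G} → ∀ i, eval (w i) H = 0 :=
    fun H hH i => by simpa using (hI H).1 hH i 1
  have hline : ∀ H : MvPolynomial (Fin 3) K, H.IsHomogeneous 3 → H ∈ Ideal.span {F, G} →
      ∀ t : K, eval (a + t • d) H = 0 := by
    intro H hH hHI t
    refine hH.eval_add_smul_eq_zero hinj (fun m => ?_) t
    have := hw H hHI (e m)
    rw [hτ m, hH.eval_smul] at this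
    exact (mul_eq_zero.1 this).resolve_left (pow_ne_zero _ (hs m))
  have hFI : F ∈ Ideal.span {F, G} := Ideal.subset_span (by simp)
  have hGI : G ∈ Ideal.span {F, G} := Ideal.subset_span (by simp)
  obtain ⟨y, hyU, hy⟩ := U.exists_mem_forall_notMem
    (fun i : Option ι => i.elim (Submodule.span K {d}) fun i => Submodule.span K {w i})
  have hyd : y ∉ Submodule.span K {d} := hy none (hsing _)
  have hyw : ∀ i, y ∉ Submodule.span K {w i} := fun i => hy (some i) (hsing _)
  obtain ⟨s', t, hs', rfl⟩ := hrep y hyU hyd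
  choose l hl hly using fun i => exists_dual_ne_zero_of_notMem_span (hyw i)
  -- One line through each point, none of them through `y`: the product is in the ideal and nonzero
  -- at `y`, whereas both generators vanish on all of `U`.
  have hprod : ∏ i, linearPoly (l i) ∈ Ideal.span {F, G} := by
    rw [hI]
    intro i t
    rw [map_prod]
    refine Finset.prod_eq_zero (Finset.mem_univ i) ?_
    rw [eval_linearPoly, map_smul, hl i _ rfl, smul_zero]
  obtain ⟨A, B, hAB⟩ := Ideal.mem_span_pair.1 hprod
  have h0 : eval (s' • (a + t • d)) (∏ i, linearPoly (l i)) = 0 := by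
    rw [← hAB, map_add, map_mul, map_mul, hF.eval_smul, hG.eval_smul, hline F hF hFI,
      hline G hG hGI]
    ring
  rw [map_prod, Finset.prod_eq_zero_iff] at h0
  obtain ⟨i, -, hi⟩ := h0
  rw [eval_linearPoly] at hi
  exact hly i hi

/-- A dependence that arises only after the projection comes from a nonzero multiple of the centre
`x` in the span of `y` and `s`. -/
theorem map_notMem_span_map {V W : Type*} [AddCommGroup V] [Module K V] [AddCommGroup W]
    [Module K W] {φ : V →ₗ[K] W} {x y : V} {s : Set V} (hφ : LinearMap.ker φ = Submodule.span K {x})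
    (hy : y ∉ Submodule.span K s) (hx : x ∉ Submodule.span K (insert y s)) :
    φ y ∉ Submodule.span K (φ '' s) := by
  rw [← Submodule.map_span]
  rintro ⟨z, hz, hzy⟩
  have h1 : y - z ∈ LinearMap.ker φ := by rw [LinearMap.mem_ker, map_sub, hzy, sub_self]
  rw [hφ, Submodule.mem_span_singleton] at h1
  obtain ⟨a, ha⟩ := h1
  by_cases h0 : a = 0
  · rw [h0, zero_smul] at ha
    exact hy (by rwa [sub_eq_zero.1 ha.symm])
  · apply hx
    have : x = a⁻¹ • (y - z) := by rw [← ha, smul_smul, inv_mul_cancel₀ h0, one_smul]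
    rw [this]
    exact Submodule.smul_mem _ _ (Submodule.sub_mem _ (Submodule.subset_span (by simp))
      (Submodule.span_mono (Set.subset_insert _ _) hz))

/-- If the general projection of nine points of projective 3-space is a complete intersection of
two cubics, then the points fail to impose independent conditions on cubic cones. -/
theorem failsOnCubicCones_of_generalProjection [Infinite K] {Z : Finset (ℙ K (Fin 4 → K))}
    (hZ : Z.card = 9)
    (h : GeneralProjectionIsCompleteIntersection 3 3 (Z : Set (ℙ K (Fin 4 → K)))) :
    FailsOnCubicCones (K := K) (fun p : Z => p.1.rep) := by
  classical
  have hsing : ∀ i j : Z, i ≠ j → j.1.rep ∉ Submodule.span K {i.1.rep} := by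
    intro i j hij hm
    obtain ⟨a, ha⟩ := Submodule.mem_span_singleton.1 hm
    apply hij
    rw [← Subtype.coe_inj, ← i.1.mk_rep, ← j.1.mk_rep]
    exact ((Projectivization.mk_eq_mk_iff' K _ _ _ _).2 ⟨a, ha⟩).symm
  refine ⟨exists_isCubicRelation_of_holdsAtGeneralPoint h fun x hx hQ => ?_, hsing, ?_⟩
  · obtain ⟨φ, F, G, hφ, hF, hG, hFG, hI⟩ := exists_plane_model hQ
    obtain ⟨c, hc0, hc⟩ := exists_relation_of_isRelPrime (w := fun i : Z => φ i.1.rep)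
      (by simp [hZ]) hF hG hFG
      (eval_rep_eq_zero hI (Ideal.subset_span (by simp)))
      (eval_rep_eq_zero hI (Ideal.subset_span (by simp)))
    refine ⟨c, hc0, fun l₁ l₂ l₃ h₁ h₂ h₃ => ?_⟩
    obtain ⟨m₁, hm₁⟩ := exists_comp_eq_of_ker_eq_span_singleton hφ l₁ h₁
    obtain ⟨m₂, hm₂⟩ := exists_comp_eq_of_ker_eq_span_singleton hφ l₂ h₂
    obtain ⟨m₃, hm₃⟩ := exists_comp_eq_of_ker_eq_span_singleton hφ l₃ h₃
    have := hc (linearPoly m₁ * linearPoly m₂ * linearPoly m₃)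
      (((isHomogeneous_linearPoly _).mul (isHomogeneous_linearPoly _)).mul
        (isHomogeneous_linearPoly _))
    simpa [hm₁, hm₂, hm₃] using this
  · intro i j k l hij hki hkj hli hlj hkl hk hl
    -- A centre off some plane through the line is off the line, so the four points stay different
    -- and collinear.
    obtain ⟨f, hf0, hf⟩ := exists_dual_ne_zero_of_finrank_lt
      (U := Submodule.span K {i.1.rep, j.1.rep})
      (by have := finrank_span_pair_le (K := K) i.1.rep j.1.rep
          rw [Module.finrank_fin_fun]; omega)
    obtain ⟨x, hx, hfx, hQ⟩ := h.exists_of_ne_zero (linearPoly_ne_zero hf0)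
    rw [eval_linearPoly] at hfx
    obtain ⟨φ, F, G, hφ, hF, hG, -, hI⟩ := exists_plane_model hQ
    have hin : ∀ y ∈ Submodule.span K {i.1.rep, j.1.rep},
        ∀ z ∈ Submodule.span K {i.1.rep, j.1.rep}, z ∉ Submodule.span K {y} →
        φ z ∉ Submodule.span K {φ y} := by
      intro y hy z hz hzy
      have := map_notMem_span_map (s := {y}) hφ hzy fun hm => hfx (hf x (by
        refine Submodule.span_le.2 ?_ hm
        rintro _ (rfl | rfl) <;> assumption))
      rwa [Set.image_singleton] at this
    let e : Fin 4 → Z := ![i, j, k, l]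
    have hmem : ∀ m, (e m).1.rep ∈ Submodule.span K {i.1.rep, j.1.rep} := by
      intro m
      fin_cases m
      · exact Submodule.subset_span (by simp [e])
      · exact Submodule.subset_span (by simp [e])
      · exact hk
      · exact hl
    have hinj : Function.Injective e := List.nodup_ofFn.1 (by
      simp [e, List.ofFn_succ, hij, hki.symm, hkj.symm, hli.symm, hlj.symm, hkl])
    have he : ∀ m m', m ≠ m' → e m ≠ e m' := fun m m' => hinj.ne
    have hli : LinearIndependent K ![φ i.1.rep, φ j.1.rep] := by
      have hi0 : φ i.1.rep ≠ 0 := fun h0 => hin _ (hmem 1) _ (hmem 0)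
        (hsing _ _ (he 1 0 (by decide))) (by
          show φ i.1.rep ∈ _
          rw [h0]; exact Submodule.zero_mem _)
      rw [LinearIndependent.pair_iff' hi0]
      exact fun c hc => hin _ (hmem 0) _ (hmem 1) (hsing _ _ (he 0 1 (by decide))) (by
        show φ j.1.rep ∈ Submodule.span K {φ i.1.rep}
        exact hc ▸ Submodule.smul_mem _ _ (Submodule.mem_span_singleton_self _))
    obtain ⟨m, hm⟩ := notMem_span_pair_of_span_eq (w := fun i : Z => φ i.1.rep) hF hG hI (e := e)
      (fun m m' hmm => hin _ (hmem m) _ (hmem m') (hsing _ _ (he m m' hmm)))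
      (Submodule.span K {φ i.1.rep, φ j.1.rep}) (by
        have := finrank_span_eq_card hli
        rwa [Matrix.range_cons_cons_empty, Fintype.card_fin] at this)
    apply hm
    have := Submodule.mem_map_of_mem (f := φ) (hmem m)
    rwa [Submodule.map_span, Set.image_pair] at this

end

/-! ### No plane contains eight of the points -/

section

open MvPolynomial

variable {K : Type*} [Field K]

theorem exists_equiv_fin_nine {ι : Type*} [Fintype ι] (hι : Fintype.card ι = 9) (o : ι) :
    ∃ e : Fin 9 ≃ ι, e 0 = o := by
  classical
  let e := (Fintype.equivFinOfCardEq hι).symm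
  exact ⟨(Equiv.swap 0 (e.symm o)).trans e, by simp⟩

/-- If a nonzero conic `D` contains all points of a set but one, the set is not a complete
intersection of two cubics. -/
theorem not_isRelPrime_of_conic {ι : Type*} {w : ι → Fin 3 → K} {F G D : MvPolynomial (Fin 3) K}
    (hF : F.IsHomogeneous 3) (hG : G.IsHomogeneous 3)
    (hI : ∀ H, H ∈ Ideal.span {F, G} ↔ ∀ (i : ι) (t : K), eval (t • w i) H = 0)
    (hD : D.IsHomogeneous 2) (hD0 : D ≠ 0) {o i₀ : ι} (hi₀ : i₀ ≠ o)
    (hDw : ∀ i ≠ o, eval (w i) D = 0) : ¬ IsRelPrime F G := by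
  intro hFG
  obtain ⟨y, hy⟩ : ∃ y, y ∉ Submodule.span K {w o} := by
    by_contra! hcon
    have h1 := Submodule.finrank_mono (R := K) (fun y _ => hcon y :
      (⊤ : Submodule K (Fin 3 → K)) ≤ Submodule.span K {w o})
    have h2 := finrank_span_pair_le (K := K) (w o) (w o)
    rw [Set.pair_eq_singleton] at h2
    rw [finrank_top, Module.finrank_fin_fun] at h1
    omega
  obtain ⟨z, hz⟩ : ∃ z, z ∉ Submodule.span K {w o, y} := by
    by_contra! hcon
    have h1 := Submodule.finrank_mono (R := K) (fun y _ => hcon y :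
      (⊤ : Submodule K (Fin 3 → K)) ≤ Submodule.span K {w o, y})
    have h2 := finrank_span_pair_le (K := K) (w o) y
    rw [finrank_top, Module.finrank_fin_fun] at h1
    omega
  -- Two different lines through `w o`. The products of `D` with them are cubics of the ideal, hence
  -- combinations of `F` and `G`. Solving for `F` and `G` exhibits `D` as a common factor.
  obtain ⟨l, hlo, hly⟩ := exists_dual_ne_zero_of_notMem_span hy
  obtain ⟨m, hmo, hmz⟩ := exists_dual_ne_zero_of_notMem_span hz
  have hlo := hlo _ rfl
  have hmy := hmo y (by simp)
  have hmo := hmo (w o) (by simp)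
  have hmem : ∀ l : Module.Dual K (Fin 3 → K), l (w o) = 0 →
      ∃ s t : K, D * linearPoly l = C s * F + C t * G := by
    intro l hl
    refine exists_eq_C_mul_add_C_mul hF hG (hD.mul (isHomogeneous_linearPoly l)) ((hI _).2 ?_)
    intro i t
    rw [map_mul, eval_linearPoly, map_smul, hD.eval_smul]
    by_cases hi : i = o
    · simp [hi, hl]
    · simp [hDw i hi]
  obtain ⟨s, t, h1⟩ := hmem l hlo
  obtain ⟨s', t', h2⟩ := hmem m hmo
  have eF : C (s * t' - s' * t) * F = D * (C t' * linearPoly l - C t * linearPoly m) := by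
    have : D * (C t' * linearPoly l - C t * linearPoly m) =
      C t' * (D * linearPoly l) - C t * (D * linearPoly m) := by ring
    rw [this, h1, h2]
    simp only [map_sub, map_mul]
    ring
  have eG : C (s * t' - s' * t) * G = D * (C s * linearPoly m - C s' * linearPoly l) := by
    have : D * (C s * linearPoly m - C s' * linearPoly l) =
      C s * (D * linearPoly m) - C s' * (D * linearPoly l) := by ring
    rw [this, h1, h2]
    simp only [map_sub, map_mul]
    ring
  -- If the determinant were zero, the independence of `l` and `m` would make all four coefficients
  -- zero, and then `D * linearPoly l = 0`.
  by_cases hδ : s * t' - s' * t = 0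
  · rw [hδ, map_zero, zero_mul] at eF eG
    have k1 := (mul_eq_zero.1 eF.symm).resolve_left hD0
    have k2 := (mul_eq_zero.1 eG.symm).resolve_left hD0
    have zero : ∀ a b : K, C a * linearPoly l - C b * linearPoly m = 0 → a = 0 ∧ b = 0 := by
      intro a b h
      have e1 := congrArg (eval y) h
      have ha : a = 0 := by simpa [hmy, hly] using e1
      have e2 := congrArg (eval z) h
      exact ⟨ha, by simpa [ha, hmz] using e2⟩
    obtain ⟨rfl, rfl⟩ := zero _ _ k1
    obtain ⟨rfl, rfl⟩ := zero s' s (by linear_combination -k2)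
    have : D * linearPoly l = 0 := by rw [h1]; simp
    rcases mul_eq_zero.1 this with h | h
    · exact hD0 h
    · have := congrArg (eval y) h
      simp [hly] at this
  · have hdvd : ∀ F E : MvPolynomial (Fin 3) K, C (s * t' - s' * t) * F = D * E → D ∣ F := by
      intro F E h
      refine ⟨C (s * t' - s' * t)⁻¹ * E, ?_⟩
      rw [mul_left_comm, ← h, ← mul_assoc, ← C_mul, inv_mul_cancel₀ hδ, C_1, one_mul]
    have hu := (hFG (hdvd _ _ eF) (hdvd _ _ eG)).map (eval (w i₀))
    rw [hDw i₀ hi₀] at hu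
    exact not_isUnit_zero hu

namespace FailsOnCubicCones

/-- If a plane contains all points of a configuration but one, no three of these are collinear. -/
theorem notMem_span_of_zeroSet {V ι : Type*} [AddCommGroup V] [Module K V] [Fintype ι] {v : ι → V}
    [Infinite K] [FiniteDimensional K V] (hV : Module.finrank K V = 4)
    (hι : Fintype.card ι = 9) (hv : FailsOnCubicCones (K := K) v) {f : Module.Dual K V} {o : ι}
    (hf : ∀ i, i ≠ o → f (v i) = 0) (hfo : f (v o) ≠ 0)
    {i j l : ι} (hi : i ≠ o) (hj : j ≠ o) (hl : l ≠ o) (hij : i ≠ j) (hil : i ≠ l) (hjl : j ≠ l) :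
    v l ∉ Submodule.span K {v i, v j} := by
  classical
  intro hm
  have : Nontrivial ι := ⟨i, j, hij⟩
  -- A plane through such a line and `v o` meets `ker f` in this line, so it contains exactly four
  -- points.
  obtain ⟨g, hg0, hg⟩ := exists_dual_ne_zero_of_finrank_lt (U := Submodule.span K {v i, v j, v o})
    (by have := finrank_span_triple_le (K := K) (v i) (v j) (v o); omega)
  have hgi := hg (v i) (Submodule.subset_span (by simp))
  have hgj := hg (v j) (Submodule.subset_span (by simp))
  have hgo := hg (v o) (Submodule.subset_span (by simp))
  have hgl : g (v l) = 0 := hg _ (Submodule.span_mono (by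
    rintro x (rfl | rfl) <;> simp) hm)
  apply hv.card_zeroSet_ne_four hV hι hg0
  have : zeroSet v g = {i, j, l, o} := by
    ext m
    rw [mem_zeroSet]
    simp only [Finset.mem_insert, Finset.mem_singleton]
    constructor
    · intro hgm
      by_contra! hne
      refine hv.not_four_collinear i j l m hij hil.symm hjl.symm hne.1 hne.2.1 hne.2.2.1.symm hm ?_
      exact mem_span_pair_of_dual_eq_zero hV (f := g) (g := f) ⟨v o, hgo, hfo⟩ hg0
        (hv.ne_zero i) (hv.notMem_span_singleton i j hij) hgi hgj hgm (hf i hi) (hf j hj)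
        (hf m hne.2.2.2)
    · rintro (rfl | rfl | rfl | rfl) <;> assumption
  rw [this]
  exact Finset.card_eq_four.2 ⟨i, j, l, o, hij, hil, hi, hjl, hj, hl, rfl⟩

end FailsOnCubicCones

/-- The relations at special vertices put eight coplanar points on a conic. The projection is
injective on their plane, so eight of the image points are on a conic, which contradicts coprimality
of the cubics. -/
theorem card_zeroSet_ne_eight [Infinite K] {Z : Finset (ℙ K (Fin 4 → K))} (hZ : Z.card = 9)
    (h : GeneralProjectionIsCompleteIntersection 3 3 (Z : Set (ℙ K (Fin 4 → K))))
    (f : Module.Dual K (Fin 4 → K)) : (zeroSet (fun p : Z => p.1.rep) f).card ≠ 8 := by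
  classical
  intro h8
  have hv := failsOnCubicCones_of_generalProjection hZ h
  set v : Z → Fin 4 → K := fun p => p.1.rep with hvdef
  have hι : Fintype.card Z = 9 := by simp [hZ]
  have hV : Module.finrank K (Fin 4 → K) = 4 := Module.finrank_fin_fun K
  obtain ⟨o, ho⟩ : ∃ o, (zeroSet v f)ᶜ = {o} := by
    rw [← Finset.card_eq_one, Finset.card_compl]
    omega
  have hfi : ∀ i, f (v i) ≠ 0 ↔ i = o := by
    intro i
    rw [← Finset.mem_singleton, ← ho, Finset.mem_compl, mem_zeroSet]
  have hfo := (hfi o).2 rfl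
  have hf : ∀ i, i ≠ o → f (v i) = 0 := fun i hi => by
    by_contra hne
    exact hi ((hfi i).1 hne)
  obtain ⟨e, rfl⟩ := exists_equiv_fin_nine hι o
  have hncol := fun i j l => hv.notMem_span_of_zeroSet hV hι hf hfo (i := i) (j := j) (l := l)
  have hne : ∀ i j, i ≠ j → e i ≠ e j := fun i j => e.injective.ne
  have hform : ∀ i j l : Fin 9, i ≠ 0 → j ≠ 0 → l ≠ 0 → i ≠ j → i ≠ l → j ≠ l →
      ∃ p : Module.Dual K (Fin 4 → K), p (v (e i)) = 0 ∧ p (v (e j)) = 0 ∧ p (v (e l)) ≠ 0 := by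
    intro i j l hi hj hl hij hil hjl
    obtain ⟨p, hp, hpl⟩ := exists_dual_ne_zero_of_notMem_span
      (hncol (e i) (e j) (e l) (hne _ _ hi) (hne _ _ hj) (hne _ _ hl) (hne _ _ hij) (hne _ _ hil)
        (hne _ _ hjl))
    exact ⟨p, hp _ (by simp), hp _ (by simp), hpl⟩
  -- The line pairs `p q` and `r s` span the pencil of conics through the points 4, 5, 6, 7. The
  -- conic `α r s - β p q` passes through 8 as well.
  obtain ⟨p, p4, p5, p8⟩ := hform 4 5 8 (by decide) (by decide) (by decide) (by decide)
    (by decide) (by decide)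
  obtain ⟨q, q6, q7, q8⟩ := hform 6 7 8 (by decide) (by decide) (by decide) (by decide)
    (by decide) (by decide)
  obtain ⟨r, r4, r6, r5⟩ := hform 4 6 5 (by decide) (by decide) (by decide) (by decide)
    (by decide) (by decide)
  obtain ⟨s, s5, s7, s4⟩ := hform 5 7 4 (by decide) (by decide) (by decide) (by decide)
    (by decide) (by decide)
  let α := p (v (e 8)) * q (v (e 8))
  let β := r (v (e 8)) * s (v (e 8))
  -- The points 1, 2, 3 take turns as `k`; the other two span with the point off the plane the
  -- auxiliary plane that contains the vertex.
  have hconic : ∀ a b k : Fin 9, [0, a, b, k, 4, 5, 6, 7, 8].Nodup →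
      (∀ i, i ∈ [0, a, b, k, 4, 5, 6, 7, 8]) →
      α * (r (v (e k)) * s (v (e k))) = β * (p (v (e k)) * q (v (e k))) := by
    intro a b k hnd hmem
    refine hv.mul_eq_mul_of_forall_notMem_span (f := f) (o := e 0) (a := e a) (b := e b)
      (c₁ := e 4) (c₂ := e 5) (c₃ := e 6) (c₄ := e 7) (c₅ := e 8) ?_ ?_ hf hfo hncol
      p4 p5 q6 q7 r4 r6 s5 s7
    · exact hnd.map e.injective
    · intro i
      have := List.mem_map_of_mem (f := e) (hmem (e.symm i))
      rwa [e.apply_symm_apply] at this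
  have hD : ∀ i : Fin 9, i ≠ 0 →
      α * (r (v (e i)) * s (v (e i))) = β * (p (v (e i)) * q (v (e i))) := by
    intro i hi
    fin_cases i
    · exact absurd rfl hi
    · exact hconic 2 3 1 (by decide) (by decide)
    · exact hconic 1 3 2 (by decide) (by decide)
    · exact hconic 1 2 3 (by decide) (by decide)
    · simp [p4, r4]
    · simp [p5, s5]
    · simp [q6, r6]
    · simp [q7, s7]
    · exact mul_comm _ _
  have hf0 : f ≠ 0 := by
    rintro rfl
    exact hfo rfl
  obtain ⟨x, hx, hfx, hQ⟩ := h.exists_of_ne_zero (linearPoly_ne_zero hf0)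
  rw [eval_linearPoly] at hfx
  obtain ⟨φ, F, G, hφ, hF, hG, hFG, hI⟩ := exists_plane_model hQ
  -- The centre is off `ker f`, so a multiple of `f` corrects any form to one that vanishes at the
  -- centre and descends.
  have hlift : ∀ l : Module.Dual K (Fin 4 → K), ∃ m : Module.Dual K (Fin 3 → K),
      ∀ y, f y = 0 → m (φ y) = l y := by
    intro l
    obtain ⟨m, hm⟩ := exists_comp_eq_of_ker_eq_span_singleton hφ (l - (l x / f x) • f)
      (by simp [hfx])
    exact ⟨m, fun y hy => by simp [hm, hy]⟩
  obtain ⟨p', hp'⟩ := hlift p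
  obtain ⟨q', hq'⟩ := hlift q
  obtain ⟨r', hr'⟩ := hlift r
  obtain ⟨s', hs'⟩ := hlift s
  let D : MvPolynomial (Fin 3) K :=
    C α * (linearPoly r' * linearPoly s') - C β * (linearPoly p' * linearPoly q')
  have hDeval : ∀ y, f y = 0 → eval (φ y) D = α * (r y * s y) - β * (p y * q y) := by
    intro y hy
    simp [D, hp' y hy, hq' y hy, hr' y hy, hs' y hy]
  refine not_isRelPrime_of_conic (w := fun i : Z => φ i.1.rep) hF hG hI (D := D) (o := e 0)
    (i₀ := e 1) ?_ ?_ (hne 1 0 (by decide)) ?_ hFG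
  · exact ((((isHomogeneous_linearPoly _).mul (isHomogeneous_linearPoly _)).C_mul α).sub
      (((isHomogeneous_linearPoly _).mul (isHomogeneous_linearPoly _)).C_mul β))
  · intro hD0
    have h4 := hf (e 4) (hne _ _ (by decide))
    have h5 := hf (e 5) (hne _ _ (by decide))
    -- At this point of the line through 4 and 5, `p` vanishes while `r` and `s` have the nonzero
    -- values `r (v (e 5))` and `s (v (e 4))`.
    have := hDeval (v (e 4) + v (e 5)) (by rw [map_add, h4, h5, add_zero])
    rw [hD0, map_zero] at this
    simp [p4, p5, r4, s5, α, p8, q8, r5, s4] at this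
  · intro i hi
    have := hDeval (v i) (hf i hi)
    have hi' := hD (e.symm i) (fun h => hi (by rw [← h, e.apply_symm_apply]))
    rw [e.apply_symm_apply] at hi'
    rwa [hi', sub_self] at this

end

/-! ### Combinatorial plane systems on nine points -/

section

/-- The combinatorial properties of the planes and lines spanned by nine points in space which fail
to impose independent conditions on cubic cones: `Pl` holds for the sets of all points on a plane,
and `Col` for collinear triples. -/
structure CubicPlaneSystem (Pl : Finset (Fin 9) → Prop) (Col : Fin 9 → Fin 9 → Fin 9 → Prop) :
    Prop where
  exists_plane : ∀ i j k, ∃ s, Pl s ∧ i ∈ s ∧ j ∈ s ∧ k ∈ s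
  mem_of_col : ∀ {i j k s}, Col i j k → Pl s → i ≠ j → i ∈ s → j ∈ s → k ∈ s
  col_of_ne : ∀ {i j k s t}, Pl s → Pl t → s ≠ t → i ≠ j → i ∈ s → j ∈ s → k ∈ s →
    i ∈ t → j ∈ t → k ∈ t → Col i j k
  col_swap : ∀ {i j k}, Col i j k → Col j i k
  col_rotate : ∀ {i j k}, Col i j k → j ≠ k → Col j k i
  not_four : ∀ {i j k l}, i ≠ j → k ≠ i → k ≠ j → l ≠ i → l ≠ j → k ≠ l → Col i j k → ¬ Col i j l
  card_ne_four : ∀ {s}, Pl s → s.card ≠ 4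
  card_ne_eight : ∀ {s}, Pl s → s.card ≠ 8
  card_ne_nine : ∀ {s}, Pl s → s.card ≠ 9
  notMem_of_not_col : ∀ {s t u x y z}, Pl s → Pl t → Pl u → s.card = 3 → t.card = 3 →
    Disjoint s t → x ∉ s → y ∉ s → z ∉ s → x ∉ t → y ∉ t → z ∉ t → x ≠ y → x ∈ u → y ∈ u → z ∈ u →
    ¬ Col x y z → ∀ w ∈ u, w ∉ s
  not_transversal : ∀ {a b c : Fin 3 → Fin 9} {s}, (∀ i, i ∈ s ↔ (∃ m, i = a m) ∨ ∃ m, i = b m) →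
    a.Injective → b.Injective → c.Injective → (∀ m n, a m ≠ b n) → (∀ m n, a m ≠ c n) →
    (∀ m n, b m ≠ c n) → Pl s → (∀ m n, Pl {a m, b m, c n}) → False
  exists_three_lt : ∃ s, Pl s ∧ 3 < s.card

theorem exists_perm_fin_nine (A : Finset (Fin 9)) (l : List (Fin 9)) (hl : l.Nodup)
    (hA : ∀ x ∈ l, x ∈ A) : ∃ σ : Equiv.Perm (Fin 9),
      (∀ (n : ℕ) (hn : n < l.length) (h9 : n < 9), σ ⟨n, h9⟩ = l[n]) ∧
      ∀ i : Fin 9, σ i ∈ A ↔ (i : ℕ) < A.card := by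
  let l' := l ++ ((A \ l.toFinset).toList ++ Aᶜ.toList)
  have hl2 : (l ++ (A \ l.toFinset).toList).length = A.card := by
    have := Finset.card_sdiff_add_card_eq_card (s := l.toFinset) (t := A)
      (fun x hx => hA x (List.mem_toFinset.1 hx))
    rw [List.toFinset_card_of_nodup hl] at this
    simp only [List.length_append, Finset.length_toList]
    omega
  have hlen : l'.length = 9 := by
    have : l'.length = (l ++ (A \ l.toFinset).toList).length + Aᶜ.card := by
      simp [l', add_assoc]
    rw [this, hl2, Finset.card_compl, Fintype.card_fin]
    have := Finset.card_le_univ A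
    simp at this
    omega
  have hnd : l'.Nodup := by
    refine hl.append (List.Nodup.append (Finset.nodup_toList _) (Finset.nodup_toList _) ?_) ?_
    · intro x hx hx'
      simp at hx hx'
      exact hx' hx.1
    · intro x hx hx'
      simp at hx'
      rcases hx' with h | h
      · exact h.2 hx
      · exact h (hA x hx)
  have hinj : Function.Injective fun i : Fin 9 => l'[(i : ℕ)]'(by omega) := by
    intro i j hij
    exact Fin.ext ((hnd.getElem_inj_iff).1 hij)
  refine ⟨Equiv.ofBijective _ (Finite.injective_iff_bijective.1 hinj), ?_, ?_⟩
  · intro n hn h9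
    simp [l', List.getElem_append, hn]
  · intro i
    have hi : Equiv.ofBijective _ (Finite.injective_iff_bijective.1 hinj) i =
      l'[(i : ℕ)]'(by omega) := rfl
    rw [hi]
    have e : l' = (l ++ (A \ l.toFinset).toList) ++ Aᶜ.toList := by simp [l']
    by_cases hlt : (i : ℕ) < A.card
    · simp only [hlt, iff_true]
      have : l'[(i : ℕ)]'(by omega) ∈ l ++ (A \ l.toFinset).toList := by
        simp only [e]
        rw [List.getElem_append_left (by omega)]
        exact List.getElem_mem _
      rw [List.mem_append] at this
      rcases this with h | h
      · exact hA _ h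
      · simp at h; exact h.1
    · simp only [hlt, iff_false]
      have : l'[(i : ℕ)]'(by omega) ∈ Aᶜ.toList := by
        simp only [e]
        rw [List.getElem_append_right (by omega)]
        exact List.getElem_mem _
      simpa using this

namespace CubicPlaneSystem

variable {Pl : Finset (Fin 9) → Prop} {Col : Fin 9 → Fin 9 → Fin 9 → Prop}

theorem comap (h : CubicPlaneSystem Pl Col) (σ : Equiv.Perm (Fin 9)) :
    CubicPlaneSystem (fun s => Pl (s.map σ.toEmbedding)) (fun i j k => Col (σ i) (σ j) (σ k)) where
  exists_plane i j k := by
    obtain ⟨s, hs, hi, hj, hk⟩ := h.exists_plane (σ i) (σ j) (σ k)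
    refine ⟨s.map σ.symm.toEmbedding, ?_, ?_, ?_, ?_⟩
    · simpa [Finset.map_map] using hs
    all_goals simpa
  mem_of_col {i j k s} h1 h2 hij h3 h4 := by
    have := h.mem_of_col h1 h2 (σ.injective.ne hij) (by simpa) (by simpa)
    simpa using this
  col_of_ne {i j k s t} h1 h2 h3 h4 h5 h6 h7 h8 h9 h10 := by
    refine h.col_of_ne h1 h2 (fun e => h3 (Finset.map_injective _ e)) (σ.injective.ne h4) ?_ ?_ ?_
      ?_ ?_ ?_ <;> simpa
  col_swap h1 := h.col_swap h1
  col_rotate h1 h2 := h.col_rotate h1 (σ.injective.ne h2)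
  not_four h1 h2 h3 h4 h5 h6 := h.not_four (σ.injective.ne h1) (σ.injective.ne h2)
    (σ.injective.ne h3) (σ.injective.ne h4) (σ.injective.ne h5) (σ.injective.ne h6)
  card_ne_four h1 := by simpa using h.card_ne_four h1
  card_ne_eight h1 := by simpa using h.card_ne_eight h1
  card_ne_nine h1 := by simpa using h.card_ne_nine h1
  notMem_of_not_col {s t u x y z} h1 h2 h3 h4 h5 h6 h7 h8 h9 h10 h11 h12 h13 h14 h15 h16 h17 w hw :=
    by
    have := h.notMem_of_not_col h1 h2 h3 (by simpa) (by simpa) (by simpa) (by simpa) (by simpa)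
      (by simpa) (by simpa) (by simpa) (by simpa) (σ.injective.ne h13) (by simpa) (by simpa)
      (by simpa) h17 (σ w) (by simpa)
    simpa using this
  not_transversal {a b c s} hs h1 h2 h3 h4 h5 h6 h7 h8 := by
    refine h.not_transversal (a := σ ∘ a) (b := σ ∘ b) (c := σ ∘ c) ?_ (σ.injective.comp h1)
      (σ.injective.comp h2) (σ.injective.comp h3) (fun m n => σ.injective.ne (h4 m n))
      (fun m n => σ.injective.ne (h5 m n)) (fun m n => σ.injective.ne (h6 m n)) h7
      (fun m n => by simpa using h8 m n)
    intro i
    obtain ⟨i, rfl⟩ := σ.surjective i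
    simp [hs]
  exists_three_lt := by
    obtain ⟨s, h1, h2⟩ := h.exists_three_lt
    exact ⟨s.map σ.symm.toEmbedding, by simpa [Finset.map_map] using h1, by simpa⟩

/-- To study a plane, one may renumber the points so that the plane contains the first ones. -/
theorem exists_comap (h : CubicPlaneSystem Pl Col) {A : Finset (Fin 9)} (hA : Pl A)
    {l : List (Fin 9)} (hl : l.Nodup) (hlA : ∀ x ∈ l, x ∈ A) : ∃ (σ : Equiv.Perm (Fin 9)),
    (∀ (n : ℕ) (hn : n < l.length) (h9 : n < 9), σ ⟨n, h9⟩ = l[n]) ∧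
    CubicPlaneSystem (fun s => Pl (s.map σ.toEmbedding)) (fun i j k => Col (σ i) (σ j) (σ k)) ∧
    ∃ B : Finset (Fin 9), Pl (B.map σ.toEmbedding) ∧ (∀ i, i ∈ B ↔ (i : ℕ) < A.card) ∧ ∀ i, i ∈ B ↔ σ i ∈ A := by
  obtain ⟨σ, h1, h2⟩ := exists_perm_fin_nine A l hl hlA
  refine ⟨σ, h1, h.comap σ, A.map σ.symm.toEmbedding, by simpa [Finset.map_map] using hA, ?_, ?_⟩
  · intro i
    rw [← h2]
    simp
  · intro i
    simp

theorem exists_fifth (h : CubicPlaneSystem Pl Col) {s : Finset (Fin 9)} (hs : Pl s)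
    {a b c d : Fin 9} (hnd : [a, b, c, d].Nodup) (ha : a ∈ s) (hb : b ∈ s) (hc : c ∈ s)
    (hd : d ∈ s) : ∃ e ∈ s, e ≠ a ∧ e ≠ b ∧ e ≠ c ∧ e ≠ d := by
  by_contra! hcon
  apply h.card_ne_four hs
  have : s = {a, b, c, d} := by
    ext x
    simp only [Finset.mem_insert, Finset.mem_singleton]
    constructor
    · intro hx
      have := hcon x hx
      tauto
    · rintro (rfl | rfl | rfl | rfl) <;> assumption
  rw [this]
  have := List.toFinset_card_of_nodup hnd
  simpa using this

theorem eq_triple_of_forall (h : CubicPlaneSystem Pl Col) {s : Finset (Fin 9)} (hs : Pl s)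
    {a b c : Fin 9} (hab : a ≠ b) (hac : a ≠ c) (hbc : b ≠ c) (ha : a ∈ s) (hb : b ∈ s) (hc : c ∈ s)
    (H : ∀ d ∈ s, d ≠ a → d ≠ b → d ≠ c → ∀ e ∈ s, e ≠ a → e ≠ b → e ≠ c → e = d) :
    s = {a, b, c} := by
  have hd : ∀ d ∈ s, d = a ∨ d = b ∨ d = c := by
    by_contra! ⟨d, hd, hda, hdb, hdc⟩
    obtain ⟨e, he, h1, h2, h3, h4⟩ := h.exists_fifth hs (a := a) (b := b) (c := c) (d := d)
      (by simp; tauto) ha hb hc hd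
    exact h4 (H d hd hda hdb hdc e he h1 h2 h3)
  ext x
  simp only [Finset.mem_insert, Finset.mem_singleton]
  constructor
  · exact hd x
  · rintro (rfl | rfl | rfl) <;> assumption

/-- No plane has exactly four points, so a plane through three points with at most one further point
has none. This provides the triples for `col_of_mem`. -/
theorem pl_triple (h : CubicPlaneSystem Pl Col) (a b c : Fin 9) (hab : a ≠ b) (hac : a ≠ c)
    (hbc : b ≠ c) (H : ∀ s, Pl s → a ∈ s → b ∈ s → c ∈ s →
      ∀ d ∈ s, d ≠ a → d ≠ b → d ≠ c → ∀ e ∈ s, e ≠ a → e ≠ b → e ≠ c → e = d) : Pl {a, b, c} := by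
  obtain ⟨s, hs, ha, hb, hc⟩ := h.exists_plane a b c
  rwa [← h.eq_triple_of_forall hs hab hac hbc ha hb hc (H s hs ha hb hc)]

/-- Two planes with three points and a third plane which contains the remaining three points and one
more. -/
theorem col_of_mem (h : CubicPlaneSystem Pl Col) {a b c d e f x y z w : Fin 9} {u : Finset (Fin 9)}
    (hs : Pl {a, b, c}) (ht : Pl {d, e, f}) (hu : Pl u) (hnd : [a, b, c, d, e, f, x, y, z].Nodup)
    (hx : x ∈ u) (hy : y ∈ u) (hz : z ∈ u) (hw : w ∈ u) (hwa : w = a ∨ w = b ∨ w = c) :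
    Col x y z := by
  by_contra hcol
  have hd : Disjoint ({a, b, c} : Finset (Fin 9)) {d, e, f} ∧ a ≠ b ∧ a ≠ c ∧ b ≠ c ∧ d ≠ e ∧ d ≠ f ∧
      e ≠ f ∧ x ≠ y := by
    clear hs ht hu hx hy hz hw hcol hwa
    simp only [List.nodup_cons, List.mem_cons, List.not_mem_nil, not_or, or_false,
      Finset.disjoint_insert_left, Finset.disjoint_singleton_left,
      Finset.mem_insert, Finset.mem_singleton] at hnd ⊢
    grind
  have hout : ∀ w ∈ [x, y, z], w ∉ ({a, b, c} : Finset (Fin 9)) ∧ w ∉ ({d, e, f} : Finset (Fin 9)) := by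
    clear hs ht hu hx hy hz hw hcol hwa hd
    intro w hw
    have := (List.nodup_append (l₁ := [a, b, c, d, e, f]) (l₂ := [x, y, z])).1 hnd
    refine ⟨fun h => this.2.2 w ?_ w hw rfl, fun h => this.2.2 w ?_ w hw rfl⟩ <;>
      simp only [Finset.mem_insert, Finset.mem_singleton] at h <;> simp <;> tauto
  have h1 := hout x (by simp)
  have h2 := hout y (by simp)
  have h3 := hout z (by simp)
  exact h.notMem_of_not_col hs ht hu (Finset.card_eq_three.2 ⟨a, b, c, hd.2.1, hd.2.2.1,
    hd.2.2.2.1, rfl⟩) (Finset.card_eq_three.2 ⟨d, e, f, hd.2.2.2.2.1, hd.2.2.2.2.2.1,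
    hd.2.2.2.2.2.2.1, rfl⟩) hd.1 h1.1 h2.1 h3.1 h1.2 h2.2 h3.2 hd.2.2.2.2.2.2.2 hx hy hz hcol w hw
    (by simpa using hwa)

end CubicPlaneSystem

end

/-! ### No plane contains seven points -/

section

namespace CubicPlaneSystem

variable {Pl : Finset (Fin 9) → Prop} {Col : Fin 9 → Fin 9 → Fin 9 → Prop}

/-- The plane through the line of `0, 1, 2` and through `7` needs a fifth point, which can only be
`8`. Since neither `0` nor `1` is on the line of `7, 8`, a plane through one of `7, 8`, one of `0,
1` and one of `3, …, 6` has just three points. Two choices of disjoint triples make `2, 5, 6` and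
`2, 6, 4` collinear, so four points are on a line. -/
theorem false_of_seven_of_col (h : CubicPlaneSystem Pl Col) {A : Finset (Fin 9)} (hA : Pl A)
    (hmem : ∀ i, i ∈ A ↔ (i : ℕ) < 7) (h012 : Col 0 1 2) (h0 : ¬ Col 7 8 0) (h1 : ¬ Col 7 8 1) :
    False := by
  obtain ⟨s, hs, h0s, h1s, h7s⟩ := h.exists_plane 0 1 7
  have h2s := h.mem_of_col h012 hs (by decide) h0s h1s
  have hsA : s ≠ A := by rintro rfl; simp [hmem] at h7s
  have hs3 : ∀ i ∈ s, i ∈ A → i = 0 ∨ i = 1 ∨ i = 2 := by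
    intro i hi hiA
    by_contra! hne
    exact h.not_four (i := 0) (j := 1) (k := 2) (l := i) (by decide) (by decide) (by decide)
      hne.1 hne.2.1 hne.2.2.symm h012
      (h.col_of_ne hs hA hsA (by decide) h0s h1s hi ((hmem _).2 (by decide))
        ((hmem _).2 (by decide)) hiA)
  have h8s : 8 ∈ s := by
    obtain ⟨e, he, hne⟩ := h.exists_fifth hs (a := 0) (b := 1) (c := 2) (d := 7) (by decide)
      h0s h1s h2s h7s
    have := hs3 e he
    have := hmem e
    have : ¬ (e : ℕ) < 7 := fun hlt => by grind
    have : e = 8 := by omega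
    rwa [← this]
  have hex : ∀ m x y a : Fin 9, m = 0 ∨ m = 1 → (x = 7 ∧ y = 8 ∨ x = 8 ∧ y = 7) → 3 ≤ (a : ℕ) →
      (a : ℕ) < 7 → Pl {x, m, a} := by
    intro m x y a hm hxy ha ha'
    refine h.pl_triple _ _ _ (by omega) (by omega) (by omega) ?_
    intro U hU hxU hmU haU d hd d1 d2 d3 e he e1 e2 e3
    by_contra hne
    have hUs : U ≠ s := by
      rintro rfl
      have := hs3 a haU ((hmem a).2 ha')
      omega
    have hUA : U ≠ A := by
      rintro rfl
      rw [hmem] at hxU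
      omega
    have hyU : y ∉ U := by
      intro hyU
      have : Col 7 8 m := h.col_of_ne hU hs hUs (by decide) (by grind) (by grind) hmU h7s h8s
        (by grind)
      grind
    have key : ∀ d ∈ U, d ≠ x → d ≠ m → d ≠ a → d ∈ A ∧ Col m a d := by
      intro d hd d1 d2 d3
      have hdA : d ∈ A := by
        rw [hmem]
        have : d ≠ y := by rintro rfl; exact hyU hd
        omega
      exact ⟨hdA, h.col_of_ne hU hA hUA (by omega) hmU haU hd ((hmem _).2 (by omega))
        ((hmem _).2 (by omega)) hdA⟩
    exact h.not_four (by omega) d2 d3 e2 e3 (Ne.symm hne) (key d hd d1 d2 d3).2 (key e he e1 e2 e3).2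
  have hA' : ∀ i : Fin 9, (i : ℕ) < 7 → i ∈ A := fun i hi => (hmem i).2 hi
  have f1 := h.col_of_mem (hex 0 7 8 3 (by simp) (by simp) (by decide) (by decide))
    (hex 1 8 7 4 (by simp) (by simp) (by decide) (by decide)) hA (x := 2) (y := 5) (z := 6) (w := 0)
    (by decide) (hA' _ (by decide)) (hA' _ (by decide)) (hA' _ (by decide)) (hA' _ (by decide))
    (by simp)
  have f2 := h.col_of_mem (hex 0 7 8 3 (by simp) (by simp) (by decide) (by decide))
    (hex 1 8 7 5 (by simp) (by simp) (by decide) (by decide)) hA (x := 2) (y := 6) (z := 4) (w := 0)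
    (by decide) (hA' _ (by decide)) (hA' _ (by decide)) (hA' _ (by decide)) (hA' _ (by decide))
    (by simp)
  exact h.not_four (i := 2) (j := 6) (k := 5) (l := 4) (by decide) (by decide) (by decide)
    (by decide) (by decide) (by decide) (h.col_swap (h.col_rotate (h.col_rotate f1 (by decide))
      (by decide))) f2

theorem card_ne_seven (h : CubicPlaneSystem Pl Col) {A : Finset (Fin 9)} (hA : Pl A) :
    A.card ≠ 7 := by
  intro h7
  by_cases htri : ∃ i ∈ A, ∃ j ∈ A, ∃ k ∈ A, i ≠ j ∧ i ≠ k ∧ j ≠ k ∧ Col i j k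
  -- Of any two points of a collinear triple in `A`, one is on the line of the two outside points.
  -- This line contains at most one point of `A`, which cannot serve all three pairs of the triple.
  · have key : ∀ i ∈ A, ∀ j ∈ A, ∀ k ∈ A, i ≠ j → i ≠ k → j ≠ k → Col i j k →
        ∃ x y, x ≠ y ∧ x ∉ A ∧ y ∉ A ∧ (Col x y i ∨ Col x y j) := by
      intro i hi j hj k hk hij hik hjk hcol
      obtain ⟨σ, hσ, h', B, hB, hmem, hBA⟩ := h.exists_comap hA (l := [i, j, k]) (by simp; tauto)
        (by simp; tauto)
      have e0 : σ 0 = i := hσ 0 (by simp) (by simp)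
      have e1 : σ 1 = j := hσ 1 (by simp) (by simp)
      have e2 : σ 2 = k := hσ 2 (by simp) (by simp)
      rw [h7] at hmem
      refine ⟨σ 7, σ 8, σ.injective.ne (by decide), fun h => ?_, fun h => ?_, ?_⟩
      · simpa [hmem] using (hBA 7).2 h
      · simpa [hmem] using (hBA 8).2 h
      · by_contra! hcon
        rw [← e0, ← e1] at hcon
        exact h'.false_of_seven_of_col hB hmem (by rwa [e0, e1, e2]) hcon.1 hcon.2
    have hcard : Aᶜ.card = 2 := by
      rw [Finset.card_compl, Fintype.card_fin, h7]
    obtain ⟨p, q, hpq, hA2⟩ := Finset.card_eq_two.1 hcard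
    have hmem : ∀ x, x ∉ A ↔ x = p ∨ x = q := fun x => by
      rw [← Finset.mem_compl, hA2]
      simp
    have key' : ∀ i ∈ A, ∀ j ∈ A, ∀ k ∈ A, i ≠ j → i ≠ k → j ≠ k → Col i j k →
        Col p q i ∨ Col p q j := by
      intro i hi j hj k hk hij hik hjk hcol
      obtain ⟨x, y, hxy, hx, hy, hc⟩ := key i hi j hj k hk hij hik hjk hcol
      have := h.col_swap (i := q) (j := p) (k := i)
      have := h.col_swap (i := q) (j := p) (k := j)
      rw [hmem] at hx hy
      grind
    have hpA : p ∉ A := (hmem p).2 (.inl rfl)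
    have hqA : q ∉ A := (hmem q).2 (.inr rfl)
    have huniq : ∀ i ∈ A, ∀ j ∈ A, i ≠ j → Col p q i → ¬ Col p q j := fun i hi j hj hij =>
      h.not_four hpq (by grind) (by grind) (by grind) (by grind) hij
    obtain ⟨i, hi, j, hj, k, hk, hij, hik, hjk, hcol⟩ := htri
    have h1 := key' i hi j hj k hk hij hik hjk hcol
    have h2 := key' j hj k hk i hi hjk hij.symm hik.symm (h.col_rotate hcol hjk)
    have h3 := key' k hk i hi j hj hik.symm hjk.symm hij
      (h.col_rotate (h.col_rotate hcol hjk) hik.symm)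
    have := huniq i hi j hj hij
    have := huniq i hi k hk hik
    have := huniq j hj k hk hjk
    tauto
  · push Not at htri
    obtain ⟨σ, hσ, h', B, hB, hmem, hBA⟩ := h.exists_comap hA (l := []) (by simp) (by simp)
    rw [h7] at hmem
    have hB' : ∀ i : Fin 9, (i : ℕ) < 7 → i ∈ B := fun i hi => (hmem i).2 hi
    have hncol : ∀ i j k : Fin 9, (i : ℕ) < 7 → (j : ℕ) < 7 → (k : ℕ) < 7 → i ≠ j → i ≠ k →
        j ≠ k → ¬ Col (σ i) (σ j) (σ k) := fun i j k hi hj hk hij hik hjk =>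
      htri _ ((hBA i).1 (hB' i hi)) _ ((hBA j).1 (hB' j hj)) _ ((hBA k).1 (hB' k hk))
        (σ.injective.ne hij) (σ.injective.ne hik) (σ.injective.ne hjk)
    -- Without collinear triples in `A`, a plane through two points of `A` and one outside point can
    -- contain only the other outside point in addition.
    have hex : ∀ x a b : Fin 9, 7 ≤ (x : ℕ) → (a : ℕ) < 7 → (b : ℕ) < 7 → a ≠ b →
        Pl (({x, a, b} : Finset (Fin 9)).map σ.toEmbedding) := by
      intro x a b hx ha hb hab
      refine h'.pl_triple _ _ _ (by omega) (by omega) hab ?_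
      intro U hU hxU haU hbU d hd d1 d2 d3 e he e1 e2 e3
      have hUB : U ≠ B := by
        rintro rfl
        rw [hmem] at hxU
        omega
      have key : ∀ d ∈ U, d ≠ x → d ≠ a → d ≠ b → 7 ≤ (d : ℕ) := by
        intro d hd d1 d2 d3
        by_contra! hlt
        exact hncol a b d ha hb hlt hab d2.symm d3.symm
          (h'.col_of_ne hU hB hUB hab haU hbU hd (hB' _ ha) (hB' _ hb) (hB' _ hlt))
      have := key d hd d1 d2 d3
      have := key e he e1 e2 e3
      omega
    exact hncol 4 5 6 (by decide) (by decide) (by decide) (by decide) (by decide) (by decide)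
      (h'.col_of_mem (hex 7 0 1 (by decide) (by decide) (by decide) (by decide))
      (hex 8 2 3 (by decide) (by decide) (by decide) (by decide)) hB (w := 0)
      (by decide) (hB' _ (by decide)) (hB' _ (by decide)) (hB' _ (by decide)) (hB' _ (by decide))
      (by simp))

end CubicPlaneSystem

end

/-! ### No plane contains six points -/

section

namespace CubicPlaneSystem

variable {Pl : Finset (Fin 9) → Prop} {Col : Fin 9 → Fin 9 → Fin 9 → Prop}

/-- A plane through the line and one of `6, 7, 8` needs a fifth point, again one of `6, 7, 8`
because the line has only three points. Different planes through the line share no further point, so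
three points cannot be distributed over two planes. -/
theorem exists_plane_of_six_of_col (h : CubicPlaneSystem Pl Col) {A : Finset (Fin 9)} (hA : Pl A)
    (hmem : ∀ i, i ∈ A ↔ (i : ℕ) < 6) {i j k : Fin 9} (hi : (i : ℕ) < 6) (hj : (j : ℕ) < 6)
    (hk : (k : ℕ) < 6) (hij : i ≠ j) (hik : i ≠ k) (hjk : j ≠ k) (hcol : Col i j k) :
    ∃ s, Pl s ∧ i ∈ s ∧ j ∈ s ∧ k ∈ s ∧ 6 ∈ s ∧ 7 ∈ s ∧ 8 ∈ s ∧
      ∀ l ∈ s, (l : ℕ) < 6 → l = i ∨ l = j ∨ l = k := by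
  have hplane : ∀ m : Fin 9, 6 ≤ (m : ℕ) → ∃ s, Pl s ∧ i ∈ s ∧ j ∈ s ∧ k ∈ s ∧ m ∈ s ∧
      (∀ l ∈ s, (l : ℕ) < 6 → l = i ∨ l = j ∨ l = k) ∧ ∃ n ∈ s, n ≠ m ∧ 6 ≤ (n : ℕ) := by
    intro m hm
    obtain ⟨s, hs, his, hjs, hms⟩ := h.exists_plane i j m
    have hks := h.mem_of_col hcol hs hij his hjs
    have hsA : s ≠ A := by
      rintro rfl
      rw [hmem] at hms
      omega
    have hs3 : ∀ l ∈ s, (l : ℕ) < 6 → l = i ∨ l = j ∨ l = k := by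
      intro l hl hl6
      by_contra! hne
      exact h.not_four hij hik.symm hjk.symm hne.1 hne.2.1 hne.2.2.symm hcol
        (h.col_of_ne hs hA hsA hij his hjs hl ((hmem _).2 hi) ((hmem _).2 hj) ((hmem _).2 hl6))
    obtain ⟨e, he, h1, h2, h3, h4⟩ := h.exists_fifth hs (a := i) (b := j) (c := k) (d := m)
      (by simp; omega) his hjs hks hms
    refine ⟨s, hs, his, hjs, hks, hms, hs3, e, he, h4, ?_⟩
    by_contra! hlt
    have := hs3 e he hlt
    tauto
  have hmeet : ∀ (s t : Finset (Fin 9)) (m : Fin 9), Pl s → Pl t → i ∈ s → j ∈ s → k ∈ s → i ∈ t →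
      j ∈ t → k ∈ t → m ∈ s → m ∈ t → 6 ≤ (m : ℕ) → s = t := by
    intro s t m hs ht his hjs hks hit hjt hkt hms hmt hm
    by_contra hst
    exact h.not_four hij hik.symm hjk.symm (by omega) (by omega) (by omega) hcol
      (h.col_of_ne hs ht hst hij his hjs hms hit hjt hmt)
  obtain ⟨s, hs, his, hjs, hks, h6s, hs3, n, hns, hn, hn6⟩ := hplane 6 (by decide)
  refine ⟨s, hs, his, hjs, hks, h6s, ?_, ?_, hs3⟩
  · obtain ⟨t, ht, hit, hjt, hkt, h7t, ht3, p, hpt, hp, hp6⟩ := hplane 7 (by decide)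
    by_contra h7s
    have hn8 : n = 8 := by
      have : n ≠ 7 := by rintro rfl; exact h7s hns
      omega
    subst hn8
    have : p = 6 ∨ p = 8 := by omega
    have hst : s ≠ t := by rintro rfl; exact h7s h7t
    rcases this with rfl | rfl
    · exact hst (hmeet s t 6 hs ht his hjs hks hit hjt hkt h6s hpt (by decide))
    · exact hst (hmeet s t 8 hs ht his hjs hks hit hjt hkt hns hpt (by decide))
  · obtain ⟨t, ht, hit, hjt, hkt, h8t, ht3, p, hpt, hp, hp6⟩ := hplane 8 (by decide)
    by_contra h8s
    have hn7 : n = 7 := by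
      have : n ≠ 8 := by rintro rfl; exact h8s hns
      omega
    subst hn7
    have : p = 6 ∨ p = 7 := by omega
    have hst : s ≠ t := by rintro rfl; exact h8s h8t
    rcases this with rfl | rfl
    · exact hst (hmeet s t 6 hs ht his hjs hks hit hjt hkt h6s hpt (by decide))
    · exact hst (hmeet s t 7 hs ht his hjs hks hit hjt hkt hns hpt (by decide))

/-- The plane `s` contains `0, 1, 2, 6, 7, 8`. A second collinear triple of `A`, through one of `0,
1, 2` and one of `3, 4, 5`, would yield another plane through `6, 7, 8`; it meets `s` in a line with
four points. Hence a plane through one point each of `0, 1, 2`, of `3, 4, 5` and of `6, 7, 8` has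
only three points, the situation of `not_transversal`. -/
theorem false_of_six_of_col (h : CubicPlaneSystem Pl Col) {A : Finset (Fin 9)} (hA : Pl A)
    (hmem : ∀ i, i ∈ A ↔ (i : ℕ) < 6) (h012 : Col 0 1 2) : False := by
  obtain ⟨s, hs, h0s, h1s, h2s, h6s, h7s, h8s, hs3⟩ := h.exists_plane_of_six_of_col hA hmem
    (by decide) (by decide) (by decide) (by decide) (by decide) (by decide) h012
  have h3s : ∀ i : Fin 9, (i : ℕ) < 3 → i ∈ s := by
    intro i hi
    have : i = 0 ∨ i = 1 ∨ i = 2 := by omega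
    rcases this with rfl | rfl | rfl <;> assumption
  have hs' : ∀ i ∈ s, (i : ℕ) < 6 → (i : ℕ) < 3 := by
    intro i hi hi6
    rcases hs3 i hi hi6 with rfl | rfl | rfl <;> decide
  have hsA : s ≠ A := by rintro rfl; simp [hmem] at h6s
  have hline : ∀ (i : Fin 9) (t : Finset (Fin 9)), Pl t → s ≠ t → (i : ℕ) < 3 → i ∈ t → 6 ∈ t →
      7 ∈ t → 8 ∉ t := by
    intro i t ht hst hi hit h6t h7t h8t
    exact h.not_four (i := 6) (j := 7) (k := 8) (l := i) (by decide) (by decide) (by decide)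
      (by omega) (by omega) (by omega) (h.col_of_ne hs ht hst (by decide) h6s h7s h8s h6t h7t h8t)
      (h.col_of_ne hs ht hst (by decide) h6s h7s (h3s i hi) h6t h7t hit)
  have hncol : ∀ a b d : Fin 9, (a : ℕ) < 3 → 3 ≤ (b : ℕ) → (b : ℕ) < 6 → (d : ℕ) < 6 → d ≠ a →
      d ≠ b → ¬ Col a b d := by
    intro a b d ha hb hb6 hd hda hdb hcol
    by_cases hd3 : (d : ℕ) < 3
    · have := h.mem_of_col (h.col_swap (h.col_rotate (h.col_rotate hcol hdb.symm) hda)) hs hda.symm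
        (h3s a ha) (h3s d hd3)
      have := hs' b this hb6
      omega
    · obtain ⟨t, ht, hat, hbt, hdt, h6t, h7t, h8t, -⟩ := h.exists_plane_of_six_of_col hA hmem
        (i := a) (j := b) (k := d) (by omega) hb6 hd (by omega) (by omega) (by omega) hcol
      have hst : s ≠ t := by
        rintro rfl
        have := hs' b hbt hb6
        omega
      exact hline a t ht hst ha hat h6t h7t h8t
  have hex : ∀ a b c : Fin 9, (a : ℕ) < 3 → 3 ≤ (b : ℕ) → (b : ℕ) < 6 → 6 ≤ (c : ℕ) →
      Pl {a, b, c} := by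
    intro a b c ha hb hb6 hc
    refine h.pl_triple _ _ _ (by omega) (by omega) (by omega) ?_
    intro U hU haU hbU hcU d hd d1 d2 d3 e he e1 e2 e3
    by_contra hne
    have hsU : s ≠ U := by
      rintro rfl
      have := hs' b hbU hb6
      omega
    have hUA : U ≠ A := by
      rintro rfl
      rw [hmem] at hcU
      omega
    have key : ∀ d ∈ U, d ≠ a → d ≠ b → d ≠ c → 6 ≤ (d : ℕ) := by
      intro d hd d1 d2 d3
      by_contra! hlt
      exact hncol a b d ha hb hb6 hlt d1 d2 (h.col_of_ne hU hA hUA (by omega) haU hbU hd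
        ((hmem _).2 (by omega)) ((hmem _).2 (by omega)) ((hmem _).2 (by omega)))
    have h1 := key d hd d1 d2 d3
    have h2 := key e he e1 e2 e3
    have h678 : ∀ x : Fin 9, 6 ≤ (x : ℕ) → x ∈ U := by
      intro x hx
      have : x = c ∨ x = d ∨ x = e := by omega
      rcases this with rfl | rfl | rfl <;> assumption
    exact hline a U hU hsU ha haU (h678 6 (by decide)) (h678 7 (by decide)) (h678 8 (by decide))
  refine h.not_transversal (a := ![0, 1, 2]) (b := ![3, 4, 5]) (c := ![6, 7, 8]) (s := A) ?_
    (by decide) (by decide) (by decide) (by decide) (by decide) (by decide) hA ?_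
  · intro i
    rw [hmem]
    revert i
    decide
  · intro m n
    refine hex _ _ _ ?_ ?_ ?_ ?_
    · revert m; decide
    · revert m; decide
    · revert m; decide
    · revert n; decide

/-- Because `0` and `1` are off the plane of `6, 7, 8` and `A` has no collinear triples, `{6, 7, 0}`
and `{8, 1, 2}` are planes with three points. Then `3, 4, 5`, which are on `A` together with `0`,
are collinear. -/
theorem false_of_six_of_not_col (h : CubicPlaneSystem Pl Col) {A C : Finset (Fin 9)} (hA : Pl A)
    (hmem : ∀ i, i ∈ A ↔ (i : ℕ) < 6) (hncol : ∀ i j k : Fin 9, (i : ℕ) < 6 → (j : ℕ) < 6 →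
      (k : ℕ) < 6 → i ≠ j → i ≠ k → j ≠ k → ¬ Col i j k) (hC : Pl C) (h678 : ¬ Col 6 7 8)
    (h6C : 6 ∈ C) (h7C : 7 ∈ C) (h8C : 8 ∈ C) (h0C : 0 ∉ C) (h1C : 1 ∉ C) : False := by
  have hA' : ∀ i : Fin 9, (i : ℕ) < 6 → i ∈ A := fun i hi => (hmem i).2 hi
  have key : ∀ U, Pl U → ∀ a b d x : Fin 9, (a : ℕ) < 6 → (b : ℕ) < 6 → (d : ℕ) < 6 → 6 ≤ (x : ℕ) →
      a ∈ U → b ∈ U → x ∈ U → a ≠ b → d ≠ a → d ≠ b → d ∉ U := by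
    intro U hU a b d x ha hb hd hx haU hbU hxU hab hda hdb hdU
    have hUA : U ≠ A := by
      rintro rfl
      rw [hmem] at hxU
      omega
    exact hncol a b d ha hb hd hab hda.symm hdb.symm
      (h.col_of_ne hU hA hUA hab haU hbU hdU (hA' _ ha) (hA' _ hb) (hA' _ hd))
  have h670 : Pl {6, 7, 0} := by
    refine h.pl_triple _ _ _ (by decide) (by decide) (by decide) ?_
    intro U hU h6U h7U h0U d hd d1 d2 d3 e he e1 e2 e3
    by_contra hne
    have hUC : U ≠ C := by rintro rfl; exact h0C h0U
    have h8U : 8 ∉ U := fun h8U =>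
      h678 (h.col_of_ne hU hC hUC (by decide) h6U h7U h8U h6C h7C h8C)
    have hd8 : d ≠ 8 := by rintro rfl; exact h8U hd
    have he8 : e ≠ 8 := by rintro rfl; exact h8U he
    exact key U hU 0 d e 6 (by decide) (by omega) (by omega) (by decide) h0U hd h6U d3.symm e3 hne he
  have h812 : Pl {8, 1, 2} := by
    refine h.pl_triple _ _ _ (by decide) (by decide) (by decide) ?_
    intro U hU h8U h1U h2U d hd d1 d2 d3 e he e1 e2 e3
    by_contra hne
    have hUC : U ≠ C := by rintro rfl; exact h1C h1U
    have hd6 : 6 ≤ (d : ℕ) := by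
      by_contra! hlt
      exact key U hU 1 2 d 8 (by decide) (by decide) hlt (by decide) h1U h2U h8U (by decide) d2 d3 hd
    have he6 : 6 ≤ (e : ℕ) := by
      by_contra! hlt
      exact key U hU 1 2 e 8 (by decide) (by decide) hlt (by decide) h1U h2U h8U (by decide) e2 e3 he
    have h6U : 6 ∈ U := by
      have : 6 = d ∨ 6 = e := by omega
      rcases this with rfl | rfl <;> assumption
    have h7U : 7 ∈ U := by
      have : 7 = d ∨ 7 = e := by omega
      rcases this with rfl | rfl <;> assumption
    exact h678 (h.col_of_ne hU hC hUC (by decide) h6U h7U h8U h6C h7C h8C)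
  exact hncol 3 4 5 (by decide) (by decide) (by decide) (by decide) (by decide) (by decide)
    (h.col_of_mem h670 h812 hA (w := 0) (by decide) (hA' _ (by decide)) (hA' _ (by decide))
      (hA' _ (by decide)) (hA' _ (by decide)) (by simp))

set_option maxHeartbeats 1000000 in
/-- The points outside a plane with six points are not collinear. -/
theorem not_col_of_six (h : CubicPlaneSystem Pl Col) {A : Finset (Fin 9)} (hA : Pl A)
    (hmem : ∀ i, i ∈ A ↔ (i : ℕ) < 6) (hncol : ∀ i j k : Fin 9, (i : ℕ) < 6 → (j : ℕ) < 6 →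
      (k : ℕ) < 6 → i ≠ j → i ≠ k → j ≠ k → ¬ Col i j k) : ¬ Col 6 7 8 := by
  intro h678
  have hA' : ∀ i : Fin 9, (i : ℕ) < 6 → i ∈ A := fun i hi => (hmem i).2 hi
  have key : ∀ U, Pl U → ∀ a b d x : Fin 9, (a : ℕ) < 6 → (b : ℕ) < 6 → (d : ℕ) < 6 → 6 ≤ (x : ℕ) →
      a ∈ U → b ∈ U → x ∈ U → a ≠ b → d ≠ a → d ≠ b → d ∉ U := by
    intro U hU a b d x ha hb hd hx haU hbU hxU hab hda hdb hdU
    have hUA : U ≠ A := by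
      rintro rfl
      rw [hmem] at hxU
      omega
    exact hncol a b d ha hb hd hab hda.symm hdb.symm
      (h.col_of_ne hU hA hUA hab haU hbU hdU (hA' _ ha) (hA' _ hb) (hA' _ hd))
  have hline : ∀ U, Pl U → ∀ x y z : Fin 9, 6 ≤ (x : ℕ) → 6 ≤ (y : ℕ) → 6 ≤ (z : ℕ) → x ≠ y →
      x ∈ U → y ∈ U → z ∈ U := by
    intro U hU x y z hx hy hz hxy hxU hyU
    by_cases hzx : z = x
    · rwa [hzx]
    by_cases hzy : z = y
    · rwa [hzy]
    have hxyz : Col x y z := by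
      have h1 := h.col_rotate h678 (by decide)
      have h2 := h.col_rotate h1 (by decide)
      have h1' := h.col_swap h1
      have h2' := h.col_swap h2
      have h678' := h.col_swap h678
      have : (x = 6 ∧ y = 7 ∧ z = 8) ∨ (x = 6 ∧ y = 8 ∧ z = 7) ∨ (x = 7 ∧ y = 6 ∧ z = 8) ∨
        (x = 7 ∧ y = 8 ∧ z = 6) ∨ (x = 8 ∧ y = 6 ∧ z = 7) ∨ (x = 8 ∧ y = 7 ∧ z = 6) := by omega
      rcases this with ⟨rfl, rfl, rfl⟩ | ⟨rfl, rfl, rfl⟩ | ⟨rfl, rfl, rfl⟩ | ⟨rfl, rfl, rfl⟩ |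
        ⟨rfl, rfl, rfl⟩ | ⟨rfl, rfl, rfl⟩ <;> assumption
    exact h.mem_of_col hxyz hU hxy hxU hyU
  -- The planes through the line of `6, 7, 8` split the points of `A` into three pairs, below `0, b`
  -- and `c, d` and `e, f`.
  have hpair : ∀ a : Fin 9, (a : ℕ) < 6 → ∃ b : Fin 9, (b : ℕ) < 6 ∧ b ≠ a ∧ ∃ s, Pl s ∧ a ∈ s ∧
      b ∈ s ∧ 6 ∈ s ∧ 7 ∈ s ∧ 8 ∈ s := by
    intro a ha
    obtain ⟨s, hs, h6s, h7s, has⟩ := h.exists_plane 6 7 a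
    have h8s := h.mem_of_col h678 hs (by decide) h6s h7s
    obtain ⟨e, he, h1, h2, h3, h4⟩ := h.exists_fifth hs (a := 6) (b := 7) (c := 8) (d := a)
      (by simp; omega) h6s h7s h8s has
    exact ⟨e, by omega, h4, s, hs, has, he, h6s, h7s, h8s⟩
  have hmeet : ∀ s t, Pl s → Pl t → 6 ∈ s → 7 ∈ s → 6 ∈ t → 7 ∈ t → ∀ a : Fin 9, (a : ℕ) < 6 →
      a ∈ s → a ∈ t → s = t := by
    intro s t hs ht h6s h7s h6t h7t a ha has hat
    by_contra hst
    exact h.not_four (i := 6) (j := 7) (k := 8) (l := a) (by decide) (by decide) (by decide)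
      (by omega) (by omega) (by omega) h678 (h.col_of_ne hs ht hst (by decide) h6s h7s has h6t h7t
      hat)
  obtain ⟨b, hb, hb0, s, hs, h0s, hbs, h6s, h7s, h8s⟩ := hpair 0 (by decide)
  have hs2 : ∀ c : Fin 9, (c : ℕ) < 6 → c ≠ 0 → c ≠ b → c ∉ s := fun c hc hc0 hcb =>
    key s hs 0 b c 6 (by decide) hb hc (by decide) h0s hbs h6s hb0.symm hc0 hcb
  obtain ⟨c, hc, hc0, hcb⟩ : ∃ c : Fin 9, (c : ℕ) < 6 ∧ c ≠ 0 ∧ c ≠ b := by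
    by_cases h1 : b = 1
    · exact ⟨2, by decide, by decide, by simp [h1]⟩
    · exact ⟨1, by decide, by decide, Ne.symm h1⟩
  obtain ⟨d, hd, hdc, t, ht, hct, hdt, h6t, h7t, h8t⟩ := hpair c hc
  have hst : s ≠ t := by rintro rfl; exact hs2 c hc hc0 hcb hct
  have ht2 : ∀ e : Fin 9, (e : ℕ) < 6 → e ≠ c → e ≠ d → e ∉ t := fun e he hec hed =>
    key t ht c d e 6 hc hd he (by decide) hct hdt h6t hdc.symm hec hed
  have hd0 : d ≠ 0 := by
    rintro rfl
    exact hst (hmeet s t hs ht h6s h7s h6t h7t 0 (by decide) h0s hdt)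
  have hdb : d ≠ b := by
    rintro rfl
    exact hst (hmeet s t hs ht h6s h7s h6t h7t _ hb hbs hdt)
  obtain ⟨e, he, he0, heb, hec, hed⟩ : ∃ e : Fin 9, (e : ℕ) < 6 ∧ e ≠ 0 ∧ e ≠ b ∧ e ≠ c ∧
      e ≠ d := by
    by_contra! hcon
    have h1 := hcon 1 (by decide) (by decide)
    have h2 := hcon 2 (by decide) (by decide)
    have h3 := hcon 3 (by decide) (by decide)
    have h4 := hcon 4 (by decide) (by decide)
    omega
  obtain ⟨f, hf, hfe, u, hu, heu, hfu, h6u, h7u, h8u⟩ := hpair e he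
  have hsu : s ≠ u := by rintro rfl; exact hs2 e he he0 heb heu
  have htu : t ≠ u := by rintro rfl; exact ht2 e he hec hed heu
  have hf0 : f ≠ 0 := by
    rintro rfl
    exact hsu (hmeet s u hs hu h6s h7s h6u h7u 0 (by decide) h0s hfu)
  have hfb : f ≠ b := by
    rintro rfl
    exact hsu (hmeet s u hs hu h6s h7s h6u h7u _ hb hbs hfu)
  have hfc : f ≠ c := by
    rintro rfl
    exact htu (hmeet t u ht hu h6t h7t h6u h7u _ hc hct hfu)
  have hfd : f ≠ d := by
    rintro rfl
    exact htu (hmeet t u ht hu h6t h7t h6u h7u _ hd hdt hfu)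
  have hu2 : ∀ i : Fin 9, (i : ℕ) < 6 → i ≠ e → i ≠ f → i ∉ u := fun i hi hie hif =>
    key u hu e f i 6 he hf hi (by decide) heu hfu h6u hfe.symm hie hif
  have hex : ∀ x p q : Fin 9, 6 ≤ (x : ℕ) → (p = c ∨ p = d) → (q = e ∨ q = f) → Pl {x, p, q} := by
    intro x p q hx hp hq
    have hp6 : (p : ℕ) < 6 := by rcases hp with rfl | rfl <;> assumption
    have hq6 : (q : ℕ) < 6 := by rcases hq with rfl | rfl <;> assumption
    have hpt : p ∈ t := by rcases hp with rfl | rfl <;> assumption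
    have hqu : q ∈ u := by rcases hq with rfl | rfl <;> assumption
    have hpq : p ≠ q := by
      rintro rfl
      exact htu (hmeet t u ht hu h6t h7t h6u h7u _ hp6 hpt hqu)
    refine h.pl_triple _ _ _ (by omega) (by omega) hpq ?_
    intro U hU hxU hpU hqU i hi i1 i2 i3 j hj j1 j2 j3
    exfalso
    have hi6 : 6 ≤ (i : ℕ) := by
      by_contra! hlt
      exact key U hU p q i x hp6 hq6 hlt hx hpU hqU hxU hpq i2 i3 hi
    have h6U := hline U hU x i 6 hx hi6 (by decide) i1.symm hxU hi
    have h7U := hline U hU x i 7 hx hi6 (by decide) i1.symm hxU hi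
    exact htu ((hmeet t U ht hU h6t h7t h6U h7U p hp6 hpt hpU).trans
      (hmeet u U hu hU h6u h7u h6U h7U q hq6 hqu hqU).symm)
  -- Two triples use up `c, d, e, f` and two points of the line, so `0`, `b` and the third point of
  -- the line are collinear. Two choices of this point give four points on a line.
  have fin : ∀ x y z : Fin 9, 6 ≤ (x : ℕ) → 6 ≤ (y : ℕ) → 6 ≤ (z : ℕ) → x ≠ y → x ≠ z → y ≠ z →
      Col 0 b x := by
    intro x y z hx hy hz hxy hxz hyz
    refine h.col_of_mem (hex y c e hy (.inl rfl) (.inl rfl)) (hex z d f hz (.inr rfl) (.inr rfl))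
      hs ?_ h0s hbs (hline s hs 6 7 x (by decide) (by decide) hx (by decide) h6s h7s)
      (hline s hs 6 7 y (by decide) (by decide) hy (by decide) h6s h7s) (.inl rfl)
    have hlt : ∀ p q : Fin 9, (p : ℕ) < 6 → 6 ≤ (q : ℕ) → p ≠ q := by omega
    have h0 : ((0 : Fin 9) : ℕ) < 6 := by decide
    have hce : c ≠ e := hec.symm
    simp only [List.nodup_cons, List.mem_cons, List.not_mem_nil, not_or, or_false, not_false_eq_true,
      List.nodup_nil, and_true]
    and_intros <;> first
      | assumption
      | (apply Ne.symm; assumption)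
      | exact hlt _ _ (by assumption) (by assumption)
      | exact (hlt _ _ (by assumption) (by assumption)).symm
  exact h.not_four (i := 0) (j := b) (k := 6) (l := 7) hb0.symm (by decide) (by omega) (by decide)
    (by omega) (by decide)
    (fin 6 7 8 (by decide) (by decide) (by decide) (by decide) (by decide) (by decide))
    (fin 7 6 8 (by decide) (by decide) (by decide) (by decide) (by decide) (by decide))

theorem card_ne_six (h : CubicPlaneSystem Pl Col) {A : Finset (Fin 9)} (hA : Pl A) :
    A.card ≠ 6 := by
  intro h6
  by_cases htri : ∃ i ∈ A, ∃ j ∈ A, ∃ k ∈ A, i ≠ j ∧ i ≠ k ∧ j ≠ k ∧ Col i j k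
  · obtain ⟨i, hi, j, hj, k, hk, hij, hik, hjk, hcol⟩ := htri
    obtain ⟨σ, hσ, h', B, hB, hmem, hBA⟩ := h.exists_comap hA (l := [i, j, k]) (by simp; tauto)
      (by simp; tauto)
    have e0 : σ 0 = i := hσ 0 (by simp) (by simp)
    have e1 : σ 1 = j := hσ 1 (by simp) (by simp)
    have e2 : σ 2 = k := hσ 2 (by simp) (by simp)
    rw [h6] at hmem
    exact h'.false_of_six_of_col hB hmem (by rwa [e0, e1, e2])
  · push Not at htri
    have hncol : ∀ (σ : Equiv.Perm (Fin 9)) (B : Finset (Fin 9)), (∀ i, i ∈ B ↔ (i : ℕ) < 6) →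
        (∀ i, i ∈ B ↔ σ i ∈ A) → ∀ i j k : Fin 9, (i : ℕ) < 6 → (j : ℕ) < 6 → (k : ℕ) < 6 →
        i ≠ j → i ≠ k → j ≠ k → ¬ Col (σ i) (σ j) (σ k) := by
      intro σ B hmem hBA i j k hi hj hk hij hik hjk
      exact htri _ ((hBA i).1 ((hmem i).2 hi)) _ ((hBA j).1 ((hmem j).2 hj)) _
        ((hBA k).1 ((hmem k).2 hk)) (σ.injective.ne hij) (σ.injective.ne hik) (σ.injective.ne hjk)
    obtain ⟨x, y, z, hxy, hxz, hyz, hA3⟩ := Finset.card_eq_three.1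
      (show Aᶜ.card = 3 by rw [Finset.card_compl, Fintype.card_fin, h6])
    obtain ⟨C, hC, hx, hy, hz⟩ := h.exists_plane x y z
    have hCA : C ≠ A := by
      rintro rfl
      have : x ∈ Cᶜ := by rw [hA3]; simp
      simp at this
      exact this hx
    have hcard : (C ∩ A).card ≤ 2 := by
      by_contra! hlt
      obtain ⟨i, hi, j, hj, k, hk, hij, hik, hjk⟩ := Finset.two_lt_card.1 hlt
      rw [Finset.mem_inter] at hi hj hk
      exact htri i hi.2 j hj.2 k hk.2 hij hik hjk
        (h.col_of_ne hC hA hCA hij hi.1 hj.1 hk.1 hi.2 hj.2 hk.2)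
    have hcard2 : 1 < (A \ C).card := by
      have := Finset.card_sdiff_add_card_inter A C
      rw [Finset.inter_comm] at this
      omega
    obtain ⟨c, hc, d, hd, hcd⟩ := Finset.one_lt_card.1 hcard2
    rw [Finset.mem_sdiff] at hc hd
    obtain ⟨σ, hσ, h', B, hB, hmem, hBA⟩ := h.exists_comap hA (l := [c, d]) (by simpa)
      (by simp; tauto)
    rw [h6] at hmem
    have e0 : σ 0 = c := hσ 0 (by simp) (by simp)
    have e1 : σ 1 = d := hσ 1 (by simp) (by simp)
    have hC3 : ∀ i : Fin 9, 6 ≤ (i : ℕ) → σ i ∈ C := by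
      intro i hi
      have : σ i ∈ Aᶜ := by
        rw [Finset.mem_compl, ← hBA, hmem]
        omega
      rw [hA3] at this
      simp only [Finset.mem_insert, Finset.mem_singleton] at this
      rcases this with h | h | h <;> rwa [h]
    refine h'.false_of_six_of_not_col (C := C.map σ.symm.toEmbedding) hB hmem
      (hncol σ B hmem hBA) (by simpa [Finset.map_map] using hC)
      (h'.not_col_of_six hB hmem (hncol σ B hmem hBA)) ?_ ?_ ?_ ?_ ?_
    · simpa using hC3 6 (by decide)
    · simpa using hC3 7 (by decide)
    · simpa using hC3 8 (by decide)
    · simpa [e0] using hc.2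
    · simpa [e1] using hd.2

theorem card_le_three_or_eq_five (h : CubicPlaneSystem Pl Col) {s : Finset (Fin 9)} (hs : Pl s) :
    s.card ≤ 3 ∨ s.card = 5 := by
  have := h.card_ne_four hs
  have := h.card_ne_six hs
  have := h.card_ne_seven hs
  have := h.card_ne_eight hs
  have := h.card_ne_nine hs
  have := Finset.card_le_univ s
  simp at this
  omega

end CubicPlaneSystem

end

/-! ### Planes with five points and the existence of a collinear triple -/

section

namespace CubicPlaneSystem

variable {Pl : Finset (Fin 9) → Prop} {Col : Fin 9 → Fin 9 → Fin 9 → Prop}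

theorem map_symm_map (s : Finset (Fin 9)) (σ : Equiv.Perm (Fin 9)) :
    (s.map σ.symm.toEmbedding).map σ.toEmbedding = s := by
  ext i
  simp

theorem not_nodup_of_forall_mem (h : CubicPlaneSystem Pl Col) {s : Finset (Fin 9)} (hs : Pl s)
    {l : List (Fin 9)} (hl : 5 < l.length) (hmem : ∀ i ∈ l, i ∈ s) : ¬ l.Nodup := by
  intro hnd
  have h1 := Finset.card_le_card (show l.toFinset ⊆ s from fun i hi => hmem i (List.mem_toFinset.1 hi))
  rw [List.toFinset_card_of_nodup hnd] at h1
  have := h.card_le_three_or_eq_five hs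
  omega

section NoTriads

variable (h : CubicPlaneSystem Pl Col) (hncol : ∀ i j k, i ≠ j → i ≠ k → j ≠ k → ¬ Col i j k)

include h hncol

theorem eq_of_not_col {s t : Finset (Fin 9)} (hs : Pl s) (ht : Pl t) {i j k : Fin 9} (hij : i ≠ j)
    (hik : i ≠ k) (hjk : j ≠ k) (his : i ∈ s) (hjs : j ∈ s) (hks : k ∈ s) (hit : i ∈ t)
    (hjt : j ∈ t) (hkt : k ∈ t) : s = t := by
  by_contra hst
  exact hncol i j k hij hik hjk (h.col_of_ne hs ht hst hij his hjs hks hit hjt hkt)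

/-- The plane `C` consists of `0` and the four points outside `A`, so a plane through one of `1, …,
4` and two outside points has only three points. The triples `{3, 5, 6}` and `{4, 7, 8}` make `0, 1,
2` collinear. -/
theorem false_of_five_of_mem {A C : Finset (Fin 9)} (hA : Pl A) (hmem : ∀ i, i ∈ A ↔ (i : ℕ) < 5)
    (hC : Pl C) (h0 : 0 ∈ C) (hC5 : ∀ i : Fin 9, 5 ≤ (i : ℕ) → i ∈ C) : False := by
  have hA' : ∀ i : Fin 9, (i : ℕ) < 5 → i ∈ A := fun i hi => (hmem i).2 hi
  have hC' : ∀ i : Fin 9, i ≠ 0 → (i : ℕ) < 5 → i ∉ C := by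
    intro i hi0 hi hiC
    refine h.not_nodup_of_forall_mem hC (l := [0, i, 5, 6, 7, 8]) (by simp) ?_ ?_
    · simp [h0, hiC, hC5]
    · simp; omega
  have hex : ∀ a b c : Fin 9, a ≠ 0 → (a : ℕ) < 5 → 5 ≤ (b : ℕ) → 5 ≤ (c : ℕ) → b ≠ c →
      Pl {a, b, c} := by
    intro a b c ha0 ha hb hc hbc
    refine h.pl_triple _ _ _ (by omega) (by omega) hbc ?_
    intro U hU haU hbU hcU d hd d1 d2 d3 e he e1 e2 e3
    by_contra hne
    have key : ∀ d ∈ U, d ≠ b → d ≠ c → (d : ℕ) < 5 := by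
      intro d hd d2 d3
      by_contra! hlt
      have := h.eq_of_not_col hncol hU hC hbc d2.symm d3.symm hbU hcU hd (hC5 _ hb) (hC5 _ hc)
        (hC5 _ hlt)
      subst this
      exact hC' a ha0 ha haU
    have := h.eq_of_not_col hncol hU hA d1.symm e1.symm (Ne.symm hne) haU hd he (hA' _ ha)
      (hA' _ (key d hd d2 d3)) (hA' _ (key e he e2 e3))
    subst this
    rw [hmem] at hbU
    omega
  exact hncol 0 1 2 (by decide) (by decide) (by decide) (h.col_of_mem
    (hex 3 5 6 (by decide) (by decide) (by decide) (by decide) (by decide))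
    (hex 4 7 8 (by decide) (by decide) (by decide) (by decide) (by decide)) hA (w := 3) (by decide)
    (hA' _ (by decide)) (hA' _ (by decide)) (hA' _ (by decide)) (hA' _ (by decide)) (by simp))

/-- For `a` in `A`, the plane through `0, a, 5` is no triple, since otherwise the other three points
of `A` would be collinear; so it contains two of `6, 7, 8`. The planes for `a = 1` and `a = 2` then
share one of these besides `0` and `5`. They coincide, contain `0, 1, 2` and equal `A`, which misses
`5`. -/
theorem false_of_five_of_triple {A : Finset (Fin 9)} (hA : Pl A)
    (hmem : ∀ i, i ∈ A ↔ (i : ℕ) < 5) (h678 : Pl {6, 7, 8}) : False := by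
  have hA' : ∀ i : Fin 9, (i : ℕ) < 5 → i ∈ A := fun i hi => (hmem i).2 hi
  have key : ∀ a x y z : Fin 9, [0, a, 5, 6, 7, 8, x, y, z].Nodup → (a : ℕ) < 5 → (x : ℕ) < 5 →
      (y : ℕ) < 5 → (z : ℕ) < 5 → ∃ s, Pl s ∧ 0 ∈ s ∧ a ∈ s ∧ 5 ∈ s ∧ s ≠ A ∧ ∃ d ∈ s, ∃ e ∈ s,
      d ≠ e ∧ 5 < (d : ℕ) ∧ 5 < (e : ℕ) := by
    intro a x y z hnd ha hx hy hz
    have ha0 : a ≠ 0 := by rintro rfl; simp at hnd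
    have hxyz : x ≠ y ∧ x ≠ z ∧ y ≠ z := by
      have := (List.nodup_append (l₁ := [0, a, 5, 6, 7, 8]) (l₂ := [x, y, z])).1 hnd
      simpa [and_assoc] using this.2.1
    by_contra! hcon
    refine hncol x y z hxyz.1 hxyz.2.1 hxyz.2.2 (h.col_of_mem
      (h.pl_triple 0 a 5 ha0.symm (by decide) (by omega) ?_) h678 hA hnd (hA' _ hx) (hA' _ hy)
      (hA' _ hz) (hA' 0 (by decide)) (by simp))
    intro U hU h0U haU h5U d hd d1 d2 d3 e he e1 e2 e3
    by_contra hne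
    have hUA : U ≠ A := by
      rintro rfl
      simp [hmem] at h5U
    have h5 : ∀ d ∈ U, d ≠ 0 → d ≠ a → d ≠ 5 → 5 < (d : ℕ) := by
      intro d hd d1 d2 d3
      by_contra! hle
      have hlt : (d : ℕ) < 5 := by omega
      exact hUA (h.eq_of_not_col hncol hU hA ha0.symm d1.symm d2.symm h0U haU hd
        (hA' _ (by decide)) (hA' _ ha) (hA' _ hlt))
    have := hcon U hU h0U haU h5U hUA d hd e he (Ne.symm hne) (h5 d hd d1 d2 d3)
    have := h5 e he e1 e2 e3
    omega
  obtain ⟨s, hs, h0s, h1s, h5s, hsA, d, hd, e, he, hde, hd5, he5⟩ :=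
    key 1 2 3 4 (by decide) (by decide) (by decide) (by decide) (by decide)
  obtain ⟨t, ht, h0t, h2t, h5t, htA, d', hd', e', he', hde', hd5', he5'⟩ :=
    key 2 1 3 4 (by decide) (by decide) (by decide) (by decide) (by decide)
  have hst : s ≠ t := by
    rintro rfl
    exact hsA (h.eq_of_not_col hncol hs hA (i := 0) (j := 1) (k := 2) (by decide) (by decide)
      (by decide) h0s h1s h2t (hA' _ (by decide)) (hA' _ (by decide)) (hA' _ (by decide)))
  have hm : ∀ m : Fin 9, 5 < (m : ℕ) → m ∈ s → m ∉ t := fun m hm hms hmt =>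
    hst (h.eq_of_not_col hncol hs ht (i := 0) (j := 5) (k := m) (by decide) (by omega)
      (by omega) h0s h5s hms h0t h5t hmt)
  have : d = d' ∨ d = e' ∨ e = d' ∨ e = e' := by omega
  rcases this with rfl | rfl | rfl | rfl
  · exact hm _ hd5 hd hd'
  · exact hm _ hd5 hd he'
  · exact hm _ he5 he hd'
  · exact hm _ he5 he he'

/-- If the four outside points are coplanar, their plane has a fifth point, which is in `A`.
Otherwise each plane through three outside points contains two points of `A`. Two such planes share
two outside points, hence no point of `A`, so three of them give six points on `A`. -/
theorem false_of_five {A : Finset (Fin 9)} (hA : Pl A) (hmem : ∀ i, i ∈ A ↔ (i : ℕ) < 5) :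
    False := by
  have hA' : ∀ i : Fin 9, (i : ℕ) < 5 → i ∈ A := fun i hi => (hmem i).2 hi
  by_cases hC : ∃ C, Pl C ∧ ∀ i : Fin 9, 5 ≤ (i : ℕ) → i ∈ C
  · obtain ⟨C, hC, hC5⟩ := hC
    obtain ⟨p, hp, hp5, hp6, hp7, hp8⟩ := h.exists_fifth hC (a := 5) (b := 6) (c := 7) (d := 8)
      (by decide) (hC5 _ (by decide)) (hC5 _ (by decide)) (hC5 _ (by decide)) (hC5 _ (by decide))
    have hp : (p : ℕ) < 5 := by omega
    have hσ : ∀ i : Fin 9, ((Equiv.swap 0 p i : Fin 9) : ℕ) < 5 ↔ (i : ℕ) < 5 := by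
      intro i
      rw [Equiv.swap_apply_def]
      split_ifs with h1 h2
      · simp [h1, hp]
      · simp [h2, hp]
      · rfl
    refine (h.comap (Equiv.swap 0 p)).false_of_five_of_mem (fun i j k hij hik hjk => hncol _ _ _
      ((Equiv.injective _).ne hij) ((Equiv.injective _).ne hik) ((Equiv.injective _).ne hjk))
      (A := A.map (Equiv.swap 0 p).symm.toEmbedding) (C := C.map (Equiv.swap 0 p).symm.toEmbedding)
      (by rwa [map_symm_map]) ?_ (by rwa [map_symm_map]) ?_ ?_
    · intro i
      rw [← hσ, ← hmem]
      simp
    · simpa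
    · intro i hi
      have : 5 ≤ ((Equiv.swap 0 p i : Fin 9) : ℕ) := by
        rw [← not_lt, hσ]
        omega
      simpa using hC5 _ this
  · push Not at hC
    have key : ∀ x y z w : Fin 9, 5 ≤ (x : ℕ) → 5 ≤ (y : ℕ) → 5 ≤ (z : ℕ) → 5 ≤ (w : ℕ) →
        [x, y, z, w].Nodup → ∃ s, Pl s ∧ x ∉ s ∧ y ∈ s ∧ z ∈ s ∧ w ∈ s ∧ ∃ d ∈ s, ∃ e ∈ s, d ≠ e ∧
        (d : ℕ) < 5 ∧ (e : ℕ) < 5 := by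
      intro x y z w hx hy hz hw hnd
      simp at hnd
      obtain ⟨s, hs, hys, hzs, hws⟩ := h.exists_plane y z w
      have hxs : x ∉ s := by
        intro hxs
        obtain ⟨i, hi, his⟩ := hC s hs
        have : i = x ∨ i = y ∨ i = z ∨ i = w := by omega
        rcases this with rfl | rfl | rfl | rfl <;> exact his (by assumption)
      refine ⟨s, hs, hxs, hys, hzs, hws, ?_⟩
      by_contra! hcon
      have hσ : ∃ σ : Equiv.Perm (Fin 9), (∀ i, ((σ i : Fin 9) : ℕ) < 5 ↔ (i : ℕ) < 5) ∧ σ 6 = y ∧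
          σ 7 = z ∧ σ 8 = w := by
        obtain ⟨σ, hσ, -⟩ := exists_perm_fin_nine Finset.univ [0, 1, 2, 3, 4, x, y, z, w]
          (by simp [hnd]; omega) (by simp)
        have hx' : ¬ (x : ℕ) < 5 := by omega
        have hy' : ¬ (y : ℕ) < 5 := by omega
        have hz' : ¬ (z : ℕ) < 5 := by omega
        have hw' : ¬ (w : ℕ) < 5 := by omega
        refine ⟨σ, fun i => ?_, hσ 6 (by simp) (by simp), hσ 7 (by simp) (by simp),
          hσ 8 (by simp) (by simp)⟩
        rw [← Fin.eta i i.2, hσ i (by simp) i.2]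
        fin_cases i <;> simp [*]
      obtain ⟨σ, hσ, h6, h7, h8⟩ := hσ
      refine (h.comap σ).false_of_five_of_triple (fun i j k hij hik hjk => hncol _ _ _
        ((Equiv.injective _).ne hij) ((Equiv.injective _).ne hik) ((Equiv.injective _).ne hjk))
        (A := A.map σ.symm.toEmbedding) (by rwa [map_symm_map]) ?_ ?_
      · intro i
        rw [← hσ, ← hmem]
        simp
      · have : s = {y, z, w} := by
          refine h.eq_triple_of_forall hs (by tauto) (by tauto) (by tauto) hys hzs hws ?_
          intro d hd d1 d2 d3 e he e1 e2 e3
          have : d ≠ x := by rintro rfl; exact hxs hd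
          have : e ≠ x := by rintro rfl; exact hxs he
          by_contra hne
          have := hcon d hd e he (Ne.symm hne) (by omega)
          omega
        rw [this] at hs
        simpa [h6, h7, h8] using hs
    obtain ⟨s, hs, h5s, h6s, h7s, h8s, d, hd, e, he, hde, hd5, he5⟩ := key 5 6 7 8 (by decide)
      (by decide) (by decide) (by decide) (by decide)
    obtain ⟨t, ht, h6t, h5t, h7t, h8t, d', hd', e', he', hde', hd5', he5'⟩ := key 6 5 7 8
      (by decide) (by decide) (by decide) (by decide) (by decide)
    obtain ⟨u, hu, h7u, h5u, h6u, h8u, d₂, hd₂, e₂, he₂, hde₂, hd5₂, he5₂⟩ := key 7 5 6 8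
      (by decide) (by decide) (by decide) (by decide) (by decide)
    have meet : ∀ s t, Pl s → Pl t → s ≠ t → ∀ x y : Fin 9, 5 ≤ (x : ℕ) → 5 ≤ (y : ℕ) → x ≠ y →
        x ∈ s → y ∈ s → x ∈ t → y ∈ t → ∀ a ∈ s, ∀ b ∈ t, (a : ℕ) < 5 → a ≠ b := by
      rintro s t hs ht hst x y hx hy hxy hxs hys hxt hyt a has _ hat ha rfl
      exact hst (h.eq_of_not_col hncol hs ht hxy (k := a) (by omega) (by omega) hxs hys has hxt hyt
        hat)
    have hst := meet s t hs ht (by rintro rfl; exact h5s h5t) 7 8 (by decide) (by decide)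
      (by decide) h7s h8s h7t h8t
    have hsu := meet s u hs hu (by rintro rfl; exact h5s h5u) 6 8 (by decide) (by decide)
      (by decide) h6s h8s h6u h8u
    have htu := meet t u ht hu (by rintro rfl; exact h6t h6u) 5 8 (by decide) (by decide)
      (by decide) h5t h8t h5u h8u
    refine h.not_nodup_of_forall_mem hA (l := [d, e, d', e', d₂, e₂]) (by simp) ?_ ?_
    · simp [*]
    · simp only [List.nodup_cons, List.mem_cons, List.not_mem_nil, not_or, or_false,
        not_false_eq_true, List.nodup_nil, and_true]
      refine ⟨⟨hde, hst d hd d' hd' hd5, hst d hd e' he' hd5, hsu d hd d₂ hd₂ hd5,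
        hsu d hd e₂ he₂ hd5⟩, ⟨hst e he d' hd' he5, hst e he e' he' he5, hsu e he d₂ hd₂ he5,
        hsu e he e₂ he₂ he5⟩, ⟨hde', htu d' hd' d₂ hd₂ hd5', htu d' hd' e₂ he₂ hd5'⟩,
        ⟨htu e' he' d₂ hd₂ he5', htu e' he' e₂ he₂ he5'⟩, hde₂⟩

end NoTriads

/-- Three of the nine points are collinear. -/
theorem exists_col (h : CubicPlaneSystem Pl Col) : ∃ i j k, i ≠ j ∧ i ≠ k ∧ j ≠ k ∧ Col i j k := by
  by_contra! hncol
  obtain ⟨s, hs, hs3⟩ := h.exists_three_lt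
  have hs5 := h.card_le_three_or_eq_five hs
  obtain ⟨σ, hσ, h', B, hB, hmem, -⟩ := h.exists_comap hs (l := []) (by simp) (by simp)
  rw [show s.card = 5 by omega] at hmem
  exact h'.false_of_five (fun i j k hij hik hjk => hncol _ _ _ (σ.injective.ne hij)
    (σ.injective.ne hik) (σ.injective.ne hjk)) hB hmem

end CubicPlaneSystem

end

/-! ### Frames: the planes through a collinear triple -/

section

namespace CubicPlaneSystem

variable {Pl : Finset (Fin 9) → Prop} {Col : Fin 9 → Fin 9 → Fin 9 → Prop}

/-- A line through three points and the three planes through this line and further points. -/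
structure Frame (Pl : Finset (Fin 9) → Prop) (Col : Fin 9 → Fin 9 → Fin 9 → Prop)
    (i j k a a' b b' c c' : Fin 9) : Prop where
  nodup : [i, j, k, a, a', b, b', c, c'].Nodup
  col : Col i j k
  pl₁ : Pl {i, j, k, a, a'}
  pl₂ : Pl {i, j, k, b, b'}
  pl₃ : Pl {i, j, k, c, c'}

theorem eq_of_five_mem (h : CubicPlaneSystem Pl Col) {s : Finset (Fin 9)} (hs : Pl s)
    {a b c d e : Fin 9} (hnd : [a, b, c, d, e].Nodup) (ha : a ∈ s) (hb : b ∈ s) (hc : c ∈ s)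
    (hd : d ∈ s) (he : e ∈ s) : s = {a, b, c, d, e} := by
  have h1 := List.toFinset_card_of_nodup hnd
  have h2 := h.card_le_three_or_eq_five hs
  have : s = [a, b, c, d, e].toFinset := by
    refine (Finset.eq_of_subset_of_card_le ?_ ?_).symm
    · intro x hx
      simp only [List.mem_toFinset, List.mem_cons, List.not_mem_nil, or_false] at hx
      rcases hx with rfl | rfl | rfl | rfl | rfl <;> assumption
    · simp only [List.length_cons, List.length_nil] at h1
      omega
  rw [this]
  simp

theorem col_unique (h : CubicPlaneSystem Pl Col) {i j a b : Fin 9} (hab : a ≠ b) (hia : i ≠ a)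
    (hib : i ≠ b) (hja : j ≠ a) (hjb : j ≠ b) (hi : Col i a b) (hj : Col j a b) : i = j := by
  by_contra hij
  exact h.not_four hab hia hib hja hjb hij (h.col_rotate hi hab) (h.col_rotate hj hab)

section Frame

-- The frame is numbered `0, 1, 2 | 3, 4 | 5, 6 | 7, 8`. For `x ≥ 3`, the quotient `(x + 1) / 2` is
-- 2, 3 or 4 and tells the pair of `x`.
variable (h : CubicPlaneSystem Pl Col)
  (hF : ∀ x : Fin 9, 3 ≤ (x : ℕ) → ∃ F, Pl F ∧
    ∀ i : Fin 9, i ∈ F ↔ (i : ℕ) < 3 ∨ ((i : ℕ) + 1) / 2 = ((x : ℕ) + 1) / 2)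

include h hF

/-- If `U` contained two points of the line, it would meet the frame planes of `x` and of `y` in
this line, which would then contain `x` and `y` too. -/
theorem eq_of_mem_of_frame {U : Finset (Fin 9)} (hU : Pl U) {j x y : Fin 9} (hj : (j : ℕ) < 3)
    (hx : 3 ≤ (x : ℕ)) (hy : 3 ≤ (y : ℕ)) (hxy : ((x : ℕ) + 1) / 2 ≠ ((y : ℕ) + 1) / 2)
    (hjU : j ∈ U) (hxU : x ∈ U) (hyU : y ∈ U) {i : Fin 9} (hi : (i : ℕ) < 3) (hiU : i ∈ U) :
    i = j := by
  by_contra hij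
  obtain ⟨F, hF', hFm⟩ := hF x hx
  obtain ⟨G, hG', hGm⟩ := hF y hy
  have hUF : U ≠ F := by
    rintro rfl
    rw [hFm] at hyU
    omega
  have hUG : U ≠ G := by
    rintro rfl
    rw [hGm] at hxU
    omega
  exact h.not_four hij (k := x) (l := y) (by omega) (by omega) (by omega) (by omega)
    (by rintro rfl; exact hxy rfl)
    (h.col_of_ne hU hF' hUF hij hiU hjU hxU ((hFm _).2 (.inl hi)) ((hFm _).2 (.inl hj))
      ((hFm _).2 (.inr rfl)))
    (h.col_of_ne hU hG' hUG hij hiU hjU hyU ((hGm _).2 (.inl hi)) ((hGm _).2 (.inl hj))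
      ((hGm _).2 (.inr rfl)))

/-- A plane which meets the line of a frame in one point either contains only three points or a pair
of the frame which is on a line with this point. -/
theorem pl_triple_or_of_frame {j x y : Fin 9} (hj : (j : ℕ) < 3)
    (hx : 3 ≤ (x : ℕ)) (hy : 3 ≤ (y : ℕ)) (hxy : ((x : ℕ) + 1) / 2 ≠ ((y : ℕ) + 1) / 2) :
    Pl {j, x, y} ∨ ∃ U, Pl U ∧ j ∈ U ∧ x ∈ U ∧ y ∈ U ∧
      (Col j 3 4 ∧ 3 ∈ U ∧ 4 ∈ U ∨ Col j 5 6 ∧ 5 ∈ U ∧ 6 ∈ U ∨ Col j 7 8 ∧ 7 ∈ U ∧ 8 ∈ U) := by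
  by_contra! hcon
  refine hcon.1 (h.pl_triple _ _ _ (by omega) (by omega) (by rintro rfl; exact hxy rfl) ?_)
  intro U hU hjU hxU hyU d hd d1 d2 d3 e he e1 e2 e3
  by_contra hne
  -- `U` meets the plane of a pair in a line through `j`. If `j` is collinear with no pair on `U`,
  -- then `U` has at most one point of each pair, so `x` and `y` leave no room for two more.
  have hpair : ∀ z z' : Fin 9, z ∈ U → z' ∈ U → 3 ≤ (z : ℕ) → (z : ℕ) < z' →
      ((z : ℕ) + 1) / 2 ≠ ((z' : ℕ) + 1) / 2 := by
    intro z z' hz hz' hz3 hlt heq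
    obtain ⟨F, hF', hFm⟩ := hF z hz3
    have hUF : U ≠ F := by
      rintro rfl
      rw [hFm] at hxU hyU
      omega
    have hc : Col j z z' := h.col_of_ne hU hF' hUF (by omega) hjU hz hz' ((hFm _).2 (.inl hj))
      ((hFm _).2 (.inr rfl)) ((hFm _).2 (.inr heq.symm))
    have h3 := hcon.2 U hU hjU hxU hyU
    have : (z = 3 ∧ z' = 4) ∨ (z = 5 ∧ z' = 6) ∨ (z = 7 ∧ z' = 8) := by omega
    rcases this with ⟨rfl, rfl⟩ | ⟨rfl, rfl⟩ | ⟨rfl, rfl⟩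
    · exact h3.1 hc hz hz'
    · exact h3.2.1 hc hz hz'
    · exact h3.2.2 hc hz hz'
  have hpair' : ∀ z z' : Fin 9, z ∈ U → z' ∈ U → 3 ≤ (z : ℕ) → 3 ≤ (z' : ℕ) → z ≠ z' →
      ((z : ℕ) + 1) / 2 ≠ ((z' : ℕ) + 1) / 2 := by
    intro z z' hz hz' hz3 hz3' hne
    rcases lt_or_gt_of_ne (fun e => hne (Fin.ext e) : (z : ℕ) ≠ z') with hlt | hlt
    · exact hpair z z' hz hz' hz3 hlt
    · exact (hpair z' z hz' hz hz3' hlt).symm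
  have h3 : ∀ d ∈ U, d ≠ j → 3 ≤ (d : ℕ) := by
    intro d hd hdj
    by_contra! hlt
    exact hdj (h.eq_of_mem_of_frame hF hU hj hx hy hxy hjU hxU hyU hlt hd)
  have hd3 := h3 d hd d1
  have he3 := h3 e he e1
  have p1 := hpair' d x hd hxU hd3 hx d2
  have p2 := hpair' d y hd hyU hd3 hy d3
  have p3 := hpair' e x he hxU he3 hx e2
  have p4 := hpair' e y he hyU he3 hy e3
  have p5 := hpair' e d he hd he3 hd3 hne
  omega

/-- The point `i` is collinear with no pair, so `{i, 4, b'}` is a triple. If `{k, 3, b}` were one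
too, `j, 7, 8` would be collinear, but only `k` is collinear with `7, 8`. So the plane of `k, 3, b`
contains the only pair that is collinear with `k`. -/
theorem mem_of_frame {j k b b' i : Fin 9} (hi : (i : ℕ) < 3) (hj : (j : ℕ) < 3)
    (hk : (k : ℕ) < 3) (hij : i ≠ j) (hik : i ≠ k) (hjk : j ≠ k)
    (h34 : ∀ i : Fin 9, (i : ℕ) < 3 → ¬ Col i 3 4) (h56 : Col j 5 6) (h78 : Col k 7 8)
    (hb : b = 5 ∧ b' = 6 ∨ b = 6 ∧ b' = 5) :
    ∃ U, Pl U ∧ k ∈ U ∧ 3 ∈ U ∧ b ∈ U ∧ 7 ∈ U ∧ 8 ∈ U := by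
  have h56' : ∀ i : Fin 9, (i : ℕ) < 3 → i ≠ j → ¬ Col i 5 6 := fun i hi hij hc =>
    hij (h.col_unique (by decide) (by omega) (by omega) (by omega) (by omega) hc h56)
  have h78' : ∀ i : Fin 9, (i : ℕ) < 3 → i ≠ k → ¬ Col i 7 8 := fun i hi hij hc =>
    hij (h.col_unique (by decide) (by omega) (by omega) (by omega) (by omega) hc h78)
  have hW : Pl {i, 4, b'} := by
    rcases h.pl_triple_or_of_frame hF hi (x := 4) (y := b') (by decide) (by omega) (by
      rcases hb with ⟨-, rfl⟩ | ⟨-, rfl⟩ <;> decide) with hW | ⟨U, -, -, -, -, hW⟩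
    · exact hW
    · have := h34 i hi
      have := h56' i hi hij
      have := h78' i hi hik
      tauto
  rcases h.pl_triple_or_of_frame hF hk (x := 3) (y := b) (by decide) (by omega) (by
      rcases hb with ⟨rfl, -⟩ | ⟨rfl, -⟩ <;> decide) with hU | ⟨U, hU, hkU, h3U, hbU, hU'⟩
  · obtain ⟨F, hF', hFm⟩ := hF 7 (by decide)
    refine absurd (h.col_of_mem hU hW hF' (x := j) (y := 7) (z := 8) (w := k) ?_
      ((hFm _).2 (.inl hj)) ((hFm _).2 (.inr rfl)) ((hFm _).2 (.inr rfl)) ((hFm _).2 (.inl hk))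
      (.inl rfl)) (h78' j hj hjk)
    have hb5 : b ≠ b' := by omega
    simp only [List.nodup_cons, List.mem_cons, List.not_mem_nil, not_or, or_false,
      not_false_eq_true, List.nodup_nil, and_true]
    and_intros <;> first | assumption | (apply Ne.symm; assumption) | decide | omega
  · have := h34 k hk
    have := h56' k hk hjk.symm
    exact ⟨U, hU, hkU, h3U, hbU, by tauto, by tauto⟩

/-- The planes of `mem_of_frame` for `5` and for `6` share `k, 7, 8` and `3`, so they coincide and
contain six points. -/
theorem false_of_frame {i j k : Fin 9} (hi : (i : ℕ) < 3) (hj : (j : ℕ) < 3)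
    (hk : (k : ℕ) < 3) (hij : i ≠ j) (hik : i ≠ k) (hjk : j ≠ k)
    (h34 : ∀ i : Fin 9, (i : ℕ) < 3 → ¬ Col i 3 4) (h56 : Col j 5 6) (h78 : Col k 7 8) : False := by
  obtain ⟨s, hs, hks, h3s, h5s, h7s, h8s⟩ := h.mem_of_frame hF hi hj hk hij hik hjk h34 h56 h78
    (.inl ⟨rfl, rfl⟩)
  obtain ⟨t, ht, hkt, h3t, h6t, h7t, h8t⟩ := h.mem_of_frame hF hi hj hk hij hik hjk h34 h56 h78
    (.inr ⟨rfl, rfl⟩)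
  have hst : s = t := by
    by_contra hst
    exact h.not_four (i := k) (j := 7) (k := 8) (l := 3) (by omega) (by omega) (by decide)
      (by omega) (by decide) (by decide) h78
      (h.col_of_ne hs ht hst (by omega) hks h7s h3s hkt h7t h3t)
  subst hst
  refine h.not_nodup_of_forall_mem hs (l := [k, 3, 5, 6, 7, 8]) (by simp) ?_ ?_
  · simp [*]
  · simp only [List.nodup_cons, List.mem_cons, List.not_mem_nil, not_or, or_false,
      not_false_eq_true, List.nodup_nil, and_true]
    and_intros <;> first | decide | omega

/-- Each pair of a frame is on a line with a point of the line of the frame. -/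
theorem exists_col_of_frame : ∃ i : Fin 9, (i : ℕ) < 3 ∧ Col i 3 4 := by
  by_contra! h34
  -- Otherwise `{j, 5, 7}` and `{k, 6, 8}` are triples and `i, 3, 4` are collinear. So at least two
  -- points of the line are collinear with `5, 6` or with `7, 8`; uniqueness and `false_of_frame`
  -- exclude this.
  have step : ∀ i j k : Fin 9, (i : ℕ) < 3 → (j : ℕ) < 3 → (k : ℕ) < 3 → i ≠ j → i ≠ k → j ≠ k →
      Col j 5 6 ∨ Col j 7 8 ∨ Col k 5 6 ∨ Col k 7 8 := by
    intro i j k hi hj hk hij hik hjk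
    by_contra! hcon
    obtain ⟨F, hF', hFm⟩ := hF 3 (by decide)
    rcases h.pl_triple_or_of_frame hF hj (x := 5) (y := 7) (by decide) (by decide) (by decide) with
      hU | ⟨U, -, -, -, -, hU⟩
    swap
    · have := h34 j hj
      tauto
    rcases h.pl_triple_or_of_frame hF hk (x := 6) (y := 8) (by decide) (by decide) (by decide) with
      hW | ⟨W, -, -, -, -, hW⟩
    swap
    · have := h34 k hk
      tauto
    refine h34 i hi (h.col_of_mem hU hW hF' (w := j) ?_ ((hFm _).2 (.inl hi))
      ((hFm _).2 (.inr rfl)) ((hFm _).2 (.inr rfl)) ((hFm _).2 (.inl hj)) (.inl rfl))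
    simp only [List.nodup_cons, List.mem_cons, List.not_mem_nil, not_or, or_false,
      not_false_eq_true, List.nodup_nil, and_true]
    and_intros <;> first | assumption | (apply Ne.symm; assumption) | decide | omega
  have fin : ∀ i j k : Fin 9, (i : ℕ) < 3 → (j : ℕ) < 3 → (k : ℕ) < 3 → i ≠ j → i ≠ k → j ≠ k →
      Col j 5 6 → ¬ Col k 7 8 := fun i j k hi hj hk hij hik hjk =>
    h.false_of_frame hF hi hj hk hij hik hjk h34
  have u5 : ∀ i j : Fin 9, (i : ℕ) < 3 → (j : ℕ) < 3 → i ≠ j → Col i 5 6 → ¬ Col j 5 6 :=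
    fun i j hi hj hij hc hc' =>
      hij (h.col_unique (by decide) (by omega) (by omega) (by omega) (by omega) hc hc')
  have u7 : ∀ i j : Fin 9, (i : ℕ) < 3 → (j : ℕ) < 3 → i ≠ j → Col i 7 8 → ¬ Col j 7 8 :=
    fun i j hi hj hij hc hc' =>
      hij (h.col_unique (by decide) (by omega) (by omega) (by omega) (by omega) hc hc')
  have s1 := step 0 1 2 (by decide) (by decide) (by decide) (by decide) (by decide) (by decide)
  have s2 := step 1 0 2 (by decide) (by decide) (by decide) (by decide) (by decide) (by decide)
  have s3 := step 2 0 1 (by decide) (by decide) (by decide) (by decide) (by decide) (by decide)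
  have f1 := fin 0 1 2 (by decide) (by decide) (by decide) (by decide) (by decide) (by decide)
  have f2 := fin 0 2 1 (by decide) (by decide) (by decide) (by decide) (by decide) (by decide)
  have f3 := fin 1 0 2 (by decide) (by decide) (by decide) (by decide) (by decide) (by decide)
  have f4 := fin 1 2 0 (by decide) (by decide) (by decide) (by decide) (by decide) (by decide)
  have f5 := fin 2 0 1 (by decide) (by decide) (by decide) (by decide) (by decide) (by decide)
  have f6 := fin 2 1 0 (by decide) (by decide) (by decide) (by decide) (by decide) (by decide)
  have := u5 0 1 (by decide) (by decide) (by decide)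
  have := u5 0 2 (by decide) (by decide) (by decide)
  have := u5 1 2 (by decide) (by decide) (by decide)
  have := u7 0 1 (by decide) (by decide) (by decide)
  have := u7 0 2 (by decide) (by decide) (by decide)
  have := u7 1 2 (by decide) (by decide) (by decide)
  clear step fin u5 u7 h34 hF h
  grind

/-- The planes through `7` and one of the lines `0, 3, 4` and `0, 5, 6` both need `8` as fifth
point, so `0, 7, 8` are collinear too. Hence `1` and `2` are collinear with no pair, and `{1, 4, 7}`
and `{2, 6, 8}` are triples. Then `0, 3, 5`, which are coplanar with `4` and `6`, are collinear, and
`4` is on the same line. -/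
theorem not_col_and_col_of_frame : ¬ (Col 0 3 4 ∧ Col 0 5 6) := by
  rintro ⟨h34, h56⟩
  obtain ⟨F, hF', hFm⟩ := hF 3 (by decide)
  obtain ⟨G, hG', hGm⟩ := hF 5 (by decide)
  obtain ⟨s, hs, h0s, h3s, h5s⟩ := h.exists_plane 0 3 5
  have h4s := h.mem_of_col h34 hs (by decide) h0s h3s
  have h6s := h.mem_of_col h56 hs (by decide) h0s h5s
  have hs' := h.eq_of_five_mem hs (a := 0) (b := 3) (c := 4) (d := 5) (e := 6) (by decide) h0s h3s
    h4s h5s h6s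
  have meet : ∀ x y z : Fin 9, Col 0 x y → x ≠ 0 → y ≠ 0 → x ≠ y → z ≠ 0 → z ≠ x → z ≠ y →
      ∀ s t, Pl s → Pl t → 0 ∈ s → x ∈ s → 0 ∈ t → x ∈ t → z ∈ s → z ∈ t → s = t := by
    intro x y z hc hx0 hy0 hxy hz0 hzx hzy s t hs ht h0s hxs h0t hxt hzs hzt
    by_contra hst
    exact h.not_four hx0.symm hy0 hxy.symm hz0 hzx hzy.symm hc
      (h.col_of_ne hs ht hst hx0.symm h0s hxs hzs h0t hxt hzt)
  have hFm0 := (hFm 0).2 (.inl (by decide))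
  have hFm3 := (hFm 3).2 (.inr (by decide))
  have hGm0 := (hGm 0).2 (.inl (by decide))
  have hGm5 := (hGm 5).2 (.inr (by decide))
  obtain ⟨t, ht, h0t, h3t, h7t⟩ := h.exists_plane 0 3 7
  have h4t := h.mem_of_col h34 ht (by decide) h0t h3t
  have h8t : 8 ∈ t := by
    obtain ⟨e, he, e1, e2, e3, e4⟩ := h.exists_fifth ht (a := 0) (b := 3) (c := 4) (d := 7)
      (by decide) h0t h3t h4t h7t
    have m1 := meet 3 4 e h34 (by decide) (by decide) (by decide) e1 e2 e3 t F ht hF' h0t h3t hFm0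
      hFm3 he
    have m2 := meet 3 4 e h34 (by decide) (by decide) (by decide) e1 e2 e3 t s ht hs h0t h3t h0s h3s
      he
    have : e ≠ 1 ∧ e ≠ 2 := by
      constructor
      all_goals
        rintro rfl
        have := m1 ((hFm _).2 (.inl (by decide)))
        subst this
        simp [hFm] at h7t
    have : e ≠ 5 ∧ e ≠ 6 := by
      constructor
      all_goals
        rintro rfl
        have := m2 (by assumption)
        subst this
        simp [hs'] at h7t
    have : e = 8 := by omega
    rwa [← this]
  obtain ⟨u, hu, h0u, h5u, h7u⟩ := h.exists_plane 0 5 7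
  have h6u := h.mem_of_col h56 hu (by decide) h0u h5u
  have h8u : 8 ∈ u := by
    obtain ⟨e, he, e1, e2, e3, e4⟩ := h.exists_fifth hu (a := 0) (b := 5) (c := 6) (d := 7)
      (by decide) h0u h5u h6u h7u
    have m1 := meet 5 6 e h56 (by decide) (by decide) (by decide) e1 e2 e3 u G hu hG' h0u h5u hGm0
      hGm5 he
    have m2 := meet 5 6 e h56 (by decide) (by decide) (by decide) e1 e2 e3 u s hu hs h0u h5u h0s h5s
      he
    have : e ≠ 1 ∧ e ≠ 2 := by
      constructor
      all_goals
        rintro rfl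
        have := m1 ((hGm _).2 (.inl (by decide)))
        subst this
        simp [hGm] at h7u
    have : e ≠ 3 ∧ e ≠ 4 := by
      constructor
      all_goals
        rintro rfl
        have := m2 (by assumption)
        subst this
        simp [hs'] at h7u
    have : e = 8 := by omega
    rwa [← this]
  have htu : t ≠ u := by
    rintro rfl
    exact h.not_nodup_of_forall_mem ht (l := [0, 3, 4, 5, 6, 7]) (by decide) (by simp [*])
      (by decide)
  have h78 := h.col_of_ne ht hu htu (by decide) h0t h7t h8t h0u h7u h8u
  have hno : ∀ i : Fin 9, (i : ℕ) < 3 → i ≠ 0 → ¬ Col i 3 4 ∧ ¬ Col i 5 6 ∧ ¬ Col i 7 8 := by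
    intro i hi hi0
    refine ⟨fun hc => hi0 ?_, fun hc => hi0 ?_, fun hc => hi0 ?_⟩
    · exact h.col_unique (by decide) (by omega) (by omega) (by decide) (by decide) hc h34
    · exact h.col_unique (by decide) (by omega) (by omega) (by decide) (by decide) hc h56
    · exact h.col_unique (by decide) (by omega) (by omega) (by decide) (by decide) hc h78
  have hex : ∀ i x y : Fin 9, (i : ℕ) < 3 → i ≠ 0 → 3 ≤ (x : ℕ) → 3 ≤ (y : ℕ) →
      ((x : ℕ) + 1) / 2 ≠ ((y : ℕ) + 1) / 2 → Pl {i, x, y} := by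
    intro i x y hi hi0 hx hy hxy
    rcases h.pl_triple_or_of_frame hF hi hx hy hxy with hU | ⟨U, -, -, -, -, hU⟩
    · exact hU
    · have := hno i hi hi0
      tauto
  exact h.not_four (i := 0) (j := 3) (k := 4) (l := 5) (by decide) (by decide) (by decide)
    (by decide) (by decide) (by decide) h34 (h.col_of_mem
      (hex 1 4 7 (by decide) (by decide) (by decide) (by decide) (by decide))
      (hex 2 6 8 (by decide) (by decide) (by decide) (by decide) (by decide)) hs (w := 4)
      (by decide) h0s h3s h5s h4s (by simp))

end Frame

end CubicPlaneSystem

end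

/-! ### The nine points form a `3 × 3` array -/

section

namespace CubicPlaneSystem

variable {Pl : Finset (Fin 9) → Prop} {Col : Fin 9 → Fin 9 → Fin 9 → Prop}

theorem exists_perm_of_nodup {l : List (Fin 9)} (hl : l.Nodup) (h9 : l.length = 9) :
    ∃ σ : Equiv.Perm (Fin 9), ∀ (n : ℕ) (hn : n < 9), σ ⟨n, hn⟩ = l[n] := by
  obtain ⟨σ, hσ, -⟩ := exists_perm_fin_nine Finset.univ l hl (by simp)
  exact ⟨σ, fun n hn => hσ n (by omega) hn⟩

namespace Frame

variable {i j k a a' b b' c c' : Fin 9}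

theorem exists_perm (hF : Frame Pl Col i j k a a' b b' c c') (h : CubicPlaneSystem Pl Col) :
    ∃ σ : Equiv.Perm (Fin 9), (σ 0 = i ∧ σ 1 = j ∧ σ 2 = k ∧ σ 3 = a ∧ σ 4 = a' ∧ σ 5 = b ∧
      σ 6 = b' ∧ σ 7 = c ∧ σ 8 = c') ∧
      CubicPlaneSystem (fun s => Pl (s.map σ.toEmbedding)) (fun i j k => Col (σ i) (σ j) (σ k)) ∧
      ∀ x : Fin 9, 3 ≤ (x : ℕ) → ∃ F : Finset (Fin 9), Pl (F.map σ.toEmbedding) ∧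
    ∀ i : Fin 9, i ∈ F ↔ (i : ℕ) < 3 ∨ ((i : ℕ) + 1) / 2 = ((x : ℕ) + 1) / 2 := by
  obtain ⟨σ, hσ⟩ := exists_perm_of_nodup hF.nodup rfl
  have e : σ 0 = i ∧ σ 1 = j ∧ σ 2 = k ∧ σ 3 = a ∧ σ 4 = a' ∧ σ 5 = b ∧
      σ 6 = b' ∧ σ 7 = c ∧ σ 8 = c' :=
    ⟨hσ 0 (by simp), hσ 1 (by simp), hσ 2 (by simp), hσ 3 (by simp), hσ 4 (by simp),
      hσ 5 (by simp), hσ 6 (by simp), hσ 7 (by simp), hσ 8 (by simp)⟩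
  refine ⟨σ, e, h.comap σ, ?_⟩
  obtain ⟨e0, e1, e2, e3, e4, e5, e6, e7, e8⟩ := e
  intro x hx
  have : x = 3 ∨ x = 4 ∨ x = 5 ∨ x = 6 ∨ x = 7 ∨ x = 8 := by omega
  rcases this with rfl | rfl | rfl | rfl | rfl | rfl
  · exact ⟨{0, 1, 2, 3, 4}, by simpa [*] using hF.pl₁, by decide⟩
  · exact ⟨{0, 1, 2, 3, 4}, by simpa [*] using hF.pl₁, by decide⟩
  · exact ⟨{0, 1, 2, 5, 6}, by simpa [*] using hF.pl₂, by decide⟩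
  · exact ⟨{0, 1, 2, 5, 6}, by simpa [*] using hF.pl₂, by decide⟩
  · exact ⟨{0, 1, 2, 7, 8}, by simpa [*] using hF.pl₃, by decide⟩
  · exact ⟨{0, 1, 2, 7, 8}, by simpa [*] using hF.pl₃, by decide⟩

theorem col_or_col_or_col (hF : Frame Pl Col i j k a a' b b' c c') (h : CubicPlaneSystem Pl Col) :
    Col i a a' ∨ Col j a a' ∨ Col k a a' := by
  obtain ⟨σ, ⟨e0, e1, e2, e3, e4, -⟩, h', hF'⟩ := hF.exists_perm h
  obtain ⟨m, hm, hc⟩ := h'.exists_col_of_frame hF'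
  rw [e3, e4] at hc
  have : m = 0 ∨ m = 1 ∨ m = 2 := by omega
  rcases this with rfl | rfl | rfl
  · rw [e0] at hc; exact .inl hc
  · rw [e1] at hc; exact .inr (.inl hc)
  · rw [e2] at hc; exact .inr (.inr hc)

theorem not_col_of_col (hF : Frame Pl Col i j k a a' b b' c c') (h : CubicPlaneSystem Pl Col)
    (ha : Col i a a') : ¬ Col i b b' := by
  intro hb
  obtain ⟨σ, ⟨e0, e1, e2, e3, e4, e5, e6, -⟩, h', hF'⟩ := hF.exists_perm h
  exact h'.not_col_and_col_of_frame hF' (by simp only [e0, e3, e4, e5, e6]; exact ⟨ha, hb⟩)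

theorem rotate (hF : Frame Pl Col i j k a a' b b' c c') (h : CubicPlaneSystem Pl Col) :
    Frame Pl Col j k i a a' b b' c c' where
  nodup := by
    refine (List.Perm.nodup_iff ?_).1 hF.nodup
    exact ((List.Perm.swap j i _).trans ((List.Perm.swap k i _).cons j))
  col := h.col_rotate hF.col (by
    have := hF.nodup
    simp only [List.nodup_cons, List.mem_cons, not_or] at this
    exact this.2.1.1)
  pl₁ := by
    rw [show ({j, k, i, a, a'} : Finset (Fin 9)) = {i, j, k, a, a'} by ext; simp; tauto]
    exact hF.pl₁
  pl₂ := by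
    rw [show ({j, k, i, b, b'} : Finset (Fin 9)) = {i, j, k, b, b'} by ext; simp; tauto]
    exact hF.pl₂
  pl₃ := by
    rw [show ({j, k, i, c, c'} : Finset (Fin 9)) = {i, j, k, c, c'} by ext; simp; tauto]
    exact hF.pl₃

theorem swap (hF : Frame Pl Col i j k a a' b b' c c') (h : CubicPlaneSystem Pl Col) :
    Frame Pl Col j i k a a' b b' c c' where
  nodup := (List.Perm.nodup_iff (List.Perm.swap j i _)).1 hF.nodup
  col := h.col_swap hF.col
  pl₁ := by rw [Finset.insert_comm]; exact hF.pl₁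
  pl₂ := by rw [Finset.insert_comm]; exact hF.pl₂
  pl₃ := by rw [Finset.insert_comm]; exact hF.pl₃

theorem swap_pairs (hF : Frame Pl Col i j k a a' b b' c c') :
    Frame Pl Col i j k b b' a a' c c' where
  nodup := by
    refine (List.Perm.nodup_iff ?_).1 hF.nodup
    refine ((List.Perm.cons _ (List.Perm.cons _ (List.Perm.cons _ ?_))))
    exact (List.perm_append_comm (l₁ := [a, a']) (l₂ := [b, b'])).append_right [c, c']
  col := hF.col
  pl₁ := hF.pl₂
  pl₂ := hF.pl₁
  pl₃ := hF.pl₃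

theorem rotate_pairs (hF : Frame Pl Col i j k a a' b b' c c') :
    Frame Pl Col i j k b b' c c' a a' where
  nodup := by
    refine (List.Perm.nodup_iff ?_).1 hF.nodup
    refine ((List.Perm.cons _ (List.Perm.cons _ (List.Perm.cons _ ?_))))
    exact List.perm_append_comm (l₁ := [a, a']) (l₂ := [b, b', c, c'])
  col := hF.col
  pl₁ := hF.pl₂
  pl₂ := hF.pl₃
  pl₃ := hF.pl₁

end Frame

/-- Every collinear triple belongs to a frame. -/
theorem exists_frame (h : CubicPlaneSystem Pl Col) {i j k : Fin 9} (hij : i ≠ j) (hik : i ≠ k)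
    (hjk : j ≠ k) (hcol : Col i j k) : ∃ a a' b b' c c', Frame Pl Col i j k a a' b b' c c' := by
  have key : ∀ a, a ≠ i → a ≠ j → a ≠ k → ∃ a', a' ≠ i ∧ a' ≠ j ∧ a' ≠ k ∧ a' ≠ a ∧
      Pl {i, j, k, a, a'} := by
    intro a hai haj hak
    obtain ⟨s, hs, his, hjs, has⟩ := h.exists_plane i j a
    have hks := h.mem_of_col hcol hs hij his hjs
    have hnd : [i, j, k, a].Nodup := by
      simp only [List.nodup_cons, List.mem_cons, List.not_mem_nil, not_or, or_false,
        not_false_eq_true, List.nodup_nil, and_true]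
      and_intros <;> first | assumption | (apply Ne.symm; assumption)
    obtain ⟨e, he, e1, e2, e3, e4⟩ := h.exists_fifth hs hnd his hjs hks has
    refine ⟨e, e1, e2, e3, e4, ?_⟩
    rwa [← h.eq_of_five_mem hs (a := i) (b := j) (c := k) (d := a) (e := e) (by
      simp only [List.nodup_cons, List.mem_cons, List.not_mem_nil, not_or, or_false,
        not_false_eq_true, List.nodup_nil, and_true]
      and_intros <;> first | assumption | (apply Ne.symm; assumption)) his hjs hks has he]
  have pick : ∀ s : Finset (Fin 9), s.card < 9 → ∃ a, a ∉ s := by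
    intro s hs
    by_contra! hcon
    rw [Finset.eq_univ_iff_forall.2 hcon, Finset.card_univ, Fintype.card_fin] at hs
    exact lt_irrefl _ hs
  have meet : ∀ a a' b b' x, a ≠ b → a ≠ b' → Pl {i, j, k, a, a'} → Pl {i, j, k, b, b'} →
      a ≠ i → a ≠ j → a ≠ k →
      x ≠ i → x ≠ j → x ≠ k → x = a ∨ x = a' → x ≠ b ∧ x ≠ b' := by
    intro a a' b b' x hab hab' ha hb ai aj ak xi xj xk hx
    by_contra hcon
    have hne : ({i, j, k, a, a'} : Finset (Fin 9)) ≠ {i, j, k, b, b'} := by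
      intro e
      have : a ∈ ({i, j, k, b, b'} : Finset (Fin 9)) := by rw [← e]; simp
      simp only [Finset.mem_insert, Finset.mem_singleton] at this
      rcases this with h | h | h | h | h
      exacts [ai h, aj h, ak h, hab h, hab' h]
    have hx' : x = b ∨ x = b' := by
      by_contra! hx'
      exact hcon hx'
    refine h.not_four hij hik.symm hjk.symm xi xj xk.symm hcol
      (h.col_of_ne ha hb hne hij (by simp) (by simp) ?_ (by simp) (by simp) ?_)
    · rcases hx with rfl | rfl <;> simp
    · rcases hx' with rfl | rfl <;> simp
  obtain ⟨a, ha⟩ := pick {i, j, k} (lt_of_le_of_lt Finset.card_le_three (by norm_num))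
  simp only [Finset.mem_insert, Finset.mem_singleton, not_or] at ha
  obtain ⟨a', a1, a2, a3, a4, hpa⟩ := key a ha.1 ha.2.1 ha.2.2
  obtain ⟨b, hb⟩ := pick {i, j, k, a, a'} (lt_of_le_of_lt Finset.card_le_five (by norm_num))
  simp only [Finset.mem_insert, Finset.mem_singleton, not_or] at hb
  obtain ⟨b', b1, b2, b3, b4, hpb⟩ := key b hb.1 hb.2.1 hb.2.2.1
  have mab := meet b b' a a' b' hb.2.2.2.1 hb.2.2.2.2 hpb hpa hb.1 hb.2.1 hb.2.2.1 b1 b2 b3 (.inr rfl)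
  obtain ⟨c, hc⟩ := pick {i, j, k, a, a', b, b'} (by
    refine lt_of_le_of_lt (Finset.card_insert_le _ _) ?_
    have := Finset.card_le_six (a := j) (b := k) (c := a) (d := a') (e := b) (f := b')
    omega)
  simp only [Finset.mem_insert, Finset.mem_singleton, not_or] at hc
  obtain ⟨c', c1, c2, c3, c4, hpc⟩ := key c hc.1 hc.2.1 hc.2.2.1
  have mca := meet c c' a a' c' hc.2.2.2.1 hc.2.2.2.2.1 hpc hpa hc.1 hc.2.1 hc.2.2.1 c1 c2 c3
    (.inr rfl)
  have mcb := meet c c' b b' c' hc.2.2.2.2.2.1 hc.2.2.2.2.2.2 hpc hpb hc.1 hc.2.1 hc.2.2.1 c1 c2 c3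
    (.inr rfl)
  refine ⟨a, a', b, b', c, c', ?_, hcol, hpa, hpb, hpc⟩
  clear key pick meet hpa hpb hpc hcol h
  obtain ⟨ha1, ha2, ha3⟩ := ha
  obtain ⟨hb1, hb2, hb3, hb4, hb5⟩ := hb
  obtain ⟨hc1, hc2, hc3, hc4, hc5, hc6, hc7⟩ := hc
  obtain ⟨m1, m2⟩ := mab
  obtain ⟨m3, m4⟩ := mca
  obtain ⟨m5, m6⟩ := mcb
  simp only [List.nodup_cons, List.mem_cons, List.not_mem_nil, not_or, or_false,
      not_false_eq_true, List.nodup_nil, and_true]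
  and_intros <;> first | assumption | (apply Ne.symm; assumption)

/-- The nine points are the points of a `3 × 3` array whose rows and columns are collinear. -/
def IsArray (Col : Fin 9 → Fin 9 → Fin 9 → Prop) : Prop :=
  ∃ p : Fin 3 → Fin 3 → Fin 9, (∀ i j i' j', p i j = p i' j' → i = i' ∧ j = j') ∧
    (∀ i, Col (p i 0) (p i 1) (p i 2)) ∧ ∀ j, Col (p 0 j) (p 1 j) (p 2 j)

theorem IsArray.of_nodup {i j k a b c a' b' c' : Fin 9} (hnd : [i, j, k, a, b, c, a', b', c'].Nodup)
    (h1 : Col i j k) (h2 : Col a b c) (h3 : Col a' b' c') (h4 : Col i a a') (h5 : Col j b b')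
    (h6 : Col k c c') : IsArray Col := by
  obtain ⟨σ, hσ⟩ := exists_perm_of_nodup hnd rfl
  have hinj : ∀ i j i' j' : Fin 3, (![![0, 1, 2], ![3, 4, 5], ![6, 7, 8]] i j : Fin 9) =
      ![![0, 1, 2], ![3, 4, 5], ![6, 7, 8]] i' j' → i = i' ∧ j = j' := by decide
  have e0 : σ 0 = i := hσ 0 (by simp)
  have e1 : σ 1 = j := hσ 1 (by simp)
  have e2 : σ 2 = k := hσ 2 (by simp)
  have e3 : σ 3 = a := hσ 3 (by simp)
  have e4 : σ 4 = b := hσ 4 (by simp)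
  have e5 : σ 5 = c := hσ 5 (by simp)
  have e6 : σ 6 = a' := hσ 6 (by simp)
  have e7 : σ 7 = b' := hσ 7 (by simp)
  have e8 : σ 8 = c' := hσ 8 (by simp)
  refine ⟨fun m n => σ (![![0, 1, 2], ![3, 4, 5], ![6, 7, 8]] m n), ?_, ?_, ?_⟩
  · exact fun i j i' j' hij => hinj i j i' j' (σ.injective hij)
  · rw [Fin.forall_fin_succ, Fin.forall_fin_succ, Fin.forall_fin_one]
    exact ⟨by simpa [e0, e1, e2], by simpa [e3, e4, e5], by simpa [e6, e7, e8]⟩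
  · rw [Fin.forall_fin_succ, Fin.forall_fin_succ, Fin.forall_fin_one]
    exact ⟨by simpa [e0, e3, e6], by simpa [e1, e4, e7], by simpa [e2, e5, e8]⟩

/-- The line of `0, 3, 4` has a frame of its own. Its pairs are `1, 2`, then `5` and `6` each with
one of `7, 8`. As `0` is the point collinear with `1, 2`, the points `3` and `4` are collinear with
one of the other pairs each; these are the missing rows. -/
theorem isArray_of_col (h : CubicPlaneSystem Pl Col) (h012 : Col 0 1 2) (h034 : Col 0 3 4)
    (h156 : Col 1 5 6) (h278 : Col 2 7 8) (hF : Pl {0, 1, 2, 3, 4}) : IsArray Col := by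
  have key : ∀ x y : Fin 9, x = 5 ∧ y = 6 ∨ x = 6 ∧ y = 5 → ∃ s, Pl s ∧ 0 ∈ s ∧ 3 ∈ s ∧ 4 ∈ s ∧
      x ∈ s ∧ ∃ e ∈ s, e = 7 ∨ e = 8 := by
    intro x y hxy
    obtain ⟨s, hs, h0s, h3s, hxs⟩ := h.exists_plane 0 3 x
    have h4s := h.mem_of_col h034 hs (by decide) h0s h3s
    obtain ⟨e, he, e0, e3, e4, ex⟩ := h.exists_fifth hs (a := 0) (b := 3) (c := 4) (d := x)
      (by rcases hxy with ⟨rfl, -⟩ | ⟨rfl, -⟩ <;> decide) h0s h3s h4s hxs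
    have h12 : ∀ e ∈ s, e ≠ 1 ∧ e ≠ 2 := by
      intro e he
      by_contra hcon
      have hsF : s ≠ {0, 1, 2, 3, 4} := by
        rintro rfl
        rcases hxy with ⟨rfl, -⟩ | ⟨rfl, -⟩ <;> simp at hxs
      have he0 : e ≠ 0 ∧ e ≠ 3 ∧ e ≠ 4 := by
        refine ⟨?_, ?_, ?_⟩ <;> (rintro rfl; simp at hcon)
      refine h.not_four (i := 0) (j := 3) (k := 4) (l := e) (by decide) (by decide) (by decide)
        he0.1 he0.2.1 he0.2.2.symm h034 (h.col_of_ne hs hF hsF (by decide) h0s h3s he (by simp)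
        (by simp) ?_)
      simp
      tauto
    refine ⟨s, hs, h0s, h3s, h4s, hxs, e, he, ?_⟩
    have := h12 e he
    have hey : e ≠ y := by
      rintro rfl
      have h561 := h.col_rotate h156 (by decide)
      have h651 := h.col_swap h561
      refine (h12 1 ?_).1 rfl
      rcases hxy with ⟨rfl, rfl⟩ | ⟨rfl, rfl⟩
      · exact h.mem_of_col h561 hs (by decide) hxs he
      · exact h.mem_of_col h651 hs (by decide) hxs he
    omega
  obtain ⟨s, hs, h0s, h3s, h4s, h5s, e, hes, he⟩ := key 5 6 (by simp)
  obtain ⟨t, ht, h0t, h3t, h4t, h6t, e', het, he'⟩ := key 6 5 (by simp)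
  have hs' := h.eq_of_five_mem hs (a := 0) (b := 3) (c := 4) (d := 5) (e := e)
    (by rcases he with rfl | rfl <;> decide) h0s h3s h4s h5s hes
  have ht' := h.eq_of_five_mem ht (a := 0) (b := 3) (c := 4) (d := 6) (e := e')
    (by rcases he' with rfl | rfl <;> decide) h0t h3t h4t h6t het
  have hee : e ≠ e' := by
    rintro rfl
    have hst : s ≠ t := by
      rintro rfl
      rw [hs'] at h6t
      rcases he with rfl | rfl <;> simp at h6t
    exact h.not_four (i := 0) (j := 3) (k := 4) (l := e) (by decide) (by decide) (by decide)
      (by omega) (by omega) (by omega) h034 (h.col_of_ne hs ht hst (by decide) h0s h3s hes h0t h3t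
      het)
  have h2ee : Col 2 e e' := by
    rcases he with rfl | rfl <;> rcases he' with rfl | rfl
    · exact absurd rfl hee
    · exact h278
    · exact h.col_swap (h.col_rotate (h.col_rotate h278 (by decide)) (by decide))
    · exact absurd rfl hee
  have fr : Frame Pl Col 0 3 4 1 2 5 e 6 e' :=
    { nodup := by
        rcases he with rfl | rfl <;> rcases he' with rfl | rfl <;> first | exact absurd rfl hee | decide
      col := h034
      pl₁ := by
        rw [show ({0, 3, 4, 1, 2} : Finset (Fin 9)) = {0, 1, 2, 3, 4} by decide]
        exact hF
      pl₂ := by rwa [hs'] at hs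
      pl₃ := by rwa [ht'] at ht }
  have q1 := fr.rotate_pairs.col_or_col_or_col h
  have q2 := fr.rotate_pairs.rotate_pairs.col_or_col_or_col h
  have n1 := fr.not_col_of_col h h012
  have n2 := fr.rotate_pairs.rotate_pairs.swap_pairs.not_col_of_col h h012
  have n3 := (fr.rotate_pairs.rotate h).not_col_of_col h
  have n4 := ((fr.rotate_pairs.rotate h).rotate h).not_col_of_col h
  have : (Col 3 5 e ∧ Col 4 6 e') ∨ (Col 4 5 e ∧ Col 3 6 e') := by tauto
  rcases this with ⟨r1, r2⟩ | ⟨r1, r2⟩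
  · refine IsArray.of_nodup (i := 0) (j := 1) (k := 2) ?_ h012 r1 r2 h034 h156 h2ee
    rcases he with rfl | rfl <;> rcases he' with rfl | rfl <;> first | exact absurd rfl hee | decide
  · refine IsArray.of_nodup (i := 0) (j := 1) (k := 2) ?_ h012 r1 r2
      (h.col_swap (h.col_rotate (h.col_rotate h034 (by decide)) (by decide))) h156 h2ee
    rcases he with rfl | rfl <;> rcases he' with rfl | rfl <;> first | exact absurd rfl hee | decide

theorem isArray_of_frame (h : CubicPlaneSystem Pl Col) {i j k a a' b b' c c' : Fin 9}
    (hF : Frame Pl Col i j k a a' b b' c c') (ha : Col i a a') (hb : Col j b b')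
    (hc : Col k c c') : IsArray Col := by
  obtain ⟨σ, ⟨e0, e1, e2, e3, e4, e5, e6, e7, e8⟩, h', -⟩ := hF.exists_perm h
  obtain ⟨p, hp, h1, h2⟩ := h'.isArray_of_col (by rw [e0, e1, e2]; exact hF.col)
    (by rwa [e0, e3, e4]) (by rwa [e1, e5, e6]) (by rwa [e2, e7, e8])
    (by simpa [*] using hF.pl₁)
  exact ⟨fun m n => σ (p m n), fun m n m' n' hmn => hp m n m' n' (σ.injective hmn), h1, h2⟩

/-- In a frame each pair is collinear with a point of the line and different pairs with different
points. A permutation of the line brings this matching into the order that `isArray_of_frame`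
expects. -/
theorem isArray (h : CubicPlaneSystem Pl Col) : IsArray Col := by
  obtain ⟨i, j, k, hij, hik, hjk, hcol⟩ := h.exists_col
  obtain ⟨a, a', b, b', c, c', hF⟩ := h.exists_frame hij hik hjk hcol
  have key : ∀ i j k, Frame Pl Col i j k a a' b b' c c' → Col i a a' → IsArray Col := by
    intro i j k hF ha
    have hb := hF.swap_pairs.col_or_col_or_col h
    have hc := hF.rotate_pairs.rotate_pairs.col_or_col_or_col h
    have nb := hF.not_col_of_col h ha
    have nc := hF.rotate_pairs.rotate_pairs.swap_pairs.not_col_of_col h ha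
    have hb' : Col j b b' ∨ Col k b b' := by tauto
    have hc' : Col j c c' ∨ Col k c c' := by tauto
    rcases hb' with hb | hb
    · have := (hF.rotate h).rotate_pairs.not_col_of_col h hb
      exact h.isArray_of_frame hF ha hb (by tauto)
    · have := ((hF.rotate h).rotate h).rotate_pairs.not_col_of_col h hb
      exact h.isArray_of_frame (((hF.rotate h).rotate h).swap h) ha hb (by tauto)
  rcases hF.col_or_col_or_col h with ha | ha | ha
  · exact key _ _ _ hF ha
  · exact key _ _ _ (hF.rotate h) ha
  · exact key _ _ _ ((hF.rotate h).rotate h) ha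

end CubicPlaneSystem

end

/-! ### The axioms of a plane system hold for the nine points -/

section

namespace FailsOnCubicCones

variable {K V : Type*} [Field K] [AddCommGroup V] [Module K V]

theorem comp_equiv {ι κ : Type*} [Fintype ι] [Fintype κ] {v : ι → V}
    (hv : FailsOnCubicCones (K := K) v) (e : κ ≃ ι) : FailsOnCubicCones (K := K) (v ∘ e) where
  exists_relation P hP := by
    obtain ⟨c, hc0, hc⟩ := hv.exists_relation P hP
    refine ⟨c ∘ e, fun h => hc0 ?_, fun l₁ l₂ l₃ h₁ h₂ h₃ => ?_⟩
    · funext i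
      simpa using congrFun h (e.symm i)
    · rw [← hc l₁ l₂ l₃ h₁ h₂ h₃]
      exact e.sum_comp fun i => c i * (l₁ (v i) * l₂ (v i) * l₃ (v i))
  notMem_span_singleton i j hij := hv.notMem_span_singleton _ _ (e.injective.ne hij)
  not_four_collinear i j k l h1 h2 h3 h4 h5 h6 := hv.not_four_collinear _ _ _ _ (e.injective.ne h1)
    (e.injective.ne h2) (e.injective.ne h3) (e.injective.ne h4) (e.injective.ne h5)
    (e.injective.ne h6)

theorem card_zeroSet_comp_equiv {ι κ : Type*} [Fintype ι] [Fintype κ] (v : ι → V) (e : κ ≃ ι)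
    (f : Module.Dual K V) : (zeroSet (v ∘ e) f).card = (zeroSet v f).card := by
  rw [← Finset.card_map e.toEmbedding]
  congr 1
  ext i
  simp [mem_zeroSet]

variable [Infinite K] [FiniteDimensional K V] {v : Fin 9 → V}

theorem exists_eq_smul_add_smul_of_nodup (hV : Module.finrank K V = 4)
    (hv : FailsOnCubicCones (K := K) v) {a b c d e k x y z : Fin 9}
    (hnd : [a, b, c, d, e, k, x, y, z].Nodup) {f g h : Module.Dual K V}
    (hf : zeroSet v f = {a, b, c}) (hg : zeroSet v g = {d, e, k})
    (hhx : h (v x) = 0) (hhy : h (v y) = 0) (hhz : h (v z) = 0)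
    (hxyz : v z ∉ Submodule.span K {v x, v y}) : ∃ s t : K, h = s • f + t • g := by
  have hf' : ∀ i, f (v i) = 0 ↔ i = a ∨ i = b ∨ i = c := fun i => by
    rw [← mem_zeroSet, hf]
    simp
  have hg' : ∀ i, g (v i) = 0 ↔ i = d ∨ i = e ∨ i = k := fun i => by
    rw [← mem_zeroSet, hg]
    simp
  have hcov : ∀ i, i = a ∨ i = b ∨ i = c ∨ i = d ∨ i = e ∨ i = k ∨ i = x ∨ i = y ∨ i = z := by
    intro i
    have h1 := List.toFinset_card_of_nodup hnd
    have : [a, b, c, d, e, k, x, y, z].toFinset = Finset.univ := by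
      rw [← Finset.card_eq_iff_eq_univ, h1]
      rfl
    have := this.ge (Finset.mem_univ i)
    simpa only [List.mem_toFinset, List.mem_cons, List.not_mem_nil, or_false] using this
  simp only [List.nodup_cons, List.mem_cons, List.not_mem_nil, not_or, or_false,
      not_false_eq_true, List.nodup_nil, and_true] at hnd
  obtain ⟨⟨hab, hac, had, hae, hak, hax, hay, haz⟩, ⟨hbc, hbd, hbe, hbk, hbx, hby, hbz⟩,
    ⟨hcd, hce, hck, hcx, hcy, hcz⟩, ⟨hde, hdk, hdx, hdy, hdz⟩, ⟨hek, hex, hey, hez⟩,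
    ⟨hkx, hky, hkz⟩, ⟨hxy, hxz⟩, hyz⟩ := hnd
  refine hv.exists_eq_smul_add_smul hV hcov hab hac hbc hde hdk hek hxy hxz hyz hf' hg' ?_ ?_ ?_ ?_
    hhx hhy hhz hxyz
  · intro i hi hi'
    rw [hf'] at hi
    rw [hg'] at hi'
    rcases hi with rfl | rfl | rfl <;> rcases hi' with h | h | h <;> exact absurd h (by assumption)
  · simp only [ne_eq, hf', hg', not_or]
    exact ⟨⟨Ne.symm hax, Ne.symm hbx, Ne.symm hcx⟩, Ne.symm hdx, Ne.symm hex, Ne.symm hkx⟩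
  · simp only [ne_eq, hf', hg', not_or]
    exact ⟨⟨Ne.symm hay, Ne.symm hby, Ne.symm hcy⟩, Ne.symm hdy, Ne.symm hey, Ne.symm hky⟩
  · simp only [ne_eq, hf', hg', not_or]
    exact ⟨⟨Ne.symm haz, Ne.symm hbz, Ne.symm hcz⟩, Ne.symm hdz, Ne.symm hez, Ne.symm hkz⟩

omit [Infinite K] in
theorem exists_dual_triple (hV : Module.finrank K V = 4) (v : Fin 9 → V) (i j k : Fin 9) :
    ∃ f : Module.Dual K V, f ≠ 0 ∧ f (v i) = 0 ∧ f (v j) = 0 ∧ f (v k) = 0 := by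
  obtain ⟨f, hf0, hf⟩ := exists_dual_ne_zero_of_finrank_lt (K := K)
    (U := Submodule.span K {v i, v j, v k})
    (by have := finrank_span_triple_le (K := K) (v i) (v j) (v k); omega)
  exact ⟨f, hf0, hf _ (Submodule.subset_span (by simp)), hf _ (Submodule.subset_span (by simp)),
    hf _ (Submodule.subset_span (by simp))⟩

-- Proportional forms have equal zero sets, so these are two different planes and they meet in a
-- line.
omit [Infinite K] in
theorem mem_span_of_zeroSet_ne (hV : Module.finrank K V = 4)
    (hv : FailsOnCubicCones (K := K) v) {f g : Module.Dual K V} (hf : f ≠ 0) (hg : g ≠ 0)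
    (hfg : zeroSet v f ≠ zeroSet v g) {i j k : Fin 9} (hij : i ≠ j) (hfi : f (v i) = 0)
    (hfj : f (v j) = 0) (hfk : f (v k) = 0) (hgi : g (v i) = 0) (hgj : g (v j) = 0)
    (hgk : g (v k) = 0) : v k ∈ Submodule.span K {v i, v j} := by
  refine mem_span_pair_of_dual_eq_zero hV ?_ hf (hv.ne_zero i) (hv.notMem_span_singleton i j hij)
    hfi hfj hfk hgi hgj hgk
  by_contra! hcon
  obtain ⟨s, t, rfl⟩ := exists_eq_smul_add_smul_of_ker_le (f := f) (g := 0) (h := g)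
    (fun z hz => hcon z hz.1)
  rw [smul_zero, add_zero] at hg hfg
  have hs : s ≠ 0 := by
    rintro rfl
    simp at hg
  apply hfg
  ext m
  simp [mem_zeroSet, hs]

/-- `h` is in the pencil of `f` and `g`. At a common point of `h` and `f` the form `g` is nonzero,
so `h` would be a multiple of `f`, which does not vanish at `x`. -/
theorem notMem_zeroSet (hV : Module.finrank K V = 4) (hv : FailsOnCubicCones (K := K) v)
    {f g h : Module.Dual K V} (hh : h ≠ 0) {x y z : Fin 9}
    (hf3 : (zeroSet v f).card = 3) (hg3 : (zeroSet v g).card = 3)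
    (hfg : Disjoint (zeroSet v f) (zeroSet v g)) (hx : x ∉ zeroSet v f) (hy : y ∉ zeroSet v f)
    (hz : z ∉ zeroSet v f) (hx' : x ∉ zeroSet v g) (hy' : y ∉ zeroSet v g) (hz' : z ∉ zeroSet v g)
    (hxy : x ≠ y) (hhx : x ∈ zeroSet v h) (hhy : y ∈ zeroSet v h) (hhz : z ∈ zeroSet v h)
    (hxyz : v z ∉ Submodule.span K {v x, v y}) : ∀ w ∈ zeroSet v h, w ∉ zeroSet v f := by
  have hxz : x ≠ z := by
    rintro rfl
    exact hxyz (Submodule.subset_span (by simp))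
  have hyz : y ≠ z := by
    rintro rfl
    exact hxyz (Submodule.subset_span (by simp))
  obtain ⟨a, b, c, hab, hac, hbc, hfe⟩ := Finset.card_eq_three.1 hf3
  obtain ⟨d, e, k, hde, hdk, hek, hge⟩ := Finset.card_eq_three.1 hg3
  have hdis := hfg
  rw [hfe] at hx hy hz
  rw [hge] at hx' hy' hz'
  rw [hfe, hge, Finset.disjoint_left] at hdis
  simp only [Finset.mem_insert, Finset.mem_singleton, not_or] at hx hy hz hx' hy' hz' hdis
  have hda := hdis (.inl rfl)
  have hdb := hdis (.inr (.inl rfl))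
  have hdc := hdis (.inr (.inr rfl))
  obtain ⟨s, t, hst⟩ := hv.exists_eq_smul_add_smul_of_nodup hV (a := a) (b := b) (c := c) (d := d)
    (e := e) (k := k) (x := x) (y := y) (z := z) (h := h) (by
      clear hdis hfe hge hfg hf3 hg3 hhx hhy hhz
      obtain ⟨x1, x2, x3⟩ := hx
      obtain ⟨y1, y2, y3⟩ := hy
      obtain ⟨z1, z2, z3⟩ := hz
      obtain ⟨x4, x5, x6⟩ := hx'
      obtain ⟨y4, y5, y6⟩ := hy'
      obtain ⟨z4, z5, z6⟩ := hz'
      obtain ⟨a4, a5, a6⟩ := hda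
      obtain ⟨b4, b5, b6⟩ := hdb
      obtain ⟨c4, c5, c6⟩ := hdc
      simp only [List.nodup_cons, List.mem_cons, List.not_mem_nil, not_or, or_false,
        not_false_eq_true, List.nodup_nil, and_true]
      and_intros <;> first | assumption | (apply Ne.symm; assumption)) hfe hge (mem_zeroSet.1 hhx)
    (mem_zeroSet.1 hhy) (mem_zeroSet.1 hhz) hxyz
  intro w hwh hwf
  have hwg : g (v w) ≠ 0 := fun h => Finset.disjoint_left.1 hfg hwf (mem_zeroSet.2 h)
  rw [mem_zeroSet] at hwh hwf
  rw [hst] at hwh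
  have ht : t = 0 := by simpa [hwf, hwg] using hwh
  subst ht
  rw [zero_smul, add_zero] at hst
  have hfx : f (v x) ≠ 0 := by
    intro h
    rw [← mem_zeroSet, hfe] at h
    simp at h
    tauto
  rw [mem_zeroSet, hst] at hhx
  have hs : s = 0 := by simpa [hfx] using hhx
  rw [hs, zero_smul] at hst
  exact hh hst

/-- Otherwise the plane of `6, 7, 8` is in the pencil of `{0, 1, 2}` and `{3, 4, 5}` and in that of
`{0, 1, 3}` and `{2, 4, 5}`. Comparing both expressions gives a form that vanishes at `0, 1` and at
`4, 5`, so it is zero. Its values at `2` and `3` make the coefficients zero. -/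
theorem exists_three_lt_card_zeroSet (hV : Module.finrank K V = 4)
    (hv : FailsOnCubicCones (K := K) v) : ∃ f : Module.Dual K V, f ≠ 0 ∧ 3 < (zeroSet v f).card := by
  by_contra! hcon
  have h4 : ∀ f : Module.Dual K V, f ≠ 0 → ∀ i j k l : Fin 9, [i, j, k, l].Nodup → f (v i) = 0 →
      f (v j) = 0 → f (v k) = 0 → f (v l) ≠ 0 := by
    intro f hf i j k l hnd hi hj hk hl
    have h1 := List.toFinset_card_of_nodup hnd
    have h2 := Finset.card_le_card (s := [i, j, k, l].toFinset) (t := zeroSet v f) (by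
      intro x hx
      simp only [List.mem_toFinset, List.mem_cons, List.not_mem_nil, or_false] at hx
      rw [mem_zeroSet]
      rcases hx with rfl | rfl | rfl | rfl <;> assumption)
    have := hcon f hf
    simp only [List.length_cons, List.length_nil] at h1
    omega
  have hex : ∀ i j k : Fin 9, i ≠ j → i ≠ k → j ≠ k → ∃ f : Module.Dual K V, f ≠ 0 ∧
      zeroSet v f = {i, j, k} := by
    intro i j k hij hik hjk
    obtain ⟨f, hf, hi, hj, hk⟩ := exists_dual_triple (K := K) hV v i j k
    refine ⟨f, hf, (Finset.eq_of_subset_of_card_le ?_ ?_).symm⟩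
    · intro x hx
      simp only [Finset.mem_insert, Finset.mem_singleton] at hx
      rw [mem_zeroSet]
      rcases hx with rfl | rfl | rfl <;> assumption
    · rw [Finset.card_eq_three.2 ⟨i, j, k, hij, hik, hjk, rfl⟩]
      exact hcon f hf
  have hncol : v 8 ∉ Submodule.span K {v 6, v 7} := by
    intro hc
    obtain ⟨f, hf, h6, h7, h0⟩ := exists_dual_triple (K := K) hV v 6 7 0
    refine h4 f hf 6 7 0 8 (by decide) h6 h7 h0 ?_
    have : Submodule.span K {v 6, v 7} ≤ LinearMap.ker f := by
      rw [Submodule.span_le]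
      rintro _ (rfl | rfl) <;> assumption
    exact this hc
  have zero : ∀ {f : Module.Dual K V} {i j k : Fin 9}, zeroSet v f = {i, j, k} →
      ∀ m, f (v m) = 0 ↔ m = i ∨ m = j ∨ m = k := by
    intro f i j k hf m
    rw [← mem_zeroSet, hf]
    simp
  obtain ⟨h, hh, h678⟩ := hex 6 7 8 (by decide) (by decide) (by decide)
  obtain ⟨f₁, -, hf₁⟩ := hex 0 1 2 (by decide) (by decide) (by decide)
  obtain ⟨g₁, -, hg₁⟩ := hex 3 4 5 (by decide) (by decide) (by decide)
  obtain ⟨f₂, -, hf₂⟩ := hex 0 1 3 (by decide) (by decide) (by decide)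
  obtain ⟨g₂, -, hg₂⟩ := hex 2 4 5 (by decide) (by decide) (by decide)
  have z := zero h678
  have z1 := zero hf₁
  have z2 := zero hg₁
  have z3 := zero hf₂
  have z4 := zero hg₂
  obtain ⟨s, t, e1⟩ := hv.exists_eq_smul_add_smul_of_nodup hV (by decide) hf₁ hg₁
    ((z 6).2 (by decide)) ((z 7).2 (by decide)) ((z 8).2 (by decide)) hncol
  obtain ⟨s', t', e2⟩ := hv.exists_eq_smul_add_smul_of_nodup hV (by decide) hf₂ hg₂
    ((z 6).2 (by decide)) ((z 7).2 (by decide)) ((z 8).2 (by decide)) hncol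
  have e : s • f₁ - s' • f₂ = t' • g₂ - t • g₁ := by
    rw [sub_eq_sub_iff_add_eq_add, ← e1, e2]
    abel
  have hk : s • f₁ - s' • f₂ = 0 := by
    by_contra hne
    refine h4 _ hne 0 1 4 5 (by decide) ?_ ?_ ?_ ?_
    · simp [(z1 0).2, (z3 0).2]
    · simp [(z1 1).2, (z3 1).2]
    · simp [e, (z2 4).2, (z4 4).2]
    · simp [e, (z2 5).2, (z4 5).2]
  have hs' : s' = 0 := by
    have := LinearMap.congr_fun hk (v 2)
    simpa [(z1 2).2, z3 2] using this
  have hs : s = 0 := by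
    have := LinearMap.congr_fun hk (v 3)
    simpa [(z3 3).2, z1 3] using this
  have ht : t = 0 := by
    have := LinearMap.congr_fun (e.symm.trans hk) (v 2)
    simpa [(z4 2).2, z2 2] using this
  apply hh
  rw [e1, hs, ht]
  simp

/-- The planes through `a m` and `b m` are `p m - x m n • α`, where the parameter `x m n` belongs to
`c n` and `x m 0 = 0`. For each bijection of the three lines with the points `c n`, the three planes
are in a pencil. The coefficients of this dependence can be read off at `a 0` and `a 1`, so they are
the same for all bijections. The linear equations for the parameters then imply that three times a
nonzero number is zero; here characteristic three must be excluded. -/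
theorem not_transversal (hV : Module.finrank K V = 4) (h3 : (3 : K) ≠ 0)
    (hv : FailsOnCubicCones (K := K) v) {a b c : Fin 3 → Fin 9} {α : Module.Dual K V}
    (hs : ∀ i, i ∈ zeroSet v α ↔ (∃ m, i = a m) ∨ ∃ m, i = b m)
    (ha : a.Injective) (hb : b.Injective) (hc : c.Injective) (hab : ∀ m n, a m ≠ b n)
    (hac : ∀ m n, a m ≠ c n) (hbc : ∀ m n, b m ≠ c n)
    (hP : ∀ m n, ∃ f : Module.Dual K V, f ≠ 0 ∧ zeroSet v f = {a m, b m, c n}) : False := by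
  have hαa : ∀ m, α (v (a m)) = 0 := fun m => mem_zeroSet.1 ((hs _).2 (.inl ⟨m, rfl⟩))
  have hαb : ∀ m, α (v (b m)) = 0 := fun m => mem_zeroSet.1 ((hs _).2 (.inr ⟨m, rfl⟩))
  have hαc : ∀ m, α (v (c m)) ≠ 0 := fun m h => by
    rcases (hs _).1 (mem_zeroSet.2 h) with ⟨n, hn⟩ | ⟨n, hn⟩
    · exact hac n m hn.symm
    · exact hbc n m hn.symm
  have hncol : ∀ m n, v (c n) ∉ Submodule.span K {v (a m), v (b m)} := by
    intro m n h
    have : Submodule.span K {v (a m), v (b m)} ≤ LinearMap.ker α := by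
      rw [Submodule.span_le]
      rintro _ (rfl | rfl)
      exacts [hαa m, hαb m]
    exact hαc n (this h)
  choose p hp0 hp using fun m => hP m 0
  have hpz : ∀ m i, p m (v i) = 0 ↔ i = a m ∨ i = b m ∨ i = c 0 := fun m i => by
    rw [← mem_zeroSet, hp]
    simp
  have hpa : ∀ m, p m (v (a m)) = 0 := fun m => (hpz _ _).2 (by simp)
  have hpb : ∀ m, p m (v (b m)) = 0 := fun m => (hpz _ _).2 (by simp)
  have hpc : ∀ m, p m (v (c 0)) = 0 := fun m => (hpz _ _).2 (by simp)
  have hpa' : ∀ m n, n ≠ m → p m (v (a n)) ≠ 0 := fun m n hmn h => by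
    rcases (hpz _ _).1 h with h | h | h
    · exact hmn (ha h)
    · exact hab _ _ h
    · exact hac _ _ h
  let x : Fin 3 → Fin 3 → K := fun m n => p m (v (c n)) / α (v (c n))
  have hx : ∀ m n, p m (v (c n)) = x m n * α (v (c n)) := fun m n =>
    (div_mul_cancel₀ _ (hαc n)).symm
  have hx0 : ∀ m, x m 0 = 0 := fun m => by simp [x, hpc]
  have hF : ∀ m n, zeroSet v (p m - x m n • α) = {a m, b m, c n} := by
    intro m n
    obtain ⟨f, hf0, hf⟩ := hP m n
    have hfz : ∀ i, f (v i) = 0 ↔ i = a m ∨ i = b m ∨ i = c n := fun i => by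
      rw [← mem_zeroSet, hf]
      simp
    by_contra hne
    refine hncol m n (hv.mem_span_of_zeroSet_ne hV (f := p m - x m n • α) (g := f) ?_ hf0
      (by rwa [hf]) (hab m m) ?_ ?_ ?_ ((hfz _).2 (by simp)) ((hfz _).2 (by simp))
      ((hfz _).2 (by simp)))
    · intro h
      have h1 := LinearMap.congr_fun h (v (c 0))
      have h2 : x m n = 0 := by simpa [hpc, hαc] using h1
      rw [h2, zero_smul, sub_zero] at h
      exact hp0 m h
    · simp [hpa, hαa]
    · simp [hpb, hαb]
    · simp [hx]
  -- Evaluation at `a 1` and `a 0` determines `s` and `t` as quotients of values of the `p m`;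
  -- evaluation at `c n` is the equation itself, with these denominators cleared.
  have key : ∀ i j k n : Fin 3, i ≠ j → i ≠ k → j ≠ k →
      p 0 (v (a 1)) * p 1 (v (a 0)) * (x 2 n - x 2 k) =
        p 2 (v (a 1)) * p 1 (v (a 0)) * (x 0 n - x 0 i) +
        p 2 (v (a 0)) * p 0 (v (a 1)) * (x 1 n - x 1 j) := by
    intro i j k n hij hik hjk
    have hnd : [a 0, b 0, c i, a 1, b 1, c j, a 2, b 2, c k].Nodup := by
      simp only [List.nodup_cons, List.mem_cons, List.not_mem_nil, not_or, or_false,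
        not_false_eq_true, List.nodup_nil, and_true]
      and_intros <;> first
        | exact ha.ne (by decide)
        | exact hb.ne (by decide)
        | exact hc.ne (by assumption)
        | exact hab _ _
        | exact (hab _ _).symm
        | exact hac _ _
        | exact (hac _ _).symm
        | exact hbc _ _
        | exact (hbc _ _).symm
    have hz : ∀ i' ∈ ({a 2, b 2, c k} : Finset (Fin 9)), (p 2 - x 2 k • α) (v i') = 0 := by
      intro i' hi'
      rwa [← hF, mem_zeroSet] at hi'
    obtain ⟨s, t, hst⟩ := hv.exists_eq_smul_add_smul_of_nodup hV hnd (hF 0 i) (hF 1 j)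
      (hz _ (by simp)) (hz _ (by simp)) (hz _ (by simp)) (hncol 2 k)
    have h1 := LinearMap.congr_fun hst (v (a 0))
    have h2 := LinearMap.congr_fun hst (v (a 1))
    have h3 := LinearMap.congr_fun hst (v (c n))
    simp only [LinearMap.sub_apply, LinearMap.add_apply, LinearMap.smul_apply, hαa, hpa, smul_eq_mul,
      mul_zero, sub_zero, zero_add, add_zero, hx] at h1 h2 h3
    rw [h1, h2]
    have h4 : x 2 n - x 2 k = s * (x 0 n - x 0 i) + t * (x 1 n - x 1 j) := by
      refine mul_right_cancel₀ (hαc n) ?_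
      linear_combination h3
    rw [h4]
    ring
  have hx1 : x 0 1 ≠ 0 := by
    intro h
    have h1 := hx 0 1
    rw [h, zero_mul] at h1
    rcases (hpz _ _).1 h1 with h | h | h
    · exact hac _ _ h.symm
    · exact hbc _ _ h.symm
    · exact absurd (hc h) (by decide)
  have k1 := key 0 1 2 0 (by decide) (by decide) (by decide)
  have k2 := key 1 0 2 0 (by decide) (by decide) (by decide)
  have k3 := key 0 2 1 0 (by decide) (by decide) (by decide)
  have k4 := key 2 0 1 0 (by decide) (by decide) (by decide)
  have k5 := key 1 2 0 0 (by decide) (by decide) (by decide)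
  have k6 := key 2 1 0 0 (by decide) (by decide) (by decide)
  have k7 := key 0 1 2 1 (by decide) (by decide) (by decide)
  simp only [hx0, zero_sub, sub_zero] at k1 k2 k3 k4 k5 k6 k7
  have hne : 3 * (p 2 (v (a 1)) * p 1 (v (a 0)) * x 0 1) ≠ 0 :=
    mul_ne_zero h3 (mul_ne_zero (mul_ne_zero (hpa' 2 1 (by decide)) (hpa' 1 0 (by decide))) hx1)
  apply hne
  -- Write `A, B, C` for the three products in `key`. Then `k2`, `k5`, `k3` give `A * x 2 2 = B * x
  -- 0 1 = -C * x 1 2 = -A * x 2 1`, while `k7` says `A * (x 2 1 - x 2 2) = B * x 0 1`.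
  linear_combination -k7 - k3 + k2 + k5

theorem cubicPlaneSystem (hV : Module.finrank K V = 4) (h3 : (3 : K) ≠ 0)
    (hv : FailsOnCubicCones (K := K) v)
    (h8 : ∀ f : Module.Dual K V, (zeroSet v f).card ≠ 8)
    (h9 : ∀ f : Module.Dual K V, f ≠ 0 → (zeroSet v f).card ≠ 9) :
    CubicPlaneSystem (fun s => ∃ f : Module.Dual K V, f ≠ 0 ∧ zeroSet v f = s)
      (fun i j k => v k ∈ Submodule.span K {v i, v j}) where
  exists_plane i j k := by
    obtain ⟨f, hf, hi, hj, hk⟩ := exists_dual_triple (K := K) hV v i j k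
    exact ⟨_, ⟨f, hf, rfl⟩, mem_zeroSet.2 hi, mem_zeroSet.2 hj, mem_zeroSet.2 hk⟩
  mem_of_col := by
    rintro i j k _ hc ⟨f, hf, rfl⟩ - hi hj
    rw [mem_zeroSet] at hi hj ⊢
    have : Submodule.span K {v i, v j} ≤ LinearMap.ker f := by
      rw [Submodule.span_le]
      rintro _ (rfl | rfl) <;> assumption
    exact this hc
  col_of_ne := by
    rintro i j k _ _ ⟨f, hf, rfl⟩ ⟨g, hg, rfl⟩ hfg hij h1 h2 h3 h4 h5 h6
    rw [mem_zeroSet] at h1 h2 h3 h4 h5 h6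
    exact hv.mem_span_of_zeroSet_ne hV hf hg hfg hij h1 h2 h3 h4 h5 h6
  col_swap := col_swap
  col_rotate := hv.col_rotate
  not_four h1 h2 h3 h4 h5 h6 h := hv.not_four_collinear _ _ _ _ h1 h2 h3 h4 h5 h6 h
  card_ne_four := by
    rintro _ ⟨f, hf, rfl⟩
    exact hv.card_zeroSet_ne_four hV (by simp) hf
  card_ne_eight := by
    rintro _ ⟨f, hf, rfl⟩
    exact h8 f
  card_ne_nine := by
    rintro _ ⟨f, hf, rfl⟩
    exact h9 f hf
  notMem_of_not_col := by
    rintro _ _ _ x y z ⟨f, hf, rfl⟩ ⟨g, hg, rfl⟩ ⟨h, hh, rfl⟩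
    exact hv.notMem_zeroSet hV hh
  not_transversal := by
    rintro a b c _ hs ha hb hc hab hac hbc ⟨α, -, rfl⟩ hP
    exact hv.not_transversal hV h3 hs ha hb hc hab hac hbc hP
  exists_three_lt := by
    obtain ⟨f, hf, hf3⟩ := hv.exists_three_lt_card_zeroSet hV
    exact ⟨_, ⟨f, hf, rfl⟩, hf3⟩

end FailsOnCubicCones

end

/-! ### From the array to the grid -/

section

section Grid

variable {K : Type*} [Field K]

theorem Projectivization.submodule_eq_iff {V : Type*} [AddCommGroup V] [Module K V] {p : ℙ K V}
    {v : V} (hv : v ≠ 0) : p.submodule = Submodule.span K {v} ↔ p = Projectivization.mk K v hv := by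
  rw [← Projectivization.submodule_mk v hv, Projectivization.submodule_injective.eq_iff]

theorem finrank_span_pair_eq_two {V : Type*} [AddCommGroup V] [Module K V] {a b : V} (ha : a ≠ 0)
    (hab : b ∉ Submodule.span K {a}) : Module.finrank K (Submodule.span K {a, b}) = 2 := by
  have hli : LinearIndependent K ![a, b] := by
    rw [LinearIndependent.pair_iff' ha]
    intro c hc
    exact hab (hc ▸ Submodule.smul_mem _ _ (Submodule.mem_span_singleton_self a))
  have := finrank_span_eq_card hli
  rwa [Matrix.range_cons_cons_empty, Fintype.card_fin] at this

namespace FailsOnCubicCones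

variable {V : Type*} [AddCommGroup V] [Module K V] [FiniteDimensional K V] {v : Fin 9 → V}

/-- Two rows that meet are coplanar, and their plane would contain six points. -/
theorem span_inf_span_eq_bot (hV : Module.finrank K V = 4)
    (h5 : ∀ f : Module.Dual K V, f ≠ 0 → (zeroSet v f).card ≤ 5) {p : Fin 3 → Fin 3 → Fin 9}
    (hp : ∀ i j i' j', p i j = p i' j' → i = i' ∧ j = j')
    (hrow : ∀ i, v (p i 2) ∈ Submodule.span K {v (p i 0), v (p i 1)}) {i i' : Fin 3} (hi : i ≠ i') :
    Submodule.span K {v (p i 0), v (p i 1)} ⊓ Submodule.span K {v (p i' 0), v (p i' 1)} = ⊥ := by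
  by_contra hne
  have h1 := Submodule.finrank_sup_add_finrank_inf_eq (Submodule.span K {v (p i 0), v (p i 1)})
    (Submodule.span K {v (p i' 0), v (p i' 1)})
  have h2 := finrank_span_pair_le (K := K) (v (p i 0)) (v (p i 1))
  have h3 := finrank_span_pair_le (K := K) (v (p i' 0)) (v (p i' 1))
  have h4 : 0 < Module.finrank K ↥(Submodule.span K {v (p i 0), v (p i 1)} ⊓
      Submodule.span K {v (p i' 0), v (p i' 1)}) := by
    rw [Nat.pos_iff_ne_zero, Ne, Submodule.finrank_eq_zero]
    exact hne
  obtain ⟨f, hf0, hf⟩ := exists_dual_ne_zero_of_finrank_lt (K := K)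
    (U := Submodule.span K {v (p i 0), v (p i 1)} ⊔ Submodule.span K {v (p i' 0), v (p i' 1)})
    (by omega)
  have hmem : ∀ m, (m = i ∨ m = i') → ∀ j, f (v (p m j)) = 0 := by
    intro m hm j
    have : v (p m j) ∈ Submodule.span K {v (p m 0), v (p m 1)} := by
      have : j = 0 ∨ j = 1 ∨ j = 2 := by omega
      rcases this with rfl | rfl | rfl
      exacts [Submodule.subset_span (by simp), Submodule.subset_span (by simp), hrow m]
    rcases hm with rfl | rfl
    · exact hf _ (Submodule.mem_sup_left this)
    · exact hf _ (Submodule.mem_sup_right this)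
  have hcard : ((({i, i'} : Finset (Fin 3)) ×ˢ (Finset.univ : Finset (Fin 3))).image
      fun x => p x.1 x.2).card = 6 := by
    rw [Finset.card_image_of_injective _ fun x y hxy => Prod.ext_iff.2 (hp _ _ _ _ hxy),
      Finset.card_product, Finset.card_pair hi]
    rfl
  have := Finset.card_le_card (s := (({i, i'} : Finset (Fin 3)) ×ˢ
      (Finset.univ : Finset (Fin 3))).image fun x => p x.1 x.2) (t := zeroSet v f) (by
    intro n hn
    simp only [Finset.mem_image, Finset.mem_product, Finset.mem_insert, Finset.mem_singleton,
      Finset.mem_univ, and_true, Prod.exists] at hn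
    obtain ⟨m, j, hm, rfl⟩ := hn
    exact mem_zeroSet.2 (hmem m hm j))
  have := h5 f hf0
  omega

theorem isGrid_range [Infinite K] {v : Fin 9 → Fin 4 → K} (h3 : (3 : K) ≠ 0)
    (hv : FailsOnCubicCones (K := K) v)
    (h8 : ∀ f : Module.Dual K (Fin 4 → K), (zeroSet v f).card ≠ 8)
    (h9 : ∀ f : Module.Dual K (Fin 4 → K), f ≠ 0 → (zeroSet v f).card ≠ 9) :
    IsGrid 3 3 (Set.range fun n => Projectivization.mk K (v n) (hv.ne_zero n)) := by
  have hV : Module.finrank K (Fin 4 → K) = 4 := Module.finrank_fin_fun K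
  have hs := hv.cubicPlaneSystem hV h3 h8 h9
  have h5 : ∀ f : Module.Dual K (Fin 4 → K), f ≠ 0 → (zeroSet v f).card ≤ 5 := fun f hf => by
    have := hs.card_le_three_or_eq_five ⟨f, hf, rfl⟩
    omega
  obtain ⟨p, hp, hrow, hcol⟩ := hs.isArray
  have hsurj : ∀ n, ∃ i j, p i j = n := by
    have hinj : Function.Injective fun x : Fin 3 × Fin 3 => p x.1 x.2 := fun x y hxy =>
      Prod.ext_iff.2 (hp _ _ _ _ hxy)
    have := ((Fintype.bijective_iff_injective_and_card _).2 ⟨hinj, by simp⟩).2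
    intro n
    obtain ⟨x, hx⟩ := this n
    exact ⟨_, _, hx⟩
  let L : Fin 3 → Submodule K (Fin 4 → K) := fun i => Submodule.span K {v (p i 0), v (p i 1)}
  let M : Fin 3 → Submodule K (Fin 4 → K) := fun j => Submodule.span K {v (p 0 j), v (p 1 j)}
  have hL : ∀ i, Module.finrank K (L i) = 2 := fun i => finrank_span_pair_eq_two (hv.ne_zero _)
    (hv.notMem_span_singleton _ _ fun h => absurd (hp _ _ _ _ h).2 (by decide))
  have hM : ∀ i, Module.finrank K (M i) = 2 := fun i => finrank_span_pair_eq_two (hv.ne_zero _)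
    (hv.notMem_span_singleton _ _ fun h => absurd (hp _ _ _ _ h).1 (by decide))
  have hLm : ∀ i j, v (p i j) ∈ L i := by
    intro i j
    have : j = 0 ∨ j = 1 ∨ j = 2 := by omega
    rcases this with rfl | rfl | rfl
    exacts [Submodule.subset_span (by simp), Submodule.subset_span (by simp), hrow i]
  have hMm : ∀ i j, v (p i j) ∈ M j := by
    intro i j
    have : i = 0 ∨ i = 1 ∨ i = 2 := by omega
    rcases this with rfl | rfl | rfl
    exacts [Submodule.subset_span (by simp), Submodule.subset_span (by simp), hcol j]
  have hLL : ∀ i i', i ≠ i' → L i ⊓ L i' = ⊥ := fun i i' hi =>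
    span_inf_span_eq_bot hV h5 hp hrow hi
  have hMM : ∀ i i', i ≠ i' → M i ⊓ M i' = ⊥ := fun i i' hi =>
    span_inf_span_eq_bot hV h5 (p := fun i j => p j i)
      (fun i j i' j' h => (hp _ _ _ _ h).symm) hcol hi
  have hLM : ∀ i j, L i ⊓ M j = Submodule.span K {v (p i j)} := by
    intro i j
    symm
    have hle : Submodule.span K {v (p i j)} ≤ L i ⊓ M j := by
      rw [Submodule.span_singleton_le_iff_mem]
      exact ⟨hLm i j, hMm i j⟩
    refine Submodule.eq_of_le_of_finrank_le hle ?_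
    rw [finrank_span_singleton (hv.ne_zero _)]
    -- Otherwise row `i` and column `j` are the same line, so any other column would meet column `j`
    -- in a point of this row.
    by_contra! hlt
    have h1 : L i ⊓ M j = M j :=
      Submodule.eq_of_le_of_finrank_le inf_le_right (by rw [hM]; omega)
    have h2 : L i ⊓ M j = L i :=
      Submodule.eq_of_le_of_finrank_le inf_le_left (by rw [hL]; omega)
    obtain ⟨j', hj'⟩ := exists_ne j
    have : v (p i j') ∈ M j' ⊓ M j := ⟨hMm i j', (h1.symm.trans h2).ge (hLm i j')⟩
    rw [hMM j' j hj'] at this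
    exact hv.ne_zero _ this
  refine ⟨L, M, hL, hM, hLL, hMM, fun i j => ?_, ?_⟩
  · rw [hLM]
    exact finrank_span_singleton (hv.ne_zero _)
  · ext q
    simp only [Set.mem_range, Set.mem_ofPred_eq, hLM, Projectivization.submodule_eq_iff (hv.ne_zero _)]
    constructor
    · rintro ⟨n, rfl⟩
      obtain ⟨i, j, rfl⟩ := hsurj n
      exact ⟨i, j, rfl⟩
    · rintro ⟨i, j, rfl⟩
      exact ⟨_, rfl⟩

end FailsOnCubicCones

theorem isGrid_of_generalProjection [Infinite K] (h3 : (3 : K) ≠ 0)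
    {Z : Finset (ℙ K (Fin 4 → K))} (hZ : Z.card = 9)
    (hnd : NonDegenerate (n := 3) (Z : Set (ℙ K (Fin 4 → K))))
    (h : GeneralProjectionIsCompleteIntersection 3 3 (Z : Set (ℙ K (Fin 4 → K)))) :
    IsGrid 3 3 (Z : Set (ℙ K (Fin 4 → K))) := by
  have hv := failsOnCubicCones_of_generalProjection hZ h
  let e : Fin 9 ≃ Z := (Fintype.equivFinOfCardEq (by simp [hZ])).symm
  have hv' := hv.comp_equiv e
  have := hv'.isGrid_range h3
    (fun f => by rw [FailsOnCubicCones.card_zeroSet_comp_equiv]; exact card_zeroSet_ne_eight hZ h f)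
    (fun f hf h9 => by
      have huniv := (Finset.card_eq_iff_eq_univ _).1 (h9.trans (Fintype.card_fin 9).symm)
      obtain ⟨p, hp, hpf⟩ := hnd (LinearMap.ker f) (by
        have := finrank_ker_dual hf
        rw [Module.finrank_fin_fun] at this
        exact Nat.succ_injective this)
      apply hpf
      rw [Projectivization.submodule_eq, Submodule.span_singleton_le_iff_mem, LinearMap.mem_ker]
      have := mem_zeroSet.1 (huniv.ge (Finset.mem_univ (e.symm ⟨p, hp⟩)))
      simpa using this)
  convert this
  ext q
  simp only [Function.comp_apply, Projectivization.mk_rep, Set.mem_range]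
  constructor
  · intro hq
    exact ⟨e.symm ⟨q, hq⟩, by simp⟩
  · rintro ⟨n, rfl⟩
    exact (e n).2

end Grid

end

/-! ### Products of row lines and column lines generate the ideal -/

section

open MvPolynomial

section CompleteIntersection

variable {K : Type*} [Field K]

/-- The homogeneous ideal of a point of the plane is generated by two linear forms. -/
theorem mem_span_pair_linearPoly [Infinite K] {n : ℕ} {l m : Module.Dual K (Fin n → K)}
    {w : Fin n → K} (hw : w ≠ 0) (hlm : LinearMap.ker l ⊓ LinearMap.ker m ≤ Submodule.span K {w})
    {H : MvPolynomial (Fin n) K} (hH : ∀ t : K, t ≠ 0 → eval (t • w) H = 0) :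
    H ∈ Ideal.span {linearPoly l, linearPoly m} := by
  obtain ⟨k, hk⟩ : ∃ k : Module.Dual K (Fin n → K), k w = 1 := by
    obtain ⟨i, hi⟩ := Function.ne_iff.1 hw
    exact ⟨(w i)⁻¹ • LinearMap.proj i, by simpa using inv_mul_cancel₀ hi⟩
  set J := Ideal.span {linearPoly l, linearPoly m} with hJ
  -- Modulo `J`, each coordinate is a multiple of the single form `k`. So the class of `H` is
  -- determined by its restriction to the line of `w`, a polynomial with infinitely many zeros.
  have hX : ∀ i, Ideal.Quotient.mk J (X i) = algebraMap K _ (w i) * Ideal.Quotient.mk J (linearPoly k) := by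
    intro i
    obtain ⟨s, t, hst⟩ := exists_eq_smul_add_smul_of_ker_le (f := l) (g := m)
      (h := LinearMap.proj i - w i • k) (fun y hy => by
        obtain ⟨c, rfl⟩ := Submodule.mem_span_singleton.1 (hlm hy)
        simp [hk])
    have e : X i - C (w i) * linearPoly k = C s * linearPoly l + C t * linearPoly m := by
      refine MvPolynomial.funext fun y => ?_
      have := LinearMap.congr_fun hst y
      simpa using this
    have : X i - C (w i) * linearPoly k ∈ J := by
      rw [e]
      exact J.add_mem (J.mul_mem_left _ (Ideal.subset_span (by simp)))
        (J.mul_mem_left _ (Ideal.subset_span (by simp)))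
    rw [← Ideal.Quotient.mk_eq_mk_iff_sub_mem] at this
    rw [this, map_mul]
    rfl
  let p : Polynomial K := MvPolynomial.aeval (fun i => Polynomial.C (w i) * Polynomial.X) H
  have hp : p = 0 := by
    refine Polynomial.eq_zero_of_infinite_isRoot p
      ((Set.finite_singleton (0 : K)).infinite_compl.mono fun t ht => ?_)
    have : p.eval t = eval (t • w) H := by
      simp only [p]
      rw [← Polynomial.coe_aeval_eq_eval, ← AlgHom.comp_apply, MvPolynomial.comp_aeval]
      have h : (fun i => Polynomial.aeval t (Polynomial.C (w i) * Polynomial.X)) = t • w := by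
        ext i
        simp only [map_mul, Polynomial.aeval_C, Polynomial.aeval_X, Pi.smul_apply, smul_eq_mul,
          Algebra.algebraMap_self, RingHom.id_apply]
        exact mul_comm _ _
      rw [h]
      rfl
    exact this.trans (hH t ht)
  rw [← Ideal.Quotient.eq_zero_iff_mem]
  have h1 : (Ideal.Quotient.mkₐ K J) H = Polynomial.aeval (Ideal.Quotient.mk J (linearPoly k)) p := by
    simp only [p]
    rw [← AlgHom.comp_apply, MvPolynomial.comp_aeval]
    have h : (fun i => Polynomial.aeval (Ideal.Quotient.mk J (linearPoly k))
        (Polynomial.C (w i) * Polynomial.X)) = fun i => (Ideal.Quotient.mkₐ K J) (X i) := by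
      ext i
      rw [Ideal.Quotient.mkₐ_eq_mk, hX]
      simp
    rw [h, ← MvPolynomial.comp_aeval, MvPolynomial.aeval_X_left]
    rfl
  rw [hp, map_zero] at h1
  exact h1

theorem totalDegree_linearPoly {n : ℕ} {l : Module.Dual K (Fin n → K)} (hl : l ≠ 0) :
    (linearPoly l).totalDegree = 1 :=
  (isHomogeneous_linearPoly l).totalDegree (linearPoly_ne_zero hl)

/-- By degrees, a nonconstant common divisor is a constant multiple of `l` and divides `m`, so `m`
would vanish at `y`. -/
theorem isRelPrime_linearPoly {n : ℕ} {l m : Module.Dual K (Fin n → K)} (hl : l ≠ 0)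
    {y : Fin n → K} (hly : l y = 0) (hmy : m y ≠ 0) : IsRelPrime (linearPoly l) (linearPoly m) := by
  have hm : m ≠ 0 := by
    rintro rfl
    exact hmy rfl
  rintro d ⟨e, he⟩ ⟨e', he'⟩
  have hle : d * e ≠ 0 := he ▸ linearPoly_ne_zero hl
  have hme : d * e' ≠ 0 := he' ▸ linearPoly_ne_zero hm
  have h1 := totalDegree_linearPoly hl
  have h2 := totalDegree_linearPoly hm
  rw [he, totalDegree_mul_of_isDomain (left_ne_zero_of_mul hle) (right_ne_zero_of_mul hle)] at h1
  rw [he', totalDegree_mul_of_isDomain (left_ne_zero_of_mul hme) (right_ne_zero_of_mul hme)] at h2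
  by_cases hd : d.totalDegree = 0
  · rw [totalDegree_eq_zero_iff_eq_C.1 hd] at hle ⊢
    refine IsUnit.map C (isUnit_iff_ne_zero.2 fun h => hle ?_)
    rw [h, C_0, zero_mul]
  · exfalso
    have e0 := totalDegree_eq_zero_iff_eq_C.1 (show e.totalDegree = 0 by omega)
    have e1 := congrArg (eval y) he
    have e2 := congrArg (eval y) he'
    rw [e0, eval_linearPoly, hly, map_mul, eval_C] at e1
    rw [eval_linearPoly, map_mul] at e2
    rcases mul_eq_zero.1 e1.symm with h | h
    · rw [h, zero_mul] at e2
      exact hmy e2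
    · rw [e0, h, C_0, mul_zero] at hle
      exact hle rfl

variable {l m : Fin 3 → Module.Dual K (Fin 3 → K)} {w : Fin 3 → Fin 3 → Fin 3 → K}
  (hl : ∀ i i' j, l i (w i' j) = 0 ↔ i' = i) (hm : ∀ j i j', m j (w i j') = 0 ↔ j' = j)

include hl hm

theorem ker_inf_ker_le_of_grid (i j : Fin 3) :
    LinearMap.ker (l i) ⊓ LinearMap.ker (m j) ≤ Submodule.span K {w i j} := by
  obtain ⟨i', hi'⟩ := exists_ne i
  obtain ⟨j', hj'⟩ := exists_ne j
  have hli : l i ≠ 0 := fun h => hi' ((hl i i' j).1 (by rw [h]; rfl))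
  have hw : w i j ≠ 0 := fun h => hi' ((hl i' i j).1 (by rw [h, map_zero])).symm
  have h1 := finrank_ker_dual hli
  rw [Module.finrank_fin_fun] at h1
  have hlt : LinearMap.ker (l i) ⊓ LinearMap.ker (m j) < LinearMap.ker (l i) := by
    refine lt_of_le_of_ne inf_le_left fun e => hj' ((hm j i j').1 ?_)
    have : w i j' ∈ LinearMap.ker (l i) := (hl i i j').2 rfl
    exact (e.ge this).2
  have h2 := Submodule.finrank_lt_finrank_of_lt hlt
  have hle : Submodule.span K {w i j} ≤ LinearMap.ker (l i) ⊓ LinearMap.ker (m j) := by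
    rw [Submodule.span_singleton_le_iff_mem]
    exact ⟨(hl i i j).2 rfl, (hm j i j).2 rfl⟩
  exact (Submodule.eq_of_le_of_finrank_le hle (by rw [finrank_span_singleton hw]; omega)).ge

/-- Induction on the points of the row. At a further point `l i` vanishes and the product of the
earlier column lines does not, so the cofactor of the product vanishes there and is in the ideal of
this point. -/
theorem mem_span_of_row [Infinite K] (i : Fin 3) (T : Finset (Fin 3)) (H : MvPolynomial (Fin 3) K)
    (hH : ∀ j ∈ T, ∀ t : K, t ≠ 0 → eval (t • w i j) H = 0) :
    H ∈ Ideal.span {linearPoly (l i), ∏ j ∈ T, linearPoly (m j)} := by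
  induction T using Finset.induction_on with
  | empty =>
    rw [Finset.prod_empty]
    exact Ideal.mem_span_pair.2 ⟨0, H, by simp⟩
  | insert a T ha ih =>
    obtain ⟨A, B, hAB⟩ := Ideal.mem_span_pair.1
      (ih fun j hj => hH j (Finset.mem_insert_of_mem hj))
    obtain ⟨i', hi'⟩ := exists_ne i
    have hw : w i a ≠ 0 := fun h => hi' ((hl i' i a).1 (by rw [h, map_zero])).symm
    have hB := mem_span_pair_linearPoly hw (ker_inf_ker_le_of_grid hl hm i a) (H := B) (by
      intro t ht
      have h1 := hH a (Finset.mem_insert_self _ _) t ht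
      rw [← hAB] at h1
      simp only [map_add, map_mul, eval_linearPoly, map_smul, (hl i i a).2 rfl, mul_zero,
        zero_add, mul_eq_zero, map_prod, Finset.prod_eq_zero_iff, smul_eq_mul] at h1
      refine h1.resolve_right ?_
      rintro ⟨j, hj, h | h⟩
      · exact ht h
      · exact ha (((hm j i a).1 h) ▸ hj))
    obtain ⟨C, D, hCD⟩ := Ideal.mem_span_pair.1 hB
    refine Ideal.mem_span_pair.2 ⟨A + C * ∏ j ∈ T, linearPoly (m j), D, ?_⟩
    rw [Finset.prod_insert ha, ← hAB, ← hCD]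
    ring

/-- Induction on the rows. After division by the ideal of one row, the cofactor of its line vanishes
on the other rows, because this line contains none of their points. -/
theorem mem_span_of_rows [Infinite K] (S : Finset (Fin 3)) (H : MvPolynomial (Fin 3) K)
    (hH : ∀ i ∈ S, ∀ j, ∀ t : K, t ≠ 0 → eval (t • w i j) H = 0) :
    H ∈ Ideal.span {∏ i ∈ S, linearPoly (l i), ∏ j, linearPoly (m j)} := by
  induction S using Finset.induction_on generalizing H with
  | empty =>
    rw [Finset.prod_empty]
    exact Ideal.mem_span_pair.2 ⟨H, 0, by simp⟩
  | insert a S ha ih =>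
    obtain ⟨A, B, hAB⟩ := Ideal.mem_span_pair.1 (mem_span_of_row hl hm a Finset.univ H
      fun j _ => hH a (Finset.mem_insert_self _ _) j)
    obtain ⟨C, D, hCD⟩ := Ideal.mem_span_pair.1 (ih A (by
      intro i hi j t ht
      have h1 := hH i (Finset.mem_insert_of_mem hi) j t ht
      have h2 : eval (t • w i j) (∏ x, linearPoly (m x)) = 0 := by
        rw [map_prod]
        exact Finset.prod_eq_zero (Finset.mem_univ j)
          (by rw [eval_linearPoly, map_smul, (hm j i j).2 rfl, smul_zero])
      rw [← hAB, map_add, map_mul, map_mul, h2, mul_zero, add_zero, eval_linearPoly, map_smul,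
        smul_eq_mul, mul_eq_zero, mul_eq_zero] at h1
      rcases h1 with h | h | h
      · exact h
      · exact absurd h ht
      · exact absurd (((hl a i j).1 h) ▸ hi) ha))
    refine Ideal.mem_span_pair.2 ⟨C, D * linearPoly (l a) + B, ?_⟩
    rw [Finset.prod_insert ha, ← hAB, ← hCD]
    ring

theorem mem_span_iff_of_grid [Infinite K] (H : MvPolynomial (Fin 3) K) :
    H ∈ Ideal.span {∏ i, linearPoly (l i), ∏ j, linearPoly (m j)} ↔
      ∀ i j, ∀ t : K, eval (t • w i j) H = 0 := by
  refine ⟨fun h i j t => ?_, fun h => mem_span_of_rows hl hm _ H fun i _ j t _ => h i j t⟩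
  obtain ⟨A, B, rfl⟩ := Ideal.mem_span_pair.1 h
  have h1 : eval (t • w i j) (∏ x, linearPoly (l x)) = 0 := by
    rw [map_prod]
    exact Finset.prod_eq_zero (Finset.mem_univ i)
      (by rw [eval_linearPoly, map_smul, (hl i i j).2 rfl, smul_zero])
  have h2 : eval (t • w i j) (∏ x, linearPoly (m x)) = 0 := by
    rw [map_prod]
    exact Finset.prod_eq_zero (Finset.mem_univ j)
      (by rw [eval_linearPoly, map_smul, (hm j i j).2 rfl, smul_zero])
  rw [map_add, map_mul, map_mul, h1, h2, mul_zero, mul_zero, add_zero]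

theorem isRelPrime_prod_of_grid : IsRelPrime (∏ i, linearPoly (l i)) (∏ j, linearPoly (m j)) := by
  refine IsRelPrime.prod_left fun i _ => IsRelPrime.prod_right fun j _ => ?_
  obtain ⟨i', hi'⟩ := exists_ne i
  obtain ⟨j', hj'⟩ := exists_ne j
  have hli : l i ≠ 0 := fun h => hi' ((hl i i' j).1 (by rw [h]; rfl))
  exact isRelPrime_linearPoly hli ((hl i i j').2 rfl) fun h => hj' ((hm j i j').1 h)

end CompleteIntersection

end

/-! ### Grids are non-degenerate and project to complete intersections -/

section

open MvPolynomial

section GridProjection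

variable {K : Type*} [Field K]

theorem Submodule.exists_projectivization {V : Type*} [AddCommGroup V] [Module K V]
    {U : Submodule K V} (hU : Module.finrank K U = 1) : ∃ p : ℙ K V, p.submodule = U := by
  obtain ⟨v, hv, hv0⟩ := Submodule.exists_mem_ne_zero_of_ne_bot (p := U) (by
    rintro rfl
    simp at hU)
  have : FiniteDimensional K U := Module.finite_of_finrank_pos (by omega)
  refine ⟨Projectivization.mk K v hv0, ?_⟩
  rw [Projectivization.submodule_mk]
  exact Submodule.eq_of_le_of_finrank_le (by rwa [Submodule.span_singleton_le_iff_mem])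
    (by rw [hU, finrank_span_singleton hv0])

/-- The points of a grid, by row and column. -/
theorem IsGrid.exists_points {Z : Set (ℙ K (Fin 4 → K))} (hZ : IsGrid 3 3 Z) :
    ∃ (L M : Fin 3 → Submodule K (Fin 4 → K)) (P : Fin 3 → Fin 3 → ℙ K (Fin 4 → K)),
      (∀ i, Module.finrank K (L i) = 2) ∧ (∀ j, Module.finrank K (M j) = 2) ∧
      (∀ i i', i ≠ i' → L i ⊓ L i' = ⊥) ∧ (∀ j j', j ≠ j' → M j ⊓ M j' = ⊥) ∧
      (∀ i j, Module.finrank K ↥(L i ⊓ M j) = 1) ∧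
      (∀ i j, (P i j).rep ∈ L i) ∧ (∀ i j, (P i j).rep ∈ M j) ∧ ∀ p, p ∈ Z ↔ ∃ i j, p = P i j := by
  obtain ⟨L, M, hL, hM, hLL, hMM, hLM, rfl⟩ := hZ
  choose P hP using fun i j => Submodule.exists_projectivization (hLM i j)
  have hmem : ∀ i j, (P i j).rep ∈ L i ⊓ M j := by
    intro i j
    rw [← hP, Projectivization.submodule_eq]
    exact Submodule.mem_span_singleton_self _
  refine ⟨L, M, P, hL, hM, hLL, hMM, hLM, fun i j => (hmem i j).1, fun i j => (hmem i j).2,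
    fun p => ?_⟩
  simp only [Set.mem_ofPred_eq, ← hP, Projectivization.submodule_injective.eq_iff]

theorem le_of_mem_of_mem {V : Type*} [AddCommGroup V] [Module K V] [FiniteDimensional K V]
    {L M M' U : Submodule K V} {a b : V}
    (hL : Module.finrank K L = 2) (hMM : M ⊓ M' = ⊥) (ha0 : a ≠ 0) (hb0 : b ≠ 0) (ha : a ∈ L)
    (hb : b ∈ L) (haM : a ∈ M) (hbM : b ∈ M') (haU : a ∈ U) (hbU : b ∈ U) : L ≤ U := by
  have hab : b ∉ Submodule.span K {a} := by
    intro h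
    have : b ∈ M ⊓ M' := ⟨(Submodule.span_singleton_le_iff_mem _ _).2 haM h, hbM⟩
    rw [hMM] at this
    exact hb0 this
  have h2 := finrank_span_pair_eq_two ha0 hab
  have hle : Submodule.span K {a, b} ≤ L := by
    rw [Submodule.span_le]
    rintro _ (rfl | rfl) <;> assumption
  rw [← Submodule.eq_of_le_of_finrank_le hle (by omega), Submodule.span_le]
  rintro _ (rfl | rfl) <;> assumption

/-- A plane that contains all points contains the rows, but two skew rows span the whole space. -/
theorem IsGrid.nonDegenerate {Z : Set (ℙ K (Fin 4 → K))} (hZ : IsGrid 3 3 Z) :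
    NonDegenerate (n := 3) Z := by
  obtain ⟨L, M, P, hL, hM, hLL, hMM, -, hPL, hPM, hP⟩ := hZ.exists_points
  intro H hH
  by_contra! hcon
  have hmem : ∀ i j, (P i j).rep ∈ H := fun i j => by
    have := hcon (P i j) ((hP _).2 ⟨i, j, rfl⟩)
    rwa [Projectivization.submodule_eq, Submodule.span_singleton_le_iff_mem] at this
  have hle : ∀ i, L i ≤ H := fun i =>
    le_of_mem_of_mem (hL i) (hMM 0 1 (by decide)) (P i 0).rep_nonzero (P i 1).rep_nonzero
      (hPL i 0) (hPL i 1) (hPM i 0) (hPM i 1) (hmem i 0) (hmem i 1)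
  have h1 := Submodule.finrank_sup_add_finrank_inf_eq (L 0) (L 1)
  rw [hLL 0 1 (by decide), finrank_bot, hL, hL] at h1
  have h2 : Module.finrank K ↥(L 0 ⊔ L 1) ≤ Module.finrank K H :=
    Submodule.finrank_mono (sup_le (hle 0) (hle 1))
  rw [hH] at h2
  omega

/-- In a projection of a grid from a point outside the planes spanned by a row and a column, the
image of a row is on a line that contains no further points. -/
theorem exists_dual_of_row {V W : Type*} [AddCommGroup V] [Module K V]
    [FiniteDimensional K V] [AddCommGroup W] [Module K W] [FiniteDimensional K W]
    (hV : Module.finrank K V = 4) (hW : Module.finrank K W = 3)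
    {L M : Fin 3 → Submodule K V} {v : Fin 3 → Fin 3 → V} {x : V} {φ : V →ₗ[K] W}
    (hφ : LinearMap.ker φ = Submodule.span K {x})
    (hL : ∀ i, Module.finrank K (L i) = 2) (hM : ∀ j, Module.finrank K (M j) = 2)
    (hLL : ∀ i i', i ≠ i' → L i ⊓ L i' = ⊥) (hLM : ∀ i j, Module.finrank K ↥(L i ⊓ M j) = 1)
    (hv0 : ∀ i j, v i j ≠ 0) (hvL : ∀ i j, v i j ∈ L i) (hvM : ∀ i j, v i j ∈ M j)
    (hx : ∀ i j, x ∉ L i ⊔ M j) (i : Fin 3) :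
    ∃ l : Module.Dual K W, ∀ i' j, l (φ (v i' j)) = 0 ↔ i' = i := by
  obtain ⟨l, hl0, hl⟩ := exists_dual_ne_zero_of_finrank_lt (K := K) (U := (L i).map φ)
    (lt_of_le_of_lt (Submodule.finrank_map_le _ _) (by rw [hL, hW]; norm_num))
  have hli : ∀ y ∈ L i, l (φ y) = 0 := fun y hy => hl _ (Submodule.mem_map_of_mem hy)
  refine ⟨l, fun i' j => ⟨fun h => ?_, ?_⟩⟩
  · by_contra hne
    have hφx : φ x = 0 := by
      have : x ∈ LinearMap.ker φ := hφ.ge (Submodule.mem_span_singleton_self x)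
      exact this
    -- If the line of row `i` contained the image of a point of column `j` in another row, its
    -- preimage would be the plane of row `i` and column `j`. But the preimage contains the centre.
    have hMle : M j ≤ LinearMap.ker (l ∘ₗ φ) :=
      le_of_mem_of_mem (hM j) (hLL i i' (Ne.symm hne)) (hv0 i j) (hv0 i' j) (hvM i j) (hvM i' j)
        (hvL i j) (hvL i' j) (hli _ (hvL i j)) h
    have hle : L i ⊔ M j ≤ LinearMap.ker (l ∘ₗ φ) := sup_le hli hMle
    have hx0 : x ≠ 0 := by
      rintro rfl
      exact hx 0 0 (Submodule.zero_mem _)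
    have hsurj : Function.Surjective φ := by
      rw [← LinearMap.range_eq_top]
      apply Submodule.eq_top_of_finrank_eq
      have := LinearMap.finrank_range_add_finrank_ker φ
      rw [hφ, finrank_span_singleton hx0] at this
      omega
    have hlφ : l ∘ₗ φ ≠ 0 := by
      intro h
      apply hl0
      refine LinearMap.ext fun y => ?_
      obtain ⟨z, rfl⟩ := hsurj y
      exact LinearMap.congr_fun h z
    have h1 := finrank_ker_dual hlφ
    have h2 := Submodule.finrank_sup_add_finrank_inf_eq (L i) (M j)
    rw [hL, hM, hLM] at h2
    apply hx i j
    rw [Submodule.eq_of_le_of_finrank_le hle (by omega), LinearMap.mem_ker, LinearMap.comp_apply,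
      hφx, map_zero]
  · rintro rfl
    exact hli _ (hvL i' j)

theorem IsGrid.generalProjection [Infinite K] {Z : Set (ℙ K (Fin 4 → K))} (hZ : IsGrid 3 3 Z) :
    GeneralProjectionIsCompleteIntersection 3 3 Z := by
  obtain ⟨L, M, P, hL, hM, hLL, hMM, hLM, hPL, hPM, hP⟩ := hZ.exists_points
  -- A row and a column meet, so they span a plane. The product of the nine equations defines the
  -- open set of centres.
  have hplane : ∀ i j, ∃ h : Module.Dual K (Fin 4 → K), h ≠ 0 ∧ ∀ y ∈ L i ⊔ M j, h y = 0 := by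
    intro i j
    refine exists_dual_ne_zero_of_finrank_lt ?_
    have := Submodule.finrank_sup_add_finrank_inf_eq (L i) (M j)
    rw [hL, hM, hLM] at this
    rw [Module.finrank_fin_fun]
    omega
  choose h hh0 hh using hplane
  refine ⟨_, ∏ x : Fin 3 × Fin 3, linearPoly (h x.1 x.2),
    IsHomogeneous.prod _ _ (fun _ => 1) fun x _ => isHomogeneous_linearPoly _,
    Finset.prod_ne_zero_iff.2 fun x _ => linearPoly_ne_zero (hh0 _ _), fun p hp => ?_⟩
  have hp' : ∀ i j, p.rep ∉ L i ⊔ M j := by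
    intro i j hmem
    apply hp
    rw [map_prod]
    exact Finset.prod_eq_zero (Finset.mem_univ (i, j)) (by rw [eval_linearPoly]; exact hh i j _ hmem)
  refine ⟨fun hpZ => ?_, fun φ hφ => ?_⟩
  · obtain ⟨i, j, rfl⟩ := (hP p).1 hpZ
    exact hp' i j (Submodule.mem_sup_left (hPL i j))
  have hker : LinearMap.ker φ = Submodule.span K {p.rep} := by
    rw [← Projectivization.submodule_eq]
    exact hφ
  have hV : Module.finrank K (Fin 4 → K) = 4 := Module.finrank_fin_fun K
  have hW : Module.finrank K (Fin 3 → K) = 3 := Module.finrank_fin_fun K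
  choose l hl using exists_dual_of_row hV hW (v := fun i j => (P i j).rep) hker hL hM hLL hLM
    (fun i j => (P i j).rep_nonzero) hPL hPM hp'
  choose m hm using exists_dual_of_row hV hW (v := fun j i => (P i j).rep) hker hM hL hMM
    (fun j i => by rw [inf_comm]; exact hLM i j) (fun j i => (P i j).rep_nonzero)
    (fun j i => hPM i j) (fun j i => hPL i j) (fun j i => by rw [sup_comm]; exact hp' i j)
  have hm' : ∀ j i j', m j (φ (P i j').rep) = 0 ↔ j' = j := fun j i j' => hm j j' i
  refine ⟨∏ i, linearPoly (l i), ∏ j, linearPoly (m j),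
    IsHomogeneous.prod Finset.univ _ (fun _ => 1) fun x _ => isHomogeneous_linearPoly _,
    IsHomogeneous.prod Finset.univ _ (fun _ => 1) fun x _ => isHomogeneous_linearPoly _,
    isRelPrime_prod_of_grid (w := fun i j => φ (P i j).rep) hl hm', ?_⟩
  have hφ0 : ∀ q ∈ Z, φ q.rep ≠ 0 := by
    intro q hq h0
    obtain ⟨i, j, rfl⟩ := (hP q).1 hq
    obtain ⟨i', hi'⟩ := exists_ne i
    exact hi' ((hl i' i j).1 (by rw [h0, map_zero])).symm
  ext H
  rw [mem_homogeneousIdealOf_projectedSet hφ0,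
    mem_span_iff_of_grid (w := fun i j => φ (P i j).rep) hl hm']
  constructor
  · intro hH i j t
    exact hH _ ((hP _).2 ⟨i, j, rfl⟩) t
  · intro hH q hq t
    obtain ⟨i, j, rfl⟩ := (hP q).1 hq
    exact hH i j t

end GridProjection

end

theorem theorem5p6 {K : Type*} [Field K] [CharZero K]
    (Z : Finset (ℙ K (Fin 4 → K))) (hZ : Z.card = 9) :
    (NonDegenerate (n := 3) (Z : Set (ℙ K (Fin 4 → K))) ∧
      GeneralProjectionIsCompleteIntersection 3 3 (Z : Set (ℙ K (Fin 4 → K)))) ↔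
    IsGrid 3 3 (Z : Set (ℙ K (Fin 4 → K))) :=
  ⟨fun h => isGrid_of_generalProjection (by norm_num) hZ h.1 h.2,
    fun h => ⟨h.nonDegenerate, h.generalProjection⟩⟩
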